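/- Let $d_1,d_2,d_\alpha>0$, let $$\alpha^*=\frac{\pi}{\pi-\arccos\frac15+2\arctan\frac{191\sqrt6}{317}}\approx 0.8439,$$ and let $0<\alpha\le\alpha^*$. On $[a,b]\times[0,T]$ consider $$\partial_t u=-d_1\partial_x u+d_2\partial_x^2u+d_\alpha\frac{\partial^\alpha u}{\partial|x|^\alpha}+s(x,t),\qquad u(x,0)=\varphi(x),\quad u(a,t)=u(b,t)=0,$$ where $\frac{\partial^\alpha u}{\partial|x|^\alpha}=-\frac{1}{2\cos(\pi\alpha/2)}\left({}_{RL}D^\alpha_{a,x}+{}_{RL}D^\alpha_{x,b}\right)u$ is the Riesz derivative built from the left and right Riemann–Liouville derivatives. Let $h=\frac{b-a}{M}$, $\tau=\frac TN$ with integers $M,N\ge1$, $x_j=a+jh$, $t_k=k\tau$, $t_{k+1/2}=(k+\frac12)\tau$, $s_j^{k+1/2}=s(x_j,t_{k+1/2})$, let $\varpi_\ell$ be the Taylor coefficients at $0$ of $\left(\frac{25}{12}-4z+3z^2-\frac43z^3+\frac14z^4\right)^\alpha$, and put $$\nu=\frac{d_\alpha}{2\cos(\pi\alpha/2)h^\alpha},\quad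 a_{1}=\frac1{12}+\frac{d_1h}{24d_2},\quad a_2=\frac56,\quad a_{3}=\frac1{12}-\frac{d_1h}{24d_2},$$ $$b_{1}=\frac{d_2}{h^2}+\frac{d_1^2}{12d_2}+\frac{d_1}{2h},\quad b_2=-2\Big(\frac{d_2}{h^2}+\frac{d_1^2}{12d_2}\Big),\quad b_{3}=\frac{d_2}{h^2}+\frac{d_1^2}{12d_2}-\frac{d_1}{2h},$$ $(Av)_j=a_1v_{j-1}+a_2v_j+a_3v_{j+1}$ and $(Bv)_j=b_1v_{j-1}+b_2v_j+b_3v_{j+1}$. The scheme is $$\frac2\tau(Au^{k+1})_j-(Bu^{k+1})_j+\nu (R u^{k+1})_j=\frac2\tau(Au^{k})_j+(Bu^{k})_j-\nu (Ru^{k})_j+2(As^{k+1/2})_j,\qquad 1\le j\le M-1,\ 0\le k\le N-1,$$ $$(Rv)_j=\sum_{\ell=0}^{j}\varpi_\ell (Av)_{j-\ell}+\sum_{\ell=0}^{M-j}\varpi_\ell (Av)_{j+\ell},$$ with $u_j^k=0$ for $j\le0$ and for $j\ge M$. Let $\|v\|_h=\left(h\sum_{j=1}^{M-1}v_j^2\right)^{1/2}$.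 Then: 1. (Unconditional von Neumann stability.) $\sum_\ell|\varpi_\ell|<\infty$, and for all real $\tau,h>0$ and $\theta\in[-\pi,\pi]$ there is exactly one $\xi\in\mathbb C$ such that $\mathcal E_j^k=\xi^ke^{ij\theta}$ ($j\in\mathbb Z$, $k\ge0$) solves the error equation, that is, the scheme with $s=0$ and with both sums in $R$ extended to $\ell=\infty$; and $|\xi|\le1$. 2. (Solvability and unconditional stability on the grid.) For all $a<b$, $T>0$ and all $M,N\ge1$, the scheme has a solution for all initial values and all source values; and there is a constant $C$, independent of $M$ and $N$, such that any two solutions $u,v$ of the scheme with the same source values satisfy $\|u^k-v^k\|_h\le C\|u^0-v^0\|_h$ for $0\le k\le N$. 3. (Convergence of order $O(\tau^2+h^4)$.) Let $a<b$, $T>0$, let $s$ be continuous and let $u\in C^6([a,b]\times[0,T])$ be a solution of the problem such that $\partial_x^mu(a,t)=\partial_x^mu(b,t)=0$ for $m=0,1,2,3$ and $t\in[0,T]$. Then there is a constant $C$, independent of $M$ and $N$, such that every solution $u_j^k$ of the scheme with $u_j^0=\varphi(x_j)$ satisfies $$\big\|\big(u(x_j,t_k)-u_j^k\big)_j\big\|_h\le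 C(\tau^2+h^4),\qquad 0\le k\le N.$$ -/

import Mathlib

open scoped BigOperators

noncomputable section

namespace RieszDiffusion

/-! Riemann-Liouville and Riesz derivatives of order `0 < α < 1` on `(a, b)`. -/

/-- Left Riemann-Liouville derivative of order `α ∈ (0, 1)`:
`(1 / Γ(1 - α)) d/dx ∫_a^x (x - y)^(-α) f(y) dy`. -/
def leftRL (a α : ℝ) (f : ℝ → ℝ) (x : ℝ) : ℝ :=
  1 / Real.Gamma (1 - α) * deriv (fun z => ∫ y in a..z, (z - y) ^ (-α) * f y) x

/-- Right Riemann-Liouville derivative of order `α ∈ (0, 1)`: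
`(-1 / Γ(1 - α)) d/dx ∫_x^b (y - x)^(-α) f(y) dy`. -/
def rightRL (b α : ℝ) (f : ℝ → ℝ) (x : ℝ) : ℝ :=
  (-1) / Real.Gamma (1 - α) * deriv (fun z => ∫ y in z..b, (y - z) ^ (-α) * f y) x

/-- Riesz derivative of order `α ∈ (0, 1)` on `(a, b)`. -/
def rieszDeriv (a b α : ℝ) (f : ℝ → ℝ) (x : ℝ) : ℝ :=
  -(1 / (2 * Real.cos (Real.pi * α / 2))) * (leftRL a α f x + rightRL b α f x)

/-- `u` is a classical solution on `[a, b] × [0, T]` of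
`u_t = -d₁ u_x + d₂ u_xx + d_α ∂^α u / ∂|x|^α + s`, `u(x, 0) = φ(x)`, `u(a, t) = u(b, t) = 0`,
which is regular enough for the fourth-order Riesz approximation: `u` is `C⁶` up to the boundary,
and the `x`-derivatives of orders `0, 1, 2, 3` vanish at both end points
(order `0` is the boundary condition). -/
structure IsRegularSolution (α d₁ d₂ dα a b T : ℝ) (φ : ℝ → ℝ) (s u : ℝ → ℝ → ℝ) : Prop where
  contDiffOn : ContDiffOn ℝ 6 (fun p : ℝ × ℝ => u p.1 p.2) (Set.Icc a b ×ˢ Set.Icc 0 T)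
  source_continuousOn :
    ContinuousOn (fun p : ℝ × ℝ => s p.1 p.2) (Set.Icc a b ×ˢ Set.Icc 0 T)
  pde : ∀ x ∈ Set.Ioo a b, ∀ t ∈ Set.Ioo 0 T,
    deriv (fun r => u x r) t =
      -d₁ * deriv (fun y => u y t) x + d₂ * iteratedDeriv 2 (fun y => u y t) x
        + dα * rieszDeriv a b α (fun y => u y t) x + s x t
  initial : ∀ x ∈ Set.Icc a b, u x 0 = φ x
  left_vanish : ∀ t ∈ Set.Icc 0 T, ∀ m < 4,
    iteratedDerivWithin m (fun y => u y t) (Set.Icc a b) a = 0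
  right_vanish : ∀ t ∈ Set.Icc 0 T, ∀ m < 4,
    iteratedDerivWithin m (fun y => u y t) (Set.Icc a b) b = 0

/-! The scheme. -/

/-- Generating function `W₄^(α)(z) = (25/12 - 4 z + 3 z² - 4/3 z³ + 1/4 z⁴)^α`. -/
def genFun (α z : ℝ) : ℝ :=
  (25 / 12 - 4 * z + 3 * z ^ 2 - 4 / 3 * z ^ 3 + 1 / 4 * z ^ 4) ^ α

/-- The weight `ϖ_{4,ℓ}^(α)`: the `ℓ`-th Taylor coefficient of `W₄^(α)` at `0`. -/
def weight (α : ℝ) (l : ℕ) : ℝ :=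
  iteratedDeriv l (genFun α) 0 / (l.factorial : ℝ)

/-- `ν = d_α / (2 cos(π α / 2) h^α)`. -/
def nu (α dα h : ℝ) : ℝ := dα / (2 * Real.cos (Real.pi * α / 2) * h ^ α)

def a₁ (d₁ d₂ h : ℝ) : ℝ := 1 / 12 + d₁ * h / (24 * d₂)

def a₂ : ℝ := 5 / 6

def a₃ (d₁ d₂ h : ℝ) : ℝ := 1 / 12 - d₁ * h / (24 * d₂)

def b₁ (d₁ d₂ h : ℝ) : ℝ := d₂ / h ^ 2 + d₁ ^ 2 / (12 * d₂) + d₁ / (2 * h)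

def b₂ (d₁ d₂ h : ℝ) : ℝ := -2 * (d₂ / h ^ 2 + d₁ ^ 2 / (12 * d₂))

def b₃ (d₁ d₂ h : ℝ) : ℝ := d₂ / h ^ 2 + d₁ ^ 2 / (12 * d₂) - d₁ / (2 * h)

/-- Three-point stencil `c₁ v_{j-1} + c₂ v_j + c₃ v_{j+1}` (`v` real or complex valued). -/
def stencil {E : Type*} [AddCommGroup E] [Module ℝ E] (c₁ c₂ c₃ : ℝ) (v : ℤ → E) (j : ℤ) : E :=
  c₁ • v (j - 1) + c₂ • v j + c₃ • v (j + 1)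

/-- The stencil with coefficients `a₁, a₂, a₃`. -/
def avg {E : Type*} [AddCommGroup E] [Module ℝ E] (d₁ d₂ h : ℝ) (v : ℤ → E) (j : ℤ) : E :=
  stencil (a₁ d₁ d₂ h) a₂ (a₃ d₁ d₂ h) v j

/-- The stencil with coefficients `2 aᵢ / τ - bᵢ` (new time level). -/
def newLevel {E : Type*} [AddCommGroup E] [Module ℝ E] (d₁ d₂ τ h : ℝ) (v : ℤ → E) (j : ℤ) : E :=
  stencil (2 * a₁ d₁ d₂ h / τ - b₁ d₁ d₂ h) (2 * a₂ / τ - b₂ d₁ d₂ h)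
    (2 * a₃ d₁ d₂ h / τ - b₃ d₁ d₂ h) v j

/-- The stencil with coefficients `2 aᵢ / τ + bᵢ` (old time level). -/
def oldLevel {E : Type*} [AddCommGroup E] [Module ℝ E] (d₁ d₂ τ h : ℝ) (v : ℤ → E) (j : ℤ) : E :=
  stencil (2 * a₁ d₁ d₂ h / τ + b₁ d₁ d₂ h) (2 * a₂ / τ + b₂ d₁ d₂ h)
    (2 * a₃ d₁ d₂ h / τ + b₃ d₁ d₂ h) v j

/-- The bracket of the scheme on the grid `x_0, …, x_M`:
`∑_{ℓ=0}^{j} ϖ_ℓ (a₁ v_{j-ℓ-1} + a₂ v_{j-ℓ} + a₃ v_{j-ℓ+1})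
+ ∑_{ℓ=0}^{M-j} ϖ_ℓ (a₁ v_{j+ℓ-1} + a₂ v_{j+ℓ} + a₃ v_{j+ℓ+1})`. -/
def bracket (α d₁ d₂ h : ℝ) (M : ℕ) (v : ℤ → ℝ) (j : ℕ) : ℝ :=
  ∑ l ∈ Finset.range (j + 1), weight α l * avg d₁ d₂ h v ((j : ℤ) - l)
    + ∑ l ∈ Finset.range (M - j + 1), weight α l * avg d₁ d₂ h v ((j : ℤ) + l)

/-- The bracket of the error equation of a mode on the whole line (both sums infinite). -/
def bracketInf (α d₁ d₂ h : ℝ) (v : ℤ → ℂ) (j : ℤ) : ℂ :=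
  ∑' l : ℕ, weight α l • avg d₁ d₂ h v (j - l) + ∑' l : ℕ, weight α l • avg d₁ d₂ h v (j + l)

/-- `v` is a grid function with homogeneous boundary values, extended by zero: `v j = 0` unless
`0 < j < M`. -/
def ZeroBoundary (M : ℕ) (v : ℤ → ℝ) : Prop := ∀ j : ℤ, (j ≤ 0 ∨ (M : ℤ) ≤ j) → v j = 0

/-- `U k j` (`0 ≤ k ≤ N`) solves the scheme with source values `S k j = s_j^{k+1/2}`. -/
def IsSchemeSolution (α d₁ d₂ dα τ h : ℝ) (M N : ℕ) (S : ℕ → ℤ → ℝ) (U : ℕ → ℤ → ℝ) : Prop :=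
  (∀ k ≤ N, ZeroBoundary M (U k)) ∧
  ∀ k < N, ∀ j : ℕ, 1 ≤ j → j < M →
    newLevel d₁ d₂ τ h (U (k + 1)) j + nu α dα h * bracket α d₁ d₂ h M (U (k + 1)) j =
      oldLevel d₁ d₂ τ h (U k) j - nu α dα h * bracket α d₁ d₂ h M (U k) j
        + 2 * avg d₁ d₂ h (S k) j

/-- `E_j^k = ξ^k e^{i j θ}` solves the error equation for all `j` and `k`. -/
def IsFourierMode (α d₁ d₂ dα τ h θ : ℝ) (ξ : ℂ) : Prop :=
  let E : ℕ → ℤ → ℂ := fun k j => ξ ^ k * Complex.exp (Complex.I * (j : ℂ) * (θ : ℂ))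
  ∀ (k : ℕ) (j : ℤ),
    newLevel d₁ d₂ τ h (E (k + 1)) j + nu α dα h • bracketInf α d₁ d₂ h (E (k + 1)) j =
      oldLevel d₁ d₂ τ h (E k) j - nu α dα h • bracketInf α d₁ d₂ h (E k) j

/-- Discrete `L²` norm `(h ∑_{j=1}^{M-1} v_j²)^{1/2}`. -/
def gridNorm (h : ℝ) (M : ℕ) (v : ℤ → ℝ) : ℝ :=
  Real.sqrt (h * ∑ j ∈ Finset.Ico 1 M, v (j : ℤ) ^ 2)

/-- The constant `π / (π - arccos(1/5) + 2 arctan(191 √6 / 317)) ≈ 0.8439`. -/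
def alphaMax : ℝ :=
  Real.pi / (Real.pi - Real.arccos (1 / 5) + 2 * Real.arctan (191 * Real.sqrt 6 / 317))

end RieszDiffusion

end

noncomputable section
namespace RieszDiffusion

open Finset Filter Topology

/-! Power series of one real variable. -/

/-! Write Q(z) = Σ_{k=1}^{4} (1-z)^k/k = (1-z) q(z), with q = `bdfQuot`. The weights are the
coefficients of W = (1-z)^α q^α. The first factor has explicit binomial coefficients `gb`; q maps a
disc of radius larger than 1 into the slit plane, so the coefficients of q^α decay geometrically.
Two properties of W carry the proof.

Positivity. On the unit circle the argument of Q is at most π/2 + δ in absolute value, δ =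
`excessAngle`, with the extreme case at Re z = 1/5. The bound `alphaMax` is the α for which α(π/2 +
δ) = π/2, so Re W ≥ 0 there (`re_tsum_weight_nonneg`). For a Fourier mode the scheme is a Cayley
transform (p-g)ξ = p+g with Re(p conj g) ≤ 0, which gives |ξ| ≤ 1. On a finite grid the same
positivity says that the Toeplitz matrix of the symmetrised weights is nonnegative: grid functions
become Laurent polynomials P, and the form is ∫ g |P|² with g ≥ 0 (`lfun_mul_invert_nonneg`).
Testing a step with the new level gives solvability. Testing with the averaged sum of both levels
gives, on fine grids, dissipation of the discrete H¹ seminorm, up to boundary terms that the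
diffusion absorbs (`spaceOp_avg_form_le`). The finitely many coarse grids are treated separately,
with constants depending on M.

Consistency. Since Q(e^{-x}) = x + O(x⁵), convolution with the weights reproduces the fractional
derivative of n^j/j!, j ≤ 4, up to O(n^{-α}) (`monomialConsistent`). For u vanishing to third order
at the ends, a Peano kernel argument turns this into a pointwise error O(h⁴ r^{-α}), r being the
distance to an end point. This is singular at the ends but summable, because α < 1. Stability is
therefore proved with the source measured in discrete L¹ (`IsStep.fine_le`): the H¹ dissipation
controls the maximum norm, which is dual to L¹. Together with Taylor expansion for the compact
stencil and for the midpoint rule in time, the difference of exact and discrete solution satisfies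
the scheme with an L¹ residual O(τ² + h⁴) and zero initial values. -/

theorem hasFPowerSeriesAt_of_hasSum {u : ℕ → ℝ} {f : ℝ → ℝ} {r : ℝ} (hr : 0 < r)
    (h : ∀ x, |x| < r → HasSum (fun n => u n * x ^ n) (f x)) :
    HasFPowerSeriesAt f (FormalMultilinearSeries.ofScalars ℝ u) 0 := by
  refine ⟨ENNReal.ofReal r, ?_, by simpa using hr, ?_⟩
  · refine ENNReal.le_of_forall_nnreal_lt fun s hs => ?_
    have hs' : |(s : ℝ)| < r := by
      rw [NNReal.abs_eq]
      simpa using hs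
    refine FormalMultilinearSeries.le_radius_of_tendsto (l := 0) _ ?_
    have h1 := (h s hs').summable.tendsto_atTop_zero.norm
    simpa [FormalMultilinearSeries.ofScalars_norm] using h1
  · intro y hy
    have hy' : |y| < r := by
      rw [Metric.eball_ofReal] at hy
      simpa using hy
    have := h y hy'
    simpa [FormalMultilinearSeries.ofScalars_apply_eq, smul_eq_mul, mul_comm] using this

/-- Uniqueness of power series: it makes `weight`, defined by iterated derivatives, computable by
products of series. Applied to the zero function it shows that coefficients vanish. -/
theorem iteratedDeriv_div_factorial_of_hasSum {u : ℕ → ℝ} {f : ℝ → ℝ} {r : ℝ} (hr : 0 < r)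
    (h : ∀ x, |x| < r → HasSum (fun n => u n * x ^ n) (f x)) (n : ℕ) :
    iteratedDeriv n f 0 / (n.factorial : ℝ) = u n := by
  have h1 := hasFPowerSeriesAt_of_hasSum hr h
  have h2 := h1.analyticAt.hasFPowerSeriesAt
  have h3 := h2.eq_formalMultilinearSeries h1
  rw [FormalMultilinearSeries.ofScalars_series_eq_iff] at h3
  exact congrFun h3 n

/-! Generalized binomial coefficients. -/

/-- `gb β n` is the `n`-th Taylor coefficient of `(1 - z) ^ (-β - 1)`. -/
def gb (β : ℝ) (n : ℕ) : ℝ := ∏ k ∈ range n, (β + k + 1) / (k + 1)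

@[simp] theorem gb_zero (β : ℝ) : gb β 0 = 1 := by simp [gb]

theorem gb_succ (β : ℝ) (n : ℕ) : gb β (n + 1) = gb β n * ((β + n + 1) / (n + 1)) := by
  rw [gb, prod_range_succ, ← gb]

theorem gb_sub_one_succ (β : ℝ) (n : ℕ) : gb (β - 1) (n + 1) = gb β n * (β / (n + 1)) := by
  induction n with
  | zero => simp [gb_succ]
  | succ n ih =>
    rw [gb_succ, ih, gb_succ]
    push_cast
    have : (n : ℝ) + 1 ≠ 0 := by positivity
    have : (n : ℝ) + 1 + 1 ≠ 0 := by positivity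
    field_simp
    ring

theorem gb_succ_sub (β : ℝ) (n : ℕ) : gb β (n + 1) - gb β n = gb (β - 1) (n + 1) := by
  rw [gb_sub_one_succ, gb_succ]
  have : (n : ℝ) + 1 ≠ 0 := by positivity
  field_simp
  ring

/-- Links the product `gb` to the generalized binomial coefficients in which the complex binomial
series is stated. -/
theorem choose_eq_gb (β : ℝ) (n : ℕ) : Ring.choose (β + 1 + n - 1) n = gb β n := by
  rw [← Ring.multichoose_eq]
  have h := Ring.factorial_nsmul_multichoose_eq_ascPochhammer (β + 1) n
  rw [Polynomial.ascPochhammer_smeval_eq_eval] at h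
  have h2 : (ascPochhammer ℝ n).eval (β + 1) = n.factorial * gb β n := by
    induction n with
    | zero => simp
    | succ n ih =>
      rw [ascPochhammer_succ_right, Polynomial.eval_mul, ih, gb_succ, Nat.factorial_succ]
      · have : (n : ℝ) + 1 ≠ 0 := by positivity
        simp
        field_simp
        ring
      · rw [Ring.factorial_nsmul_multichoose_eq_ascPochhammer,
          Polynomial.ascPochhammer_smeval_eq_eval]
  rw [h2, nsmul_eq_mul] at h
  exact mul_left_cancel₀ (by positivity) h

theorem hasSum_gb (β : ℝ) {z : ℂ} (hz : ‖z‖ < 1) :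
    HasSum (fun n => (gb β n : ℂ) * z ^ n) ((1 - z) ^ (-(β : ℂ) - 1)) := by
  have h := (Complex.one_div_one_sub_cpow_hasFPowerSeriesOnBall_zero (β + 1)).hasSum
    (y := z) (by simpa [← ENNReal.ofReal_one, Metric.eball_ofReal] using hz)
  have h1 : 1 - z ≠ 0 := by
    intro h0
    rw [sub_eq_zero] at h0
    rw [← h0] at hz
    simp at hz
  simp only [zero_add, FormalMultilinearSeries.ofScalars_apply_eq, smul_eq_mul] at h
  have e : (fun n : ℕ => (gb β n : ℂ) * z ^ n) =
      fun n : ℕ => Ring.choose ((β : ℂ) + 1 + n - 1) n * z ^ n := by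
    funext n
    rw [← choose_eq_gb, Complex.ofReal_choose]
    push_cast
    rfl
  rw [e]
  convert! h using 1
  rw [show -(β : ℂ) - 1 = -(β + 1) by ring, Complex.cpow_neg, one_div]

theorem gb_nonneg {β : ℝ} (hβ : -1 ≤ β) (n : ℕ) : 0 ≤ gb β n :=
  prod_nonneg fun k _ => div_nonneg (by have := k.cast_nonneg (α := ℝ); linarith) (by positivity)

theorem gb_pos {β : ℝ} (hβ : -1 < β) (n : ℕ) : 0 < gb β n :=
  prod_pos fun k _ => div_pos (by have := k.cast_nonneg (α := ℝ); linarith) (by positivity)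

/-- All coefficients of (1-z)^α after the first are nonpositive, and by `gb_succ_sub` the partial
sums telescope to `gb (-α)`. The sum of absolute values up to n is therefore 2 - `gb (-α) n`, which
is at most 2. -/
theorem summable_abs_gb {α : ℝ} (h0 : 0 < α) (h1 : α < 1) :
    Summable fun n => |gb (-α - 1) n| := by
  refine summable_of_sum_range_le (c := 2) (fun n => abs_nonneg _) fun n => ?_
  have key : ∀ n, ∑ k ∈ range (n + 1), |gb (-α - 1) k| = 2 - gb (-α) n := by
    intro n
    induction n with
    | zero => norm_num
    | succ n ih =>
      rw [sum_range_succ, ih, abs_of_nonpos, ← gb_succ_sub]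
      · ring
      · rw [gb_sub_one_succ]
        exact mul_nonpos_of_nonneg_of_nonpos (gb_nonneg (by linarith) n)
          (div_nonpos_of_nonpos_of_nonneg (by linarith) (by positivity))
  cases n with
  | zero => norm_num
  | succ n => rw [key]; linarith [gb_nonneg (show (-1 : ℝ) ≤ -α by linarith) n]

end RieszDiffusion
end

noncomputable section
namespace RieszDiffusion

open Finset Filter Topology

/-! The generating function on the unit disc. -/

/-- The quotient of `25/12 - 4z + 3z² - 4z³/3 + z⁴/4` by `1 - z`. -/
def bdfQuot {K : Type*} [Field K] (z : K) : K :=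
  1 + (1 - z) / 2 + (1 - z) ^ 2 / 3 + (1 - z) ^ 3 / 4

theorem bdfQuot_ofReal (x : ℝ) : bdfQuot (x : ℂ) = (bdfQuot x : ℝ) := by
  simp [bdfQuot]

theorem bdfQuot_re (z : ℂ) : (bdfQuot z).re = 1 + (1 - z.re) / 2 +
    ((1 - z.re) ^ 2 - z.im ^ 2) / 3 + ((1 - z.re) ^ 3 - 3 * (1 - z.re) * z.im ^ 2) / 4 := by
  simp [bdfQuot, pow_succ]
  ring

theorem bdfQuot_im (z : ℂ) : (bdfQuot z).im =
    -z.im * (1 / 2 + 2 * (1 - z.re) / 3 + (3 * (1 - z.re) ^ 2 - z.im ^ 2) / 4) := by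
  simp [bdfQuot, pow_succ]
  ring

theorem bdfQuot_im_factor_pos {x y : ℝ} (h : x ^ 2 + y ^ 2 ≤ 2) :
    0 < 1 / 2 + 2 * (1 - x) / 3 + (3 * (1 - x) ^ 2 - y ^ 2) / 4 := by
  nlinarith [sq_nonneg (x - 1)]

theorem bdfQuot_pos {x : ℝ} (h : x ^ 2 ≤ 2) : 0 < bdfQuot x := by
  have hx : x ≤ 3 / 2 := by nlinarith
  have hx' : -(3 / 2) ≤ x := by nlinarith
  have h1 : (-1 / 2 : ℝ) ≤ 1 - x := by linarith
  have : 0 < 1 + (1 - x) / 2 + (1 - x) ^ 2 / 3 + (1 - x) ^ 3 / 4 := by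
    nlinarith [mul_nonneg (sq_nonneg (1 - x)) (by linarith : 0 ≤ (1 - x) + 1 / 2),
      sq_nonneg (1 - x)]
  exact this

/-- Off the real axis the imaginary part is -Im z times a positive factor, hence nonzero; on the
real axis the value is positive. The principal power is thus holomorphic on a disc strictly larger
than the unit disc. -/
theorem bdfQuot_mem_slitPlane {z : ℂ} (h : ‖z‖ ^ 2 ≤ 2) : bdfQuot z ∈ Complex.slitPlane := by
  have h' : z.re ^ 2 + z.im ^ 2 ≤ 2 := by
    rw [← Complex.normSq_eq_norm_sq, Complex.normSq_apply] at h
    nlinarith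
  by_cases hy : z.im = 0
  · have : z = (z.re : ℂ) := by apply Complex.ext <;> simp [hy]
    rw [this, bdfQuot_ofReal]
    exact Complex.ofReal_mem_slitPlane.2 (bdfQuot_pos (by nlinarith))
  · rw [Complex.mem_slitPlane_iff]
    right
    rw [bdfQuot_im]
    exact mul_ne_zero (neg_ne_zero.2 hy) (bdfQuot_im_factor_pos h').ne'

/-- Taylor coefficients of `bdfQuot ^ α` decay geometrically with a rate below `1`. -/
theorem exists_bdfQuot_coeff (α : ℝ) : ∃ c : ℕ → ℝ, ∃ K : ℝ,
    (∀ n, |c n| ≤ K * (5 / 6) ^ n) ∧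
    ∀ z : ℂ, ‖z‖ < 7 / 5 → HasSum (fun n => (c n : ℂ) * z ^ n) (bdfQuot z ^ (α : ℂ)) := by
  -- Any radius in (6/5, √2) would serve: (7/5)² < 2 keeps the disc inside the region of
  -- `bdfQuot_mem_slitPlane`, and the smaller radius 6/5 yields the rate 5/6.
  set R : NNReal := 7 / 5 with hR
  have hR' : (R : ℝ) = 7 / 5 := by simp [hR]
  have hd : DifferentiableOn ℂ (fun z : ℂ => bdfQuot z ^ (α : ℂ)) (Metric.closedBall 0 (7 / 5)) := by
    intro z hz
    have hz' : ‖z‖ ≤ 7 / 5 := by simpa using hz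
    refine DifferentiableWithinAt.cpow_const ?_ (bdfQuot_mem_slitPlane ?_)
    · unfold bdfQuot; fun_prop
    · nlinarith [norm_nonneg z]
  rw [← hR'] at hd
  have hp := DifferentiableOn.hasFPowerSeriesOnBall (c := (0 : ℂ)) (R := R) hd
    (by rw [← NNReal.coe_lt_coe, hR']; norm_num)
  set p := cauchyPowerSeries (fun z : ℂ => bdfQuot z ^ (α : ℂ)) 0 R
  have hs : ∀ z : ℂ, ‖z‖ < 7 / 5 →
      HasSum (fun n => p.coeff n * z ^ n) (bdfQuot z ^ (α : ℂ)) := by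
    intro z hz
    have := hp.hasSum (y := z) (by
      rw [mem_eball_zero_iff, ← ofReal_norm, ENNReal.ofReal_lt_coe_iff (norm_nonneg _), hR']
      exact hz)
    simpa [mul_comm] using this
  -- On the real axis the power is real, so the imaginary parts are the coefficients of the zero
  -- function.
  have him : ∀ n, (p.coeff n).im = 0 := by
    have h0 : ∀ x : ℝ, |x| < 1 → HasSum (fun n => (p.coeff n).im * x ^ n) ((fun _ => (0:ℝ)) x) := by
      intro x hx
      have h1 := hs x (by simpa using hx.trans (by norm_num : (1:ℝ) < 7/5))
      have h2 := Complex.hasSum_im h1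
      have e1 : (bdfQuot (x : ℂ) ^ (α : ℂ)).im = 0 := by
        rw [bdfQuot_ofReal, ← Complex.ofReal_cpow (bdfQuot_pos _).le, Complex.ofReal_im]
        nlinarith [abs_nonneg x, sq_abs x]
      have e2 : ∀ n, (p.coeff n * (x : ℂ) ^ n).im = (p.coeff n).im * x ^ n := by
        intro n
        rw [← Complex.ofReal_pow, Complex.im_mul_ofReal]
      simpa only [e1, e2] using h2
    intro n
    rw [← iteratedDeriv_div_factorial_of_hasSum one_pos h0 n]
    simp
  have hre : ∀ n, ((p.coeff n).re : ℂ) = p.coeff n := fun n => by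
    apply Complex.ext <;> simp [him n]
  obtain ⟨K, -, hK⟩ := p.norm_mul_pow_le_of_lt_radius (r := 6 / 5)
    (lt_of_lt_of_le (by
      rw [ENNReal.coe_lt_coe, ← NNReal.coe_lt_coe, hR']
      norm_num) hp.r_le)
  refine ⟨fun n => (p.coeff n).re, K, fun n => ?_, fun z hz => ?_⟩
  · have h1 := hK n
    have h2 : |(p.coeff n).re| ≤ ‖p n‖ :=
      (Complex.abs_re_le_norm _).trans (by rw [FormalMultilinearSeries.norm_apply_eq_norm_coef])
    have h3 : ‖p n‖ * (6 / 5 : ℝ) ^ n ≤ K := by simpa using h1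
    calc |(p.coeff n).re| ≤ ‖p n‖ := h2
      _ = ‖p n‖ * (6 / 5 : ℝ) ^ n * (5 / 6) ^ n := by
        rw [mul_assoc, ← mul_pow]; norm_num
      _ ≤ _ := by gcongr
  · simpa only [hre] using hs z hz

end RieszDiffusion
end

/-! ### The weights as a Cauchy product, and their generating function on the closed disc. -/

noncomputable section
namespace RieszDiffusion

open Finset Filter Topology

/-- Taylor coefficients of `bdfQuot ^ α`. -/
def quotCoeff (α : ℝ) : ℕ → ℝ := (exists_bdfQuot_coeff α).choose

theorem exists_abs_quotCoeff_le (α : ℝ) : ∃ K : ℝ, ∀ n, |quotCoeff α n| ≤ K * (5 / 6) ^ n :=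
  ⟨_, (exists_bdfQuot_coeff α).choose_spec.choose_spec.1⟩

theorem hasSum_quotCoeff (α : ℝ) {z : ℂ} (hz : ‖z‖ < 7 / 5) :
    HasSum (fun n => (quotCoeff α n : ℂ) * z ^ n) (bdfQuot z ^ (α : ℂ)) :=
  (exists_bdfQuot_coeff α).choose_spec.choose_spec.2 z hz

theorem summable_geometric_bound {c : ℕ → ℝ} {K : ℝ} (h : ∀ n, |c n| ≤ K * (5 / 6) ^ n) :
    Summable fun n => |c n| :=
  Summable.of_nonneg_of_le (fun _ => abs_nonneg _) h
    ((summable_geometric_of_lt_one (by norm_num) (by norm_num)).mul_left K)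

theorem summable_abs_quotCoeff (α : ℝ) : Summable fun n => |quotCoeff α n| :=
  let ⟨_, h⟩ := exists_abs_quotCoeff_le α
  summable_geometric_bound h

theorem sq_le_of_abs_lt_one {x : ℝ} (hx : |x| < 1) : x ^ 2 ≤ 2 := by
  nlinarith [abs_nonneg x, sq_abs x]

theorem genFun_eq (α : ℝ) {x : ℝ} (hx : |x| < 1) :
    genFun α x = (1 - x) ^ α * bdfQuot x ^ α := by
  rw [genFun, ← Real.mul_rpow (by linarith [(abs_lt.1 hx).2])
    (bdfQuot_pos (sq_le_of_abs_lt_one hx)).le]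
  congr 1
  simp only [bdfQuot]
  ring

theorem hasSum_conv (α : ℝ) {z : ℂ} (hz : ‖z‖ < 1) :
    HasSum (fun n => ((∑ kl ∈ antidiagonal n, gb (-α - 1) kl.1 * quotCoeff α kl.2 : ℝ) : ℂ) * z ^ n)
      ((1 - z) ^ (α : ℂ) * bdfQuot z ^ (α : ℂ)) := by
  have h1 := hasSum_gb (-α - 1) hz
  have h2 := hasSum_quotCoeff α (hz.trans (by norm_num))
  have e : -((-α - 1 : ℝ) : ℂ) - 1 = α := by push_cast; ring
  rw [e] at h1
  have s1 := h1.summable.norm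
  have s2 := h2.summable.norm
  have h3 := tsum_mul_tsum_eq_tsum_sum_antidiagonal_of_summable_norm s1 s2
  have h4 := summable_norm_sum_mul_antidiagonal_of_summable_norm s1 s2
  rw [h1.tsum_eq, h2.tsum_eq] at h3
  rw [h3]
  have e2 : ∀ n, ∑ kl ∈ antidiagonal n, (gb (-α - 1) kl.1 : ℂ) * z ^ kl.1 *
      ((quotCoeff α kl.2 : ℂ) * z ^ kl.2) =
      ((∑ kl ∈ antidiagonal n, gb (-α - 1) kl.1 * quotCoeff α kl.2 : ℝ) : ℂ) * z ^ n := by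
    intro n
    push_cast
    rw [sum_mul]
    refine sum_congr rfl fun kl hkl => ?_
    rw [← mem_antidiagonal.1 hkl, pow_add]
    ring
  simp only [e2] at h4 ⊢
  exact h4.of_norm.hasSum

theorem weight_eq (α : ℝ) (n : ℕ) :
    weight α n = ∑ kl ∈ antidiagonal n, gb (-α - 1) kl.1 * quotCoeff α kl.2 := by
  rw [weight]
  refine iteratedDeriv_div_factorial_of_hasSum (f := genFun α)
    (u := fun n => ∑ kl ∈ antidiagonal n, gb (-α - 1) kl.1 * quotCoeff α kl.2)
    one_pos (fun x hx => ?_) n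
  have h := hasSum_conv α (z := (x : ℂ)) (by simpa using hx)
  have e : (1 - (x : ℂ)) ^ (α : ℂ) * bdfQuot (x : ℂ) ^ (α : ℂ) = (genFun α x : ℝ) := by
    rw [genFun_eq α hx, bdfQuot_ofReal, ← Complex.ofReal_cpow (bdfQuot_pos
      (sq_le_of_abs_lt_one hx)).le, ← Complex.ofReal_one, ← Complex.ofReal_sub,
      ← Complex.ofReal_cpow (by linarith [(abs_lt.1 hx).2]), ← Complex.ofReal_mul]
  rw [e] at h
  exact_mod_cast h

theorem hasSum_weight_of_norm_lt (α : ℝ) {z : ℂ} (hz : ‖z‖ < 1) :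
    HasSum (fun n => (weight α n : ℂ) * z ^ n) ((1 - z) ^ (α : ℂ) * bdfQuot z ^ (α : ℂ)) := by
  simpa only [← weight_eq] using hasSum_conv α hz

theorem summable_abs_weight {α : ℝ} (h0 : 0 < α) (h1 : α < 1) :
    Summable fun n => |weight α n| := by
  have := summable_norm_sum_mul_antidiagonal_of_summable_norm
    (f := gb (-α - 1)) (g := quotCoeff α) (summable_abs_gb h0 h1) (summable_abs_quotCoeff α)
  simpa only [← weight_eq, Real.norm_eq_abs] using this

theorem norm_weight_mul_le (α : ℝ) {z : ℂ} (hz : ‖z‖ ≤ 1) (n : ℕ) :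
    ‖(weight α n : ℂ) * z ^ n‖ ≤ |weight α n| := by
  rw [norm_mul, norm_pow, Complex.norm_real, Real.norm_eq_abs]
  exact mul_le_of_le_one_right (abs_nonneg _) (pow_le_one₀ (norm_nonneg _) hz)

theorem summable_weight_mul {α : ℝ} (h0 : 0 < α) (h1 : α < 1) {z : ℂ} (hz : ‖z‖ ≤ 1) :
    Summable fun n => (weight α n : ℂ) * z ^ n :=
  Summable.of_norm_bounded (summable_abs_weight h0 h1) (norm_weight_mul_le α hz)

/-- Abel's argument: along the radius r ↦ rz both sides are continuous on [0, 1], by absolute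
summability of the weights on one side and since 0 < α on the other, and they agree for r < 1. -/
theorem tsum_weight_mul {α : ℝ} (h0 : 0 < α) (h1 : α < 1) {z : ℂ} (hz : ‖z‖ ≤ 1) :
    ∑' n, (weight α n : ℂ) * z ^ n = (1 - z) ^ (α : ℂ) * bdfQuot z ^ (α : ℂ) := by
  have hmem : ∀ r ∈ Set.Icc (0 : ℝ) 1, ‖(r : ℂ) * z‖ ≤ 1 := by
    intro r hr
    rw [norm_mul, Complex.norm_real, Real.norm_eq_abs, abs_of_nonneg hr.1]
    exact mul_le_one₀ hr.2 (norm_nonneg _) hz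
  have hc1 : ContinuousOn (fun r : ℝ => ∑' n, (weight α n : ℂ) * ((r : ℂ) * z) ^ n)
      (Set.Icc 0 1) :=
    continuousOn_tsum (fun n => by fun_prop) (summable_abs_weight h0 h1)
      fun n r hr => norm_weight_mul_le α (hmem r hr) n
  have hc2 : ContinuousOn (fun r : ℝ => (1 - (r : ℂ) * z) ^ (α : ℂ) *
      bdfQuot ((r : ℂ) * z) ^ (α : ℂ)) (Set.Icc 0 1) := by
    intro r hr
    have hn := hmem r hr
    apply ContinuousAt.continuousWithinAt
    apply ContinuousAt.mul
    · have : ContinuousAt (fun w : ℂ => w ^ (α : ℂ)) (1 - (r : ℂ) * z) := by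
        apply Complex.continuousAt_cpow_const_of_re_pos
        · left
          have := (Complex.re_le_norm ((r : ℂ) * z)).trans hn
          rw [Complex.sub_re, Complex.one_re]
          linarith
        · simpa using h0
      exact ContinuousAt.comp (f := fun r : ℝ => 1 - (r : ℂ) * z) this (by fun_prop)
    · refine ContinuousAt.cpow (by unfold bdfQuot; fun_prop) continuousAt_const
        (bdfQuot_mem_slitPlane ?_)
      nlinarith [norm_nonneg ((r : ℂ) * z)]
  have heq : Set.EqOn (fun r : ℝ => ∑' n, (weight α n : ℂ) * ((r : ℂ) * z) ^ n)
      (fun r : ℝ => (1 - (r : ℂ) * z) ^ (α : ℂ) * bdfQuot ((r : ℂ) * z) ^ (α : ℂ))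
      (Set.Icc 0 1) := by
    have := Set.EqOn.of_subset_closure (s := Set.Ico (0 : ℝ) 1) (t := Set.Icc 0 1) ?_ hc1 hc2
      Set.Ico_subset_Icc_self (by rw [closure_Ico zero_ne_one])
    · exact this
    · intro r hr
      refine (hasSum_weight_of_norm_lt α ?_).tsum_eq
      rw [norm_mul, Complex.norm_real, Real.norm_eq_abs, abs_of_nonneg hr.1]
      nlinarith [hr.1, hr.2, norm_nonneg z]
  simpa using heq (Set.right_mem_Icc.2 zero_le_one)

/-! The argument of the generating function on the unit circle. -/

/-- The angle by which the range of the generating function exceeds the right half plane. -/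
def excessAngle : ℝ := Real.arctan (256 * Real.sqrt 6 / 2097)

theorem excessAngle_pos : 0 < excessAngle := Real.arctan_pos.2 (by positivity)

/-- Here arccos(1/5) = 2 arctan(√6/3), and the addition theorem for arctan combines √6/3 with the
tangent of `excessAngle` to 191√6/317. In this form the bound on α reads α(π/2 + δ) ≤ π/2. -/
theorem alphaMax_eq : alphaMax = Real.pi / (Real.pi + 2 * excessAngle) := by
  have h6 : Real.sqrt 6 ^ 2 = 6 := Real.sq_sqrt (by norm_num)
  have h60 : 0 < Real.sqrt 6 := Real.sqrt_pos.2 (by norm_num)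
  have h65 : Real.sqrt 6 < 5 / 2 := by nlinarith
  have hA : Real.arccos (1 / 5) = 2 * Real.arctan (Real.sqrt 6 / 3) := by
    have h1 : Real.cos (2 * Real.arctan (Real.sqrt 6 / 3)) = 1 / 5 := by
      rw [Real.cos_two_mul, Real.cos_sq_arctan, div_pow, h6]; norm_num
    rw [← h1, Real.arccos_cos]
    · have : 0 < Real.arctan (Real.sqrt 6 / 3) := Real.arctan_pos.2 (by positivity)
      linarith
    · linarith [Real.arctan_lt_pi_div_two (Real.sqrt 6 / 3)]
  have hB : Real.arctan (Real.sqrt 6 / 3) + excessAngle = Real.arctan (191 * Real.sqrt 6 / 317) := by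
    rw [excessAngle, Real.arctan_add]
    · congr 1
      rw [div_eq_div_iff]
      · nlinarith
      · nlinarith
      · norm_num
    · nlinarith
  rw [alphaMax, hA, ← hB]
  congr 1
  ring

theorem alphaMax_lt_one : alphaMax < 1 := by
  rw [alphaMax_eq, div_lt_one] <;> linarith [Real.pi_pos, excessAngle_pos]

theorem mul_le_pi_div_two {α : ℝ} (hα : α ≤ alphaMax) :
    α * (Real.pi / 2 + excessAngle) ≤ Real.pi / 2 := by
  have h : 0 < Real.pi + 2 * excessAngle := by linarith [Real.pi_pos, excessAngle_pos]
  rw [alphaMax_eq, le_div_iff₀ h] at hα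
  linarith

/-- The right side minus the left is, up to a positive constant, (1-c)(5c-1)² times a quintic in 1-c
that is positive on the range. The double zero c = 1/5 is the point where the argument of Q is
largest. -/
theorem symbol_poly_nonneg {c : ℝ} (h1 : -(1 / 3) ≤ c) (h2 : c ≤ 1) :
    (2 / 3 * (1 - c) ^ 3 * (1 + 3 * c)) ^ 2 ≤ (256 ^ 2 * 6 / 2097 ^ 2) * ((1 - c ^ 2) *
      (8 / 3 - 5 * c + 16 / 3 * c ^ 2 - 2 * c ^ 3) ^ 2) := by
  have ht : 0 ≤ 1 - c := by linarith
  have hQ : 0 ≤ 49152 + 131072 * (1 - c) + 523264 / 3 * (1 - c) ^ 2 + 1308160 / 3 * (1 - c) ^ 3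
      + 817600 * (1 - c) ^ 4 - 766500 * (1 - c) ^ 5 := by
    have e1 := mul_nonneg (pow_nonneg ht 4) (by linarith : 0 ≤ 4 / 3 - (1 - c))
    have e2 := mul_nonneg (pow_nonneg ht 3) (by linarith : 0 ≤ 4 / 3 - (1 - c))
    nlinarith [pow_nonneg ht 2, pow_nonneg ht 3]
  have := mul_nonneg (mul_nonneg ht (sq_nonneg (5 * c - 1))) hQ
  nlinarith

theorem quartic_re (z : ℂ) (h : ‖z‖ = 1) :
    ((1 - z) * bdfQuot z).re = -(2 / 3) * (1 - z.re) ^ 3 * (1 + 3 * z.re) := by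
  have h' : z.im ^ 2 = 1 - z.re ^ 2 := by
    have : ‖z‖ ^ 2 = 1 := by rw [h]; norm_num
    rw [← Complex.normSq_eq_norm_sq, Complex.normSq_apply] at this
    nlinarith
  rw [Complex.mul_re, bdfQuot_re, bdfQuot_im]
  simp only [Complex.sub_re, Complex.sub_im, Complex.one_re, Complex.one_im]
  have h4 : z.im ^ 4 = (1 - z.re ^ 2) ^ 2 := by rw [← h']; ring
  ring_nf
  rw [h4, h']
  ring

theorem quartic_im (z : ℂ) (h : ‖z‖ = 1) :
    ((1 - z) * bdfQuot z).im =
      -z.im * (8 / 3 - 5 * z.re + 16 / 3 * z.re ^ 2 - 2 * z.re ^ 3) := by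
  have h' : z.im ^ 2 = 1 - z.re ^ 2 := by
    have : ‖z‖ ^ 2 = 1 := by rw [h]; norm_num
    rw [← Complex.normSq_eq_norm_sq, Complex.normSq_apply] at this
    nlinarith
  rw [Complex.mul_im, bdfQuot_re, bdfQuot_im]
  simp only [Complex.sub_re, Complex.sub_im, Complex.one_re, Complex.one_im]
  have h3 : z.im ^ 3 = z.im * (1 - z.re ^ 2) := by rw [← h']; ring
  ring_nf
  rw [h3]
  ring

/-- W is a product of two principal powers, so the relevant angle is the sum φ of the two principal
arguments, which a priori may reach 3π/2. Its sine has the sign of Im Q, which is positive, so φ <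
π. Then tan(φ - π/2) = -Re Q / Im Q is compared with tan δ by means of `symbol_poly_nonneg`. -/
theorem arg_add_arg_bound {z : ℂ} (h : ‖z‖ = 1) (hy : z.im < 0) :
    0 < Complex.arg (1 - z) + Complex.arg (bdfQuot z) ∧
    Complex.arg (1 - z) + Complex.arg (bdfQuot z) ≤ Real.pi / 2 + excessAngle := by
  have hsq : z.re ^ 2 + z.im ^ 2 = 1 := by
    have : ‖z‖ ^ 2 = 1 := by rw [h]; norm_num
    rw [← Complex.normSq_eq_norm_sq, Complex.normSq_apply] at this
    nlinarith
  have hc1 : z.re < 1 := by nlinarith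
  have hc2 : -1 < z.re := by nlinarith
  set J := 8 / 3 - 5 * z.re + 16 / 3 * z.re ^ 2 - 2 * z.re ^ 3 with hJ
  have hJ0 : 0 < J := by nlinarith [mul_nonneg (sq_nonneg (z.re - 1)) (by linarith : 0 ≤ 1 - z.re)]
  have a1 : 0 < Complex.arg (1 - z) := by
    have h1 : 0 < (1 - z).im := by simpa using hy
    refine lt_of_le_of_ne (Complex.arg_nonneg_iff.2 h1.le) fun h0 => ?_
    have := Complex.arg_eq_zero_iff.1 h0.symm
    linarith [this.2]
  have a2 : Complex.arg (1 - z) < Real.pi / 2 :=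
    (abs_lt.1 (Complex.abs_arg_lt_pi_div_two_iff.2 (Or.inl (by simpa using hc1)))).2
  have hqim : 0 < (bdfQuot z).im := by
    rw [bdfQuot_im]
    exact mul_pos (by linarith) (bdfQuot_im_factor_pos (by linarith))
  have b1 : 0 < Complex.arg (bdfQuot z) := by
    refine lt_of_le_of_ne (Complex.arg_nonneg_iff.2 hqim.le) fun h0 => ?_
    have := Complex.arg_eq_zero_iff.1 h0.symm
    linarith [this.2]
  have b2 : Complex.arg (bdfQuot z) ≤ Real.pi := Complex.arg_le_pi _
  set φ := Complex.arg (1 - z) + Complex.arg (bdfQuot z) with hφ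
  refine ⟨by linarith, ?_⟩
  have hρ : 0 < ‖1 - z‖ * ‖bdfQuot z‖ := by
    refine mul_pos (norm_pos_iff.2 fun h0 => ?_) (norm_pos_iff.2 fun h0 => ?_)
    · rw [h0, Complex.arg_zero] at a1; exact a1.false
    · rw [h0, Complex.arg_zero] at b1; exact b1.false
  have hpolar : (1 - z) * bdfQuot z = ((‖1 - z‖ * ‖bdfQuot z‖ : ℝ) : ℂ) *
      (Complex.cos (φ : ℝ) + Complex.sin (φ : ℝ) * Complex.I) := by
    rw [← Complex.exp_mul_I, hφ]
    conv_lhs => rw [← Complex.norm_mul_exp_arg_mul_I (1 - z),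
      ← Complex.norm_mul_exp_arg_mul_I (bdfQuot z)]
    push_cast
    rw [add_mul, Complex.exp_add]
    ring
  set ρ := ‖1 - z‖ * ‖bdfQuot z‖
  have hX : ρ * Real.cos φ = -(2 / 3) * (1 - z.re) ^ 3 * (1 + 3 * z.re) := by
    rw [← quartic_re z h, hpolar, Complex.re_ofReal_mul, Complex.add_re, ← Complex.ofReal_cos,
      ← Complex.ofReal_sin, Complex.re_ofReal_mul, Complex.I_re, Complex.ofReal_re]
    ring
  have hY : ρ * Real.sin φ = -z.im * J := by
    rw [← quartic_im z h, hpolar, Complex.im_ofReal_mul, Complex.add_im, ← Complex.ofReal_cos,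
      ← Complex.ofReal_sin, Complex.im_ofReal_mul, Complex.I_im, Complex.ofReal_im]
    ring
  have hsin : 0 < Real.sin φ := by
    have : 0 < ρ * Real.sin φ := by rw [hY]; exact mul_pos (by linarith) hJ0
    exact (pos_iff_pos_of_mul_pos this).1 hρ
  have hφπ : φ < Real.pi := by
    by_contra hcon
    have : Real.sin (φ - Real.pi) ≥ 0 :=
      Real.sin_nonneg_of_nonneg_of_le_pi (by linarith) (by linarith)
    rw [Real.sin_sub_pi] at this
    linarith
  by_contra hcon
  push Not at hcon
  have htan : Real.tan excessAngle < Real.tan (φ - Real.pi / 2) :=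
    Real.strictMonoOn_tan ⟨Real.neg_pi_div_two_lt_arctan _, Real.arctan_lt_pi_div_two _⟩
      ⟨by linarith [excessAngle_pos, Real.pi_pos], by linarith⟩ (lt_sub_iff_add_lt'.2 hcon)
  have hk : Real.tan excessAngle = 256 * Real.sqrt 6 / 2097 := Real.tan_arctan _
  have ht2 : Real.tan (φ - Real.pi / 2) = -Real.cos φ / Real.sin φ := by
    rw [Real.tan_eq_sin_div_cos, Real.sin_sub_pi_div_two, Real.cos_sub_pi_div_two]
  rw [hk, ht2, lt_div_iff₀ hsin] at htan
  have hmain : (256 * Real.sqrt 6 / 2097) * (-z.im * J) <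
      2 / 3 * (1 - z.re) ^ 3 * (1 + 3 * z.re) := by
    have := mul_lt_mul_of_pos_left htan hρ
    rw [← hY]
    nlinarith
  have hpos : 0 ≤ (256 * Real.sqrt 6 / 2097) * (-z.im * J) :=
    mul_nonneg (by positivity) (mul_nonneg (by linarith) hJ0.le)
  -- For c < -1/3 the real part of Q is positive, so the angle is below π/2 and `hmain` is
  -- impossible.
  have hc3 : -(1 / 3) ≤ z.re := by
    by_contra hcc
    have h3 : 0 < (1 - z.re) ^ 3 := pow_pos (by linarith) 3
    nlinarith
  have h5 := symbol_poly_nonneg hc3 hc1.le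
  have h6 : Real.sqrt 6 ^ 2 = 6 := Real.sq_sqrt (by norm_num)
  have h7 := pow_lt_pow_left₀ hmain hpos two_ne_zero
  have h8 : ((256 * Real.sqrt 6 / 2097) * (-z.im * J)) ^ 2 =
      (256 ^ 2 * 6 / 2097 ^ 2) * ((1 - z.re ^ 2) * J ^ 2) := by
    rw [mul_pow, div_pow, mul_pow, h6, mul_pow, neg_sq, show z.im ^ 2 = 1 - z.re ^ 2 by linarith]
  rw [h8] at h7
  exact absurd h7 (not_lt.2 h5)

/-- The upper half circle follows from the lower one by complex conjugation. The points ±1 have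
argument zero for both factors. -/
theorem abs_arg_add_arg_le {z : ℂ} (h : ‖z‖ = 1) :
    |Complex.arg (1 - z) + Complex.arg (bdfQuot z)| ≤ Real.pi / 2 + excessAngle := by
  have hpi := Real.pi_pos
  have hex := excessAngle_pos
  rcases lt_trichotomy z.im 0 with hy | hy | hy
  · have := arg_add_arg_bound h hy
    rw [abs_le]; constructor <;> linarith [this.1, this.2]
  · have hz : z = (z.re : ℂ) := by apply Complex.ext <;> simp [hy]
    have hre : |z.re| = 1 := by
      rw [hz] at h
      simpa using h
    have h1 : z.re ≤ 1 := (le_abs_self _).trans hre.le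
    have e1 : Complex.arg (1 - z) = 0 := by
      rw [hz, ← Complex.ofReal_one, ← Complex.ofReal_sub]
      exact Complex.arg_ofReal_of_nonneg (by linarith)
    have e2 : Complex.arg (bdfQuot z) = 0 := by
      rw [hz, bdfQuot_ofReal]
      refine Complex.arg_ofReal_of_nonneg (bdfQuot_pos ?_).le
      rw [← sq_abs, hre]; norm_num
    rw [e1, e2, add_zero, abs_zero]
    linarith
  · have h1 : ‖(starRingEnd ℂ) z‖ = 1 := by simpa using h
    have h2 := arg_add_arg_bound h1 (by simpa using hy)
    have e0 : bdfQuot ((starRingEnd ℂ) z) = (starRingEnd ℂ) (bdfQuot z) := by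
      simp [bdfQuot, map_ofNat (starRingEnd ℂ)]
    have e1 : 1 - (starRingEnd ℂ) z = (starRingEnd ℂ) (1 - z) := by simp
    have hq : Complex.arg (bdfQuot z) ≠ Real.pi :=
      Complex.slitPlane_arg_ne_pi (bdfQuot_mem_slitPlane (by rw [h]; norm_num))
    have hz : Complex.arg (1 - z) ≠ Real.pi := by
      intro h0
      have := (Complex.arg_eq_pi_iff.1 h0).2
      simp at this
      linarith
    rw [e0, e1, Complex.arg_conj, Complex.arg_conj, if_neg hq, if_neg hz] at h2
    rw [abs_le]; constructor <;> linarith [h2.1, h2.2]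

/-- Away from z = 1, W(z) = exp(…) with imaginary exponent α times the angle sum, which lies in
[-π/2, π/2] precisely because α ≤ `alphaMax`. -/
theorem re_tsum_weight_nonneg {α : ℝ} (h0 : 0 < α) (hα : α ≤ alphaMax) {z : ℂ} (h : ‖z‖ = 1) :
    0 ≤ (∑' n, (weight α n : ℂ) * z ^ n).re := by
  rw [tsum_weight_mul h0 (hα.trans_lt alphaMax_lt_one) h.le]
  by_cases hz : 1 - z = 0
  · rw [hz, Complex.zero_cpow (by simpa using h0.ne'), zero_mul, Complex.zero_re]
  have hq : bdfQuot z ≠ 0 :=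
    Complex.slitPlane_ne_zero (bdfQuot_mem_slitPlane (by rw [h]; norm_num))
  rw [Complex.cpow_def_of_ne_zero hz, Complex.cpow_def_of_ne_zero hq, ← Complex.exp_add,
    Complex.exp_re]
  refine mul_nonneg (Real.exp_pos _).le (Real.cos_nonneg_of_mem_Icc ?_)
  have e : (Complex.log (1 - z) * α + Complex.log (bdfQuot z) * α).im =
      α * (Complex.arg (1 - z) + Complex.arg (bdfQuot z)) := by
    rw [Complex.add_im, Complex.im_mul_ofReal, Complex.im_mul_ofReal, Complex.log_im,
      Complex.log_im]
    ring
  rw [e, Set.mem_Icc, ← abs_le, abs_mul, abs_of_pos h0]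
  exact (mul_le_mul_of_nonneg_left (abs_arg_add_arg_le h) h0.le).trans (mul_le_pi_div_two hα)

end RieszDiffusion
end

noncomputable section
namespace RieszDiffusion

open Finset Filter Topology

/-! Fourier modes. -/

theorem nu_nonneg {α dα h : ℝ} (h0 : 0 < α) (h1 : α < 1) (hd : 0 < dα) (hh : 0 < h) :
    0 ≤ nu α dα h := by
  have hc : 0 < Real.cos (Real.pi * α / 2) := by
    apply Real.cos_pos_of_mem_Ioo
    constructor <;> nlinarith [Real.pi_pos]
  unfold nu
  positivity

/-- The symbol of the three-point stencil. -/
def stencilSymbol (c₁ c₂ c₃ θ : ℝ) : ℂ :=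
  ⟨c₂ + (c₁ + c₃) * Real.cos θ, (c₃ - c₁) * Real.sin θ⟩

/-- The mode `e^{i j θ}`. -/
def mode (θ : ℝ) (j : ℤ) : ℂ := Complex.exp (Complex.I * j * θ)

theorem mode_add (θ : ℝ) (i j : ℤ) : mode θ (i + j) = mode θ i * mode θ j := by
  rw [mode, mode, mode, ← Complex.exp_add]
  push_cast
  ring_nf

theorem mode_natCast (θ : ℝ) (l : ℕ) : mode θ l = mode θ 1 ^ l := by
  rw [mode, mode, ← Complex.exp_nat_mul]
  push_cast
  ring_nf

theorem mode_neg (θ : ℝ) (j : ℤ) : mode θ (-j) = mode (-θ) j := by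
  rw [mode, mode]
  push_cast
  ring_nf

theorem norm_mode (θ : ℝ) (j : ℤ) : ‖mode θ j‖ = 1 := by
  rw [mode, show Complex.I * j * θ = ((j * θ : ℝ) : ℂ) * Complex.I by push_cast; ring]
  exact Complex.norm_exp_ofReal_mul_I _

theorem mode_ne_zero (θ : ℝ) (j : ℤ) : mode θ j ≠ 0 := Complex.exp_ne_zero _

theorem mode_one (θ : ℝ) : mode θ 1 = ⟨Real.cos θ, Real.sin θ⟩ := by
  rw [mode, show Complex.I * ((1 : ℤ) : ℂ) * θ = (θ : ℂ) * Complex.I by push_cast; ring]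
  apply Complex.ext
  · rw [Complex.exp_ofReal_mul_I_re]
  · rw [Complex.exp_ofReal_mul_I_im]

theorem mode_neg_eq_conj (θ : ℝ) : mode (-θ) 1 = (starRingEnd ℂ) (mode θ 1) := by
  rw [mode_one, mode_one]
  apply Complex.ext <;> simp

theorem stencil_mode (c₁ c₂ c₃ θ : ℝ) (q : ℂ) (j : ℤ) :
    stencil c₁ c₂ c₃ (fun j => q * mode θ j) j = q * mode θ j * stencilSymbol c₁ c₂ c₃ θ := by
  have e : stencilSymbol c₁ c₂ c₃ θ = c₁ * mode (-θ) 1 + c₂ + c₃ * mode θ 1 := by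
    rw [stencilSymbol, mode_one, mode_one]
    apply Complex.ext
    · simp; ring
    · simp; ring
  rw [e, stencil, sub_eq_add_neg, mode_add, mode_add, mode_neg]
  simp only [Complex.real_smul]
  ring

/-- The symbol of the two-sided convolution with the weights. -/
def weightSymbol (α θ : ℝ) : ℝ := 2 * (∑' n, (weight α n : ℂ) * mode θ 1 ^ n).re

theorem weightSymbol_nonneg {α : ℝ} (h0 : 0 < α) (hα : α ≤ alphaMax) (θ : ℝ) :
    0 ≤ weightSymbol α θ :=
  mul_nonneg zero_le_two (re_tsum_weight_nonneg h0 hα (norm_mode θ 1))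

/-- The backward sum contributes the conjugate of the factor of the forward sum, so the symbol is
the averaging symbol times the real number 2 Re W(e^{iθ}). -/
theorem bracketInf_mode {α : ℝ} (d₁ d₂ h θ : ℝ) (q : ℂ) (j : ℤ) :
    bracketInf α d₁ d₂ h (fun j => q * mode θ j) j =
      q * mode θ j * ((weightSymbol α θ : ℝ) *
        stencilSymbol (a₁ d₁ d₂ h) a₂ (a₃ d₁ d₂ h) θ) := by
  have e1 : ∀ l : ℕ, weight α l • avg d₁ d₂ h (fun j => q * mode θ j) (j - l) =
      (q * mode θ j * stencilSymbol (a₁ d₁ d₂ h) a₂ (a₃ d₁ d₂ h) θ) *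
        (starRingEnd ℂ) ((weight α l : ℂ) * mode θ 1 ^ l) := by
    intro l
    rw [avg, stencil_mode, sub_eq_add_neg, mode_add, mode_neg, mode_natCast, mode_neg_eq_conj,
      Complex.real_smul, map_mul, map_pow, Complex.conj_ofReal]
    ring
  have e2 : ∀ l : ℕ, weight α l • avg d₁ d₂ h (fun j => q * mode θ j) (j + l) =
      (q * mode θ j * stencilSymbol (a₁ d₁ d₂ h) a₂ (a₃ d₁ d₂ h) θ) *
        ((weight α l : ℂ) * mode θ 1 ^ l) := by
    intro l
    rw [avg, stencil_mode, mode_add, mode_natCast, Complex.real_smul]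
    ring
  rw [bracketInf]
  simp only [e1, e2]
  rw [tsum_mul_left, tsum_mul_left, ← Complex.conj_tsum, ← mul_add, add_comm, Complex.add_conj,
    weightSymbol]
  push_cast
  ring

theorem norm_add_le_norm_sub {p g : ℂ} (h : p.re * g.re + p.im * g.im ≤ 0) :
    ‖p + g‖ ≤ ‖p - g‖ := by
  refine le_of_sq_le_sq ?_ (norm_nonneg _)
  rw [← Complex.normSq_eq_norm_sq, ← Complex.normSq_eq_norm_sq, Complex.normSq_apply,
    Complex.normSq_apply]
  simp only [Complex.add_re, Complex.add_im, Complex.sub_re, Complex.sub_im]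
  nlinarith

/-- This is Re(A conj B) for the averaging and differencing symbols. The odd parts of the stencils
contribute only through their product, and everything has the factor 1 - cos θ. -/
theorem symbol_form_nonpos {d₁ d₂ h : ℝ} (hd₂ : 0 < d₂) (hh : 0 < h) (θ : ℝ) :
    (stencilSymbol (a₁ d₁ d₂ h) a₂ (a₃ d₁ d₂ h) θ).re *
        (stencilSymbol (b₁ d₁ d₂ h) (b₂ d₁ d₂ h) (b₃ d₁ d₂ h) θ).re +
      (stencilSymbol (a₁ d₁ d₂ h) a₂ (a₃ d₁ d₂ h) θ).im *
        (stencilSymbol (b₁ d₁ d₂ h) (b₂ d₁ d₂ h) (b₃ d₁ d₂ h) θ).im ≤ 0 := by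
  have hs : Real.sin θ ^ 2 = 1 - Real.cos θ ^ 2 := by linarith [Real.sin_sq_add_cos_sq θ]
  have hc := Real.cos_le_one θ
  have hc' := Real.neg_one_le_cos θ
  have e : (stencilSymbol (a₁ d₁ d₂ h) a₂ (a₃ d₁ d₂ h) θ).re *
        (stencilSymbol (b₁ d₁ d₂ h) (b₂ d₁ d₂ h) (b₃ d₁ d₂ h) θ).re +
      (stencilSymbol (a₁ d₁ d₂ h) a₂ (a₃ d₁ d₂ h) θ).im *
        (stencilSymbol (b₁ d₁ d₂ h) (b₂ d₁ d₂ h) (b₃ d₁ d₂ h) θ).im =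
      -(1 - Real.cos θ) * (d₂ / h ^ 2 * ((5 + Real.cos θ) / 3) +
        d₁ ^ 2 / (12 * d₂) * (2 / 3 * (1 - Real.cos θ))) := by
    simp only [stencilSymbol, a₁, a₂, a₃, b₁, b₂, b₃]
    field_simp
    ring_nf
    rw [hs]
    ring
  rw [e, neg_mul, neg_nonpos]
  have h1 : 0 ≤ 1 - Real.cos θ := by linarith
  have h2 : 0 ≤ 5 + Real.cos θ := by linarith
  positivity

/-- With p = 2A/τ, g = B - rA and r ≥ 0 the error equation for a mode is (p-g)ξ = p+g. From Re(p
conj g) ≤ 0 one gets |p+g| ≤ |p-g|. Moreover p = g would force p = 0, whereas Re A ≥ 2/3. -/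
theorem fourierMode_stability {α d₁ d₂ dα τ h : ℝ} (h0 : 0 < α) (hα : α ≤ alphaMax)
    (hd₂ : 0 < d₂) (hdα : 0 < dα) (hτ : 0 < τ) (hh : 0 < h) (θ : ℝ) :
    (∃! ξ : ℂ, IsFourierMode α d₁ d₂ dα τ h θ ξ) ∧
      ∀ ξ : ℂ, IsFourierMode α d₁ d₂ dα τ h θ ξ → ‖ξ‖ ≤ 1 := by
  set A := stencilSymbol (a₁ d₁ d₂ h) a₂ (a₃ d₁ d₂ h) θ with hA
  set B := stencilSymbol (b₁ d₁ d₂ h) (b₂ d₁ d₂ h) (b₃ d₁ d₂ h) θ with hB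
  set r := nu α dα h * weightSymbol α θ with hr
  have hr0 : 0 ≤ r := mul_nonneg (nu_nonneg h0 (hα.trans_lt alphaMax_lt_one) hdα hh)
    (weightSymbol_nonneg h0 hα θ)
  set p : ℂ := ((2 / τ : ℝ) : ℂ) * A with hp
  set g : ℂ := B - (r : ℂ) * A with hg
  have hpg : p.re * g.re + p.im * g.im ≤ 0 := by
    have h1 := symbol_form_nonpos (d₁ := d₁) hd₂ hh θ
    rw [← hA, ← hB] at h1
    have e : p.re * g.re + p.im * g.im =
        2 / τ * ((A.re * B.re + A.im * B.im) - r * (A.re ^ 2 + A.im ^ 2)) := by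
      simp only [hp, hg, Complex.re_ofReal_mul, Complex.im_ofReal_mul, Complex.sub_re,
        Complex.sub_im]
      ring
    rw [e]
    refine mul_nonpos_of_nonneg_of_nonpos (by positivity) ?_
    have : 0 ≤ r * (A.re ^ 2 + A.im ^ 2) := by positivity
    linarith
  have hAre : 0 < A.re := by
    have : A.re = 5 / 6 + 1 / 6 * Real.cos θ := by
      simp only [hA, stencilSymbol, a₁, a₂, a₃]; ring
    rw [this]
    linarith [Real.neg_one_le_cos θ]
  have hpg0 : p - g ≠ 0 := by
    intro h1
    have h2 : p = g := sub_eq_zero.1 h1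
    rw [← h2] at hpg
    have h3 : p.re = 2 / τ * A.re := by rw [hp, Complex.re_ofReal_mul]
    have h4 : 0 < p.re := by rw [h3]; positivity
    nlinarith [sq_nonneg p.im]
  have key : ∀ ξ : ℂ, IsFourierMode α d₁ d₂ dα τ h θ ξ ↔ (p - g) * ξ = p + g := by
    intro ξ
    have step : ∀ (k : ℕ) (j : ℤ),
        (newLevel d₁ d₂ τ h (fun j => ξ ^ (k + 1) * mode θ j) j +
            nu α dα h • bracketInf α d₁ d₂ h (fun j => ξ ^ (k + 1) * mode θ j) j =
          oldLevel d₁ d₂ τ h (fun j => ξ ^ k * mode θ j) j -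
            nu α dα h • bracketInf α d₁ d₂ h (fun j => ξ ^ k * mode θ j) j) ↔
        ξ ^ k * mode θ j * ((p - g) * ξ) = ξ ^ k * mode θ j * (p + g) := by
      intro k j
      have eN : stencilSymbol (2 * a₁ d₁ d₂ h / τ - b₁ d₁ d₂ h) (2 * a₂ / τ - b₂ d₁ d₂ h)
          (2 * a₃ d₁ d₂ h / τ - b₃ d₁ d₂ h) θ = p - B := by
        apply Complex.ext <;>
        · simp only [hp, hA, hB, Complex.sub_re, Complex.sub_im, Complex.re_ofReal_mul,
            Complex.im_ofReal_mul, stencilSymbol]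
          ring
      have eO : stencilSymbol (2 * a₁ d₁ d₂ h / τ + b₁ d₁ d₂ h) (2 * a₂ / τ + b₂ d₁ d₂ h)
          (2 * a₃ d₁ d₂ h / τ + b₃ d₁ d₂ h) θ = p + B := by
        apply Complex.ext <;>
        · simp only [hp, hA, hB, Complex.add_re, Complex.add_im, Complex.re_ofReal_mul,
            Complex.im_ofReal_mul, stencilSymbol]
          ring
      rw [newLevel, oldLevel, stencil_mode, stencil_mode, bracketInf_mode, bracketInf_mode, eN, eO,
        Complex.real_smul, Complex.real_smul, ← hA]
      have e1 : ξ ^ (k + 1) * mode θ j * (p - B) + (nu α dα h : ℂ) *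
          (ξ ^ (k + 1) * mode θ j * ((weightSymbol α θ : ℝ) * A)) =
          ξ ^ k * mode θ j * ((p - g) * ξ) := by
        rw [hg, hr]; push_cast; ring
      have e2 : ξ ^ k * mode θ j * (p + B) - (nu α dα h : ℂ) *
          (ξ ^ k * mode θ j * ((weightSymbol α θ : ℝ) * A)) =
          ξ ^ k * mode θ j * (p + g) := by
        rw [hg, hr]; push_cast; ring
      rw [e1, e2]
    constructor
    · intro hF
      -- Level k = 0 is used because ξ^k can be cancelled there even when ξ = 0.
      have h1 := (step 0 0).1 (hF 0 0)
      rw [pow_zero, one_mul] at h1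
      exact mul_left_cancel₀ (mode_ne_zero θ 0) h1
    · intro h1 k j
      refine (step k j).2 ?_
      rw [h1]
  refine ⟨⟨(p + g) / (p - g), (key _).2 (mul_div_cancel₀ _ hpg0), fun ξ hξ => ?_⟩, fun ξ hξ => ?_⟩
  · rw [eq_div_iff hpg0, mul_comm]
    exact (key ξ).1 hξ
  · have h1 := congrArg norm ((key ξ).1 hξ)
    rw [norm_mul] at h1
    have h2 := norm_add_le_norm_sub hpg
    have h3 : 0 < ‖p - g‖ := norm_pos_iff.2 hpg0
    by_contra hcon
    push Not at hcon
    nlinarith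

end RieszDiffusion
end

noncomputable section
namespace RieszDiffusion

open Finset Filter Topology Asymptotics

/-! Asymptotics of generalized binomial coefficients. -/

theorem one_sub_rpow_taylor (γ : ℝ) (N : ℕ) :
    (fun x : ℝ => (1 - x) ^ γ - ∑ k ∈ range N, gb (-γ - 1) k * x ^ k) =O[𝓝 0]
      fun x : ℝ => x ^ N := by
  have h0 : ∀ x : ℝ, |x| < 1 → HasSum (fun n => gb (-γ - 1) n * x ^ n) ((1 - x) ^ γ) := by
    intro x hx
    have h := hasSum_gb (-γ - 1) (z := (x : ℂ)) (by simpa using hx)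
    have e : (1 - (x : ℂ)) ^ (-((-γ - 1 : ℝ) : ℂ) - 1) = (((1 - x) ^ γ : ℝ) : ℂ) := by
      rw [Complex.ofReal_cpow (by linarith [(abs_lt.1 hx).2])]
      push_cast
      ring_nf
    rw [e] at h
    exact_mod_cast h
  have h1 := (hasFPowerSeriesAt_of_hasSum one_pos h0).isBigO_sub_partialSum_pow N
  refine (h1.congr_left fun x => ?_).trans (IsBigO.of_norm_left ?_)
  · rw [zero_add, FormalMultilinearSeries.partialSum]
    congr 1
    refine sum_congr rfl fun k _ => ?_
    rw [FormalMultilinearSeries.ofScalars_apply_eq, smul_eq_mul]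
  · simp only [norm_pow, norm_norm]
    simpa only [norm_pow] using (isBigO_refl (fun x : ℝ => x ^ N) (𝓝 0)).norm_left

/-- The increments are dominated by those of C n^{-(p+1)}. So ±g(n) + C n^{-(p+1)} are eventually
decreasing with limit 0, hence nonnegative. -/
theorem isBigO_of_tendsto_zero_of_sub {g : ℕ → ℝ} {p : ℕ} (hg : Tendsto g atTop (𝓝 0))
    (hd : (fun n => g (n + 1) - g n) =O[atTop] fun n : ℕ => (1 / ((n : ℝ) + 1)) ^ (p + 2)) :
    g =O[atTop] fun n : ℕ => (1 / (n : ℝ)) ^ (p + 1) := by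
  obtain ⟨C, hC0, hC⟩ := hd.exists_pos
  rw [IsBigOWith, eventually_atTop] at hC
  obtain ⟨n0, hn0⟩ := hC
  have step : ∀ n : ℕ, 1 ≤ n → (1 / ((n : ℝ) + 1)) ^ (p + 2) ≤
      (1 / (n : ℝ)) ^ (p + 1) - (1 / ((n : ℝ) + 1)) ^ (p + 1) := by
    intro n hn
    have hn' : (1 : ℝ) ≤ n := by exact_mod_cast hn
    have h1 : 1 / (n : ℝ) = 1 / ((n : ℝ) + 1) * (1 + 1 / n) := by field_simp
    have h2 : 1 / ((n : ℝ) + 1) ≤ 1 / n := by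
      apply one_div_le_one_div_of_le <;> linarith
    have h3 : 1 + 1 / (n : ℝ) ≤ (1 + 1 / (n : ℝ)) ^ (p + 1) :=
      le_self_pow₀ (by have : 0 < 1 / (n : ℝ) := by positivity
                       linarith) (by omega)
    have h4 : 0 ≤ (1 / ((n : ℝ) + 1)) ^ (p + 1) := by positivity
    rw [h1, mul_pow, pow_succ _ (p + 1)]
    nlinarith
  have hmono : ∀ (s : ℝ), |s| = 1 → ∀ n, max n0 1 ≤ n → 0 ≤ s * g n + C * (1 / (n : ℝ)) ^ (p + 1) := by
    intro s hs n hn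
    have hant : Antitone fun m : ℕ => s * g (n + m) + C * (1 / ((n + m : ℕ) : ℝ)) ^ (p + 1) := by
      refine antitone_nat_of_succ_le fun m => ?_
      have h1 := hn0 (n + m) (by omega)
      have h2 := step (n + m) (by omega)
      rw [Real.norm_eq_abs, Real.norm_of_nonneg (by positivity)] at h1
      have h3 : s * (g (n + m + 1) - g (n + m)) ≤ C * (1 / (((n + m : ℕ) : ℝ) + 1)) ^ (p + 2) := by
        refine (le_abs_self _).trans ?_
        rw [abs_mul, hs, one_mul]
        exact h1
      have h4 := mul_le_mul_of_nonneg_left h2 hC0.le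
      simp only [← add_assoc]
      push_cast at h3 h4 ⊢
      linarith
    have hlim : Tendsto (fun m : ℕ => s * g (n + m) + C * (1 / ((n + m : ℕ) : ℝ)) ^ (p + 1))
        atTop (𝓝 (s * 0 + C * 0 ^ (p + 1))) := by
      have hsh : Tendsto (fun m : ℕ => n + m) atTop atTop := by
        simpa only [add_comm] using tendsto_add_atTop_nat n
      exact ((hg.comp hsh).const_mul s).add
        (((tendsto_one_div_atTop_nhds_zero_nat.comp hsh).pow (p + 1)).const_mul C)
    have := hant.le_of_tendsto hlim 0
    simpa using this
  refine IsBigO.of_bound C ?_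
  filter_upwards [eventually_ge_atTop (max n0 1)] with n hn
  rw [Real.norm_eq_abs, Real.norm_of_nonneg (by positivity), abs_le]
  have h1 := hmono 1 (by simp) n hn
  have h2 := hmono (-1) (by simp) n hn
  constructor <;> linarith

/-- The reciprocal of Euler's product for Γ(β + 1), up to the factor n/(n + β + 1). -/
theorem tendsto_gb_div {β : ℝ} (hβ : -1 < β) :
    Tendsto (fun n : ℕ => Real.Gamma (β + 1) * gb β n / (n : ℝ) ^ β) atTop (𝓝 1) := by
  have hΓ : 0 < Real.Gamma (β + 1) := Real.Gamma_pos_of_pos (by linarith)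
  have h1 := Real.GammaSeq_tendsto_Gamma (β + 1)
  have h2 : Tendsto (fun n : ℕ => (n : ℝ) / (n + (β + 1))) atTop (𝓝 1) :=
    tendsto_natCast_div_add_atTop (β + 1)
  have h3 := (h2.div h1 hΓ.ne').const_mul (Real.Gamma (β + 1))
  rw [mul_one_div, div_self hΓ.ne'] at h3
  refine h3.congr' ?_
  filter_upwards [eventually_ge_atTop 1] with n hn
  have hn' : (0 : ℝ) < n := by exact_mod_cast hn
  have e : gb β n = (∏ j ∈ range n, (β + 1 + j)) / n.factorial := by
    have e2 : ∀ n : ℕ, (n.factorial : ℝ) = ∏ k ∈ range n, ((k : ℝ) + 1) := by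
      intro n
      rw [← prod_range_add_one_eq_factorial]
      push_cast
      rfl
    rw [gb, prod_div_distrib, e2]
    congr 1
    refine prod_congr rfl fun k _ => by ring
  have hpos : 0 < ∏ j ∈ range n, (β + 1 + (j : ℝ)) :=
    prod_pos fun j _ => by have := j.cast_nonneg (α := ℝ); linarith
  have hb : (n : ℝ) + (β + 1) ≠ 0 := (by linarith : 0 < (n : ℝ) + (β + 1)).ne'
  have hf : (n.factorial : ℝ) ≠ 0 := by positivity
  have hpow : (n : ℝ) ^ β ≠ 0 := (Real.rpow_pos_of_pos hn' _).ne'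
  simp only [Pi.div_apply, Real.GammaSeq]
  rw [prod_range_succ, e, Real.rpow_add_one hn'.ne']
  have hb' : β + 1 + (n : ℝ) ≠ 0 := by rwa [add_comm]
  have hpos' := hpos.ne'
  field_simp
  ring

/-- The first four terms of the expansion of `Γ(β + 1) gb β n / n ^ β` in powers of `1 / n`. -/
def gbExpansion (β x : ℝ) : ℝ :=
  1 + β * (β + 1) / 2 * x + β * (β ^ 2 - 1) * (3 * β + 2) / 24 * x ^ 2 +
    β ^ 2 * (β + 1) ^ 2 * (β - 1) * (β - 2) / 48 * x ^ 3

/-- With x = 1/(n+1) one has 1/n = x/(1-x), and (1+βx)(1-x)^β is the ratio of consecutive values of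
`gb β n` / n^β. The coefficients of `gbExpansion` are those that make it satisfy this recurrence up
to order x⁵. -/
theorem gbExpansion_step (β : ℝ) :
    (fun x : ℝ => gbExpansion β x - (1 + β * x) * (1 - x) ^ β * gbExpansion β (x / (1 - x)))
      =O[𝓝 0] fun x => x ^ 5 := by
  set T : ℝ → ℝ → ℝ := fun γ x => 1 - γ * x + γ * (γ - 1) / 2 * x ^ 2 -
    γ * (γ - 1) * (γ - 2) / 6 * x ^ 3 + γ * (γ - 1) * (γ - 2) * (γ - 3) / 24 * x ^ 4 with hT
  have hT5 : ∀ γ : ℝ, (fun x : ℝ => (1 - x) ^ γ - T γ x) =O[𝓝 0] fun x => x ^ 5 := by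
    intro γ
    refine (one_sub_rpow_taylor γ 5).congr_left fun x => ?_
    simp only [sum_range_succ, sum_range_zero, gb_succ, gb_zero, hT]
    push_cast
    ring
  set e1 := β * (β + 1) / 2 with he1
  set e2 := β * (β ^ 2 - 1) * (3 * β + 2) / 24 with he2
  set e3 := β ^ 2 * (β + 1) ^ 2 * (β - 1) * (β - 2) / 48 with he3
  have hcont : ∀ f : ℝ → ℝ, Continuous f → f =O[𝓝 0] fun _ => (1 : ℝ) := fun f hf =>
    (hf.tendsto 0).isBigO_one ℝ
  have hmul : ∀ (f : ℝ → ℝ) (γ : ℝ), Continuous f →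
      (fun x : ℝ => f x * ((1 - x) ^ γ - T γ x)) =O[𝓝 0] fun x => x ^ 5 := by
    intro f γ hf
    simpa using (hcont f hf).mul (hT5 γ)
  have hsum := (((hmul (fun x => 1 + β * x) β (by fun_prop)).add
    (hmul (fun x => (1 + β * x) * (e1 * x)) (β - 1) (by fun_prop))).add
    (hmul (fun x => (1 + β * x) * (e2 * x ^ 2)) (β - 2) (by fun_prop))).add
    (hmul (fun x => (1 + β * x) * (e3 * x ^ 3)) (β - 3) (by fun_prop))
  set t1 : ℝ → ℝ := fun γ => -γ with ht1
  set t2 : ℝ → ℝ := fun γ => γ * (γ - 1) / 2 with ht2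
  set t3 : ℝ → ℝ := fun γ => -(γ * (γ - 1) * (γ - 2) / 6) with ht3
  set t4 : ℝ → ℝ := fun γ => γ * (γ - 1) * (γ - 2) * (γ - 3) / 24 with ht4
  set s4 := t4 β + e1 * t3 (β - 1) + e2 * t2 (β - 2) + e3 * t1 (β - 3) with hs4
  set s5 := e1 * t4 (β - 1) + e2 * t3 (β - 2) + e3 * t2 (β - 3) with hs5
  set s6 := e2 * t4 (β - 2) + e3 * t3 (β - 3) with hs6
  set s7 := e3 * t4 (β - 3) with hs7
  -- The numbers `s4`, …, `s7` are the coefficients of x⁴, …, x⁷ before multiplication by 1 + βx.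
  -- This polynomial collects all terms of degree at least 5 of the product of the truncated series;
  -- those of lower degree cancel.
  have hpoly : (fun x : ℝ => x ^ 5 * ((s5 + β * s4) + (s6 + β * s5) * x + (s7 + β * s6) * x ^ 2 +
      β * s7 * x ^ 3)) =O[𝓝 0] fun x => x ^ 5 := by
    simpa using (isBigO_refl (fun x : ℝ => x ^ 5) (𝓝 0)).mul (hcont (fun x : ℝ => (s5 + β * s4) +
      (s6 + β * s5) * x + (s7 + β * s6) * x ^ 2 + β * s7 * x ^ 3) (by fun_prop))
  refine ((hsum.add hpoly).neg_left).congr' ?_ EventuallyEq.rfl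
  filter_upwards [eventually_lt_nhds (zero_lt_one (α := ℝ))] with x hx
  have hx' : 0 < 1 - x := by linarith
  have r1 : (1 - x) ^ (β - 1) = (1 - x) ^ β / (1 - x) := Real.rpow_sub_one hx'.ne' _
  have r2 : (1 - x) ^ (β - 2) = (1 - x) ^ β / (1 - x) ^ 2 := by
    exact_mod_cast Real.rpow_sub_natCast hx'.ne' β 2
  have r3 : (1 - x) ^ (β - 3) = (1 - x) ^ β / (1 - x) ^ 3 := by
    exact_mod_cast Real.rpow_sub_natCast hx'.ne' β 3
  have hexp : (1 - x) ^ β * gbExpansion β (x / (1 - x)) = (1 - x) ^ β + e1 * x * (1 - x) ^ (β - 1) +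
      e2 * x ^ 2 * (1 - x) ^ (β - 2) + e3 * x ^ 3 * (1 - x) ^ (β - 3) := by
    rw [r1, r2, r3, gbExpansion, div_pow, div_pow, ← he1, ← he2, ← he3]
    ring
  rw [mul_assoc (1 + β * x) ((1 - x) ^ β) _, hexp]
  generalize (1 - x) ^ β = u0
  generalize (1 - x) ^ (β - 1) = u1
  generalize (1 - x) ^ (β - 2) = u2
  generalize (1 - x) ^ (β - 3) = u3
  simp only [gbExpansion, hT, hs4, hs5, hs6, hs7, ht1, ht2, ht3, ht4, he1, he2, he3]
  ring

/-- Let b(n) be the normalised coefficient, which tends to 1. The quotient f(n) of the expansion and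
b(n) also tends to 1, and by `gbExpansion_step` its increments are O(n⁻⁵), so f(n) - 1 = O(n⁻⁴). -/
theorem gb_asymptotics {β : ℝ} (hβ : -1 < β) :
    (fun n : ℕ => Real.Gamma (β + 1) * gb β n - (n : ℝ) ^ β * gbExpansion β (1 / n)) =O[atTop]
      fun n : ℕ => (n : ℝ) ^ β * (1 / (n : ℝ)) ^ 4 := by
  have hΓ : 0 < Real.Gamma (β + 1) := Real.Gamma_pos_of_pos (by linarith)
  set b : ℕ → ℝ := fun n => Real.Gamma (β + 1) * gb β n / (n : ℝ) ^ β with hb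
  have hb1 : Tendsto b atTop (𝓝 1) := tendsto_gb_div hβ
  have hb0 : ∀ n : ℕ, 1 ≤ n → 0 < b n := fun n hn =>
    div_pos (mul_pos hΓ (gb_pos hβ n)) (Real.rpow_pos_of_pos (by exact_mod_cast hn) _)
  have hE : Tendsto (fun n : ℕ => gbExpansion β (1 / n)) atTop (𝓝 1) := by
    have hc : Continuous (gbExpansion β) := by unfold gbExpansion; fun_prop
    have h1 := (hc.tendsto 0).comp (tendsto_one_div_atTop_nhds_zero_nat (𝕜 := ℝ))
    have h2 : gbExpansion β 0 = 1 := by simp [gbExpansion]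
    rwa [h2] at h1
  set f : ℕ → ℝ := fun n => gbExpansion β (1 / n) / b n with hf
  have hf1 : Tendsto (fun n => f n - 1) atTop (𝓝 0) := by
    have h1 := (hE.div hb1 one_ne_zero).sub_const 1
    rwa [div_one, sub_self] at h1
  have hx0 : Tendsto (fun n : ℕ => 1 / ((n : ℝ) + 1)) atTop (𝓝 0) :=
    tendsto_one_div_add_atTop_nhds_zero_nat
  have hstep := (gbExpansion_step β).comp_tendsto hx0
  have hbinv : (fun n : ℕ => (b (n + 1))⁻¹) =O[atTop] fun _ => (1 : ℝ) :=
    (((tendsto_add_atTop_iff_nat 1).2 hb1).inv₀ one_ne_zero).isBigO_one ℝ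
  have hd : (fun n => (f (n + 1) - 1) - (f n - 1)) =O[atTop]
      fun n : ℕ => (1 / ((n : ℝ) + 1)) ^ (3 + 2) := by
    have h1 := hstep.mul hbinv
    simp only [mul_one] at h1
    refine h1.congr' ?_ EventuallyEq.rfl
    filter_upwards [eventually_ge_atTop 1] with n hn
    have hn0 : (0 : ℝ) < n := by exact_mod_cast hn
    have hn1 : (0 : ℝ) < (n : ℝ) + 1 := by positivity
    have hsub : 1 - 1 / ((n : ℝ) + 1) = n / (n + 1) := by field_simp; ring
    have hdiv : 1 / ((n : ℝ) + 1) / (n / (n + 1)) = 1 / n := by field_simp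
    have hbs : b (n + 1) = (1 + β * (1 / ((n : ℝ) + 1))) * (n / (n + 1)) ^ β * b n := by
      simp only [hb]
      rw [gb_succ, Real.div_rpow hn0.le hn1.le]
      have h3 : (n : ℝ) ^ β ≠ 0 := (Real.rpow_pos_of_pos hn0 _).ne'
      have h4 : ((n : ℝ) + 1) ^ β ≠ 0 := (Real.rpow_pos_of_pos hn1 _).ne'
      push_cast
      field_simp
      ring
    have hbn := (hb0 n hn).ne'
    have hbn1 := (hb0 (n + 1) (by omega)).ne'
    simp only [Function.comp, hf]
    rw [hsub, hdiv, sub_sub_sub_cancel_right, sub_mul, ← div_eq_mul_inv]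
    push_cast
    congr 1
    rw [hbs] at hbn1 ⊢
    have hρ := left_ne_zero_of_mul hbn1
    rw [mul_comm, ← div_eq_inv_mul, mul_comm _ (b n), mul_comm (b n),
      mul_div_mul_left _ _ hρ]
  have h4 := isBigO_of_tendsto_zero_of_sub hf1 hd
  have h5 : (fun n : ℕ => (n : ℝ) ^ β * (-b n * (f n - 1))) =O[atTop]
      fun n : ℕ => (n : ℝ) ^ β * (1 * (1 / (n : ℝ)) ^ 4) :=
    (isBigO_refl _ _).mul (((hb1.neg).isBigO_one ℝ).mul h4)
  simp only [one_mul] at h5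
  refine h5.congr' ?_ EventuallyEq.rfl
  filter_upwards [eventually_ge_atTop 1] with n hn
  have hn0 : (0 : ℝ) < n := by exact_mod_cast hn
  have hbn := (hb0 n hn).ne'
  have h6 : Real.Gamma (β + 1) * gb β n = (n : ℝ) ^ β * b n := by
    simp only [hb]
    rw [mul_div_cancel₀ _ (Real.rpow_pos_of_pos hn0 _).ne']
  rw [h6]
  simp only [hf]
  field_simp
  ring

end RieszDiffusion
end

noncomputable section
namespace RieszDiffusion

open Finset Filter Topology Asymptotics

/-! Expansion of the quotient factor at `1`. -/

/-- `mk c - ∑ c` divided by `1 - X`. -/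
def tailSeq (c : ℕ → ℝ) (n : ℕ) : ℝ := -∑' i, c (n + 1 + i)

theorem abs_tailSeq_le {c : ℕ → ℝ} {K : ℝ} (h : ∀ n, |c n| ≤ K * (5 / 6) ^ n) (n : ℕ) :
    |tailSeq c n| ≤ (5 * K) * (5 / 6) ^ n := by
  rw [tailSeq, abs_neg]
  have hg : HasSum (fun i : ℕ => K * (5 / 6 : ℝ) ^ (n + 1) * (5 / 6) ^ i)
      (K * (5 / 6) ^ (n + 1) * (1 - 5 / 6)⁻¹) :=
    (hasSum_geometric_of_lt_one (by norm_num) (by norm_num)).mul_left _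
  have := tsum_of_norm_bounded (f := fun i => c (n + 1 + i)) hg fun i => by
    rw [Real.norm_eq_abs, mul_assoc, ← pow_add]
    exact h _
  rw [Real.norm_eq_abs] at this
  refine this.trans (le_of_eq ?_)
  rw [pow_succ]
  norm_num
  ring

theorem tailSeq_zero {c : ℕ → ℝ} (hc : Summable c) : tailSeq c 0 = c 0 - ∑' n, c n := by
  rw [hc.tsum_eq_zero_add, tailSeq]
  simp only [zero_add, add_comm 1]
  ring

theorem tailSeq_succ {c : ℕ → ℝ} (hc : Summable c) (n : ℕ) :
    tailSeq c (n + 1) - tailSeq c n = c (n + 1) := by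
  have h : Summable fun i => c (n + 1 + i) := by
    simpa only [add_comm] using (summable_nat_add_iff (n + 1)).2 hc
  rw [tailSeq, tailSeq, h.tsum_eq_zero_add]
  simp only [add_zero]
  have e : ∀ b, c (n + 1 + (b + 1)) = c (n + 1 + 1 + b) := fun b => by congr 1; ring
  simp only [e]
  ring

theorem mk_eq_tailSeq {c : ℕ → ℝ} (hc : Summable c) :
    PowerSeries.mk c = PowerSeries.C (∑' n, c n) + (1 - PowerSeries.X) * PowerSeries.mk (tailSeq c) := by
  ext n
  cases n with
  | zero => simp [sub_mul, tailSeq_zero hc]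
  | succ n =>
    simp [sub_mul, PowerSeries.coeff_succ_X_mul]
    rw [← tailSeq_succ hc n]

theorem tsum_eq_tailSeq {c : ℕ → ℝ} {K : ℝ} (h : ∀ n, |c n| ≤ K * (5 / 6) ^ n) {x : ℝ}
    (hx : |x| ≤ 1) :
    ∑' n, c n * x ^ n = ∑' n, c n + (1 - x) * ∑' n, tailSeq c n * x ^ n := by
  have hs : ∀ {d : ℕ → ℝ} {K : ℝ}, (∀ n, |d n| ≤ K * (5 / 6) ^ n) →
      Summable fun n => d n * x ^ n := by
    intro d K hd
    refine Summable.of_norm_bounded (summable_geometric_bound hd) fun n => ?_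
    rw [norm_mul, norm_pow, Real.norm_eq_abs, Real.norm_eq_abs]
    exact mul_le_of_le_one_right (abs_nonneg _) (pow_le_one₀ (abs_nonneg _) hx)
  have hc : Summable c := (summable_geometric_bound h).of_abs
  have h1 := hs h
  have h2 := hs (abs_tailSeq_le h)
  have h3 : Summable fun n => tailSeq c (n + 1) * x ^ (n + 1) :=
    (summable_nat_add_iff (f := fun n => tailSeq c n * x ^ n) 1).2 h2
  have h4 : ∑' n, c (n + 1) * x ^ (n + 1) =
      ∑' n, tailSeq c (n + 1) * x ^ (n + 1) - x * ∑' n, tailSeq c n * x ^ n := by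
    rw [← tsum_mul_left, ← h3.tsum_sub (h2.mul_left x)]
    refine tsum_congr fun n => ?_
    rw [← tailSeq_succ hc n]
    ring
  rw [h1.tsum_eq_zero_add, h4, sub_mul, one_mul]
  nth_rw 2 [h2.tsum_eq_zero_add]
  rw [tailSeq_zero hc]
  ring

/-- Peels off one Taylor coefficient at a time. The limit is one-sided because the series for q^α at
z = 1 - y is compared only for 0 < y < 1. -/
theorem eq_zero_of_add_mul_isBigO {a : ℝ} {g : ℝ → ℝ} (hg : Continuous g) {k : ℕ}
    (h : (fun y => a + y * g y) =O[𝓝[>] 0] fun y : ℝ => y ^ (k + 1)) :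
    a = 0 ∧ g =O[𝓝[>] 0] fun y : ℝ => y ^ k := by
  have h0 : a = 0 := by
    have t1 : Tendsto (fun y : ℝ => y ^ (k + 1)) (𝓝[>] 0) (𝓝 0) := by
      have : Tendsto (fun y : ℝ => y ^ (k + 1)) (𝓝 0) (𝓝 (0 ^ (k + 1))) :=
        (continuous_pow (k + 1)).tendsto 0
      rw [zero_pow (Nat.succ_ne_zero k)] at this
      exact this.mono_left nhdsWithin_le_nhds
    have t2 := h.trans_tendsto t1
    have t3 : Tendsto (fun y => a + y * g y) (𝓝[>] 0) (𝓝 (a + 0 * g 0)) :=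
      ((by fun_prop : Continuous fun y => a + y * g y).tendsto 0).mono_left nhdsWithin_le_nhds
    simpa using tendsto_nhds_unique t3 t2
  refine ⟨h0, ?_⟩
  subst h0
  have h1 := h.mul (isBigO_refl (fun y : ℝ => y⁻¹) (𝓝[>] 0))
  refine h1.congr' ?_ ?_
  · filter_upwards [self_mem_nhdsWithin] with y hy
    have : y ≠ 0 := ne_of_gt hy
    field_simp
    ring
  · filter_upwards [self_mem_nhdsWithin] with y hy
    have : y ≠ 0 := ne_of_gt hy
    rw [pow_succ]
    field_simp

theorem bdfQuot_rpow_taylor (α : ℝ) :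
    (fun y : ℝ => bdfQuot (1 - y) ^ α - (1 + α / 2 * y + (α / 3 + α * (α - 1) / 8) * y ^ 2 +
      (α / 4 + α * (α - 1) / 6 + α * (α - 1) * (α - 2) / 48) * y ^ 3)) =O[𝓝 0]
      fun y => y ^ 4 := by
  set v : ℝ → ℝ := fun y => -(1 / 2 + y / 3 + y ^ 2 / 4) with hv
  have hvc : Continuous v := by fun_prop
  have hs : Tendsto (fun y : ℝ => y * v y) (𝓝 0) (𝓝 0) := by
    have := (by fun_prop : Continuous fun y : ℝ => y * v y).tendsto 0
    simpa using this
  have h1 := (one_sub_rpow_taylor α 4).comp_tendsto hs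
  have hcont : ∀ f : ℝ → ℝ, Continuous f →
      (fun y => y ^ 4 * f y) =O[𝓝 0] fun y : ℝ => y ^ 4 := fun f hf => by
    simpa using (isBigO_refl (fun x : ℝ => x ^ 4) (𝓝 0)).mul ((hf.tendsto 0).isBigO_one ℝ)
  have h2 : (fun y : ℝ => (y * v y) ^ 4) =O[𝓝 0] fun y : ℝ => y ^ 4 := by
    simpa only [mul_pow] using hcont (fun y => v y ^ 4) (by fun_prop)
  have h3 := h1.trans h2
  -- The powers (y v)² and (y v)³ of the binomial expansion also contain terms of degree at least 4;
  -- these are y⁴ times the polynomials given here.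
  have h4 := hcont (fun y => (α * (α - 1) / 2) * (13 / 36 + y / 6 + y ^ 2 / 16) +
    (α * (α - 1) * (α - 2) / 6) * (1 / 4 + 17 / 48 * y + 31 / 108 * y ^ 2 + 17 / 96 * y ^ 3 +
      y ^ 4 / 16 + y ^ 5 / 64)) (by fun_prop)
  refine (h3.add h4).congr_left fun y => ?_
  have e : bdfQuot (1 - y) = 1 - y * v y := by
    simp only [bdfQuot, hv]; ring
  simp only [Function.comp, e, sum_range_succ, sum_range_zero, gb_succ, gb_zero]
  generalize (1 - y * v y) ^ α = w
  simp only [hv]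
  push_cast
  ring

/-- The expansion of the quotient factor at `1` with a geometrically decaying remainder. -/
theorem exists_quotCoeff_expansion (α : ℝ) : ∃ (r : ℕ → ℝ) (K : ℝ),
    (∀ n, |r n| ≤ K * (5 / 6) ^ n) ∧ PowerSeries.mk (quotCoeff α) =
      1 + PowerSeries.C (α / 2) * (1 - PowerSeries.X) +
      PowerSeries.C (α / 3 + α * (α - 1) / 8) * (1 - PowerSeries.X) ^ 2 +
      PowerSeries.C (α / 4 + α * (α - 1) / 6 + α * (α - 1) * (α - 2) / 48) *
        (1 - PowerSeries.X) ^ 3 + (1 - PowerSeries.X) ^ 4 * PowerSeries.mk r := by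
  obtain ⟨K, h0⟩ := exists_abs_quotCoeff_le α
  set c := quotCoeff α with hc
  have h1 := abs_tailSeq_le h0
  have h2 := abs_tailSeq_le h1
  have h3 := abs_tailSeq_le h2
  have h4 := abs_tailSeq_le h3
  set t1 := tailSeq c
  set t2 := tailSeq t1
  set t3 := tailSeq t2
  set t4 := tailSeq t3
  set s0 := ∑' n, c n
  set s1 := ∑' n, t1 n
  set s2 := ∑' n, t2 n
  set s3 := ∑' n, t3 n
  have hval : ∀ y ∈ Set.Ioo (0 : ℝ) 1, bdfQuot (1 - y) ^ α =
      s0 + s1 * y + s2 * y ^ 2 + s3 * y ^ 3 + y ^ 4 * ∑' n, t4 n * (1 - y) ^ n := by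
    intro y hy
    have hx : |1 - y| ≤ 1 := by rw [abs_le]; constructor <;> linarith [hy.1, hy.2]
    have hsum : ∑' n, c n * (1 - y) ^ n = bdfQuot (1 - y) ^ α := by
      have h := hasSum_quotCoeff α (z := ((1 - y : ℝ) : ℂ)) (by
        rw [Complex.norm_real, Real.norm_eq_abs]; exact hx.trans_lt (by norm_num))
      rw [bdfQuot_ofReal, ← Complex.ofReal_cpow (bdfQuot_pos _).le] at h
      · have h' : HasSum (fun n => c n * (1 - y) ^ n) (bdfQuot (1 - y) ^ α) := by
          exact_mod_cast h
        exact h'.tsum_eq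
      · nlinarith [hy.1, hy.2]
    rw [← hsum, tsum_eq_tailSeq h0 hx, tsum_eq_tailSeq h1 hx, tsum_eq_tailSeq h2 hx,
      tsum_eq_tailSeq h3 hx]
    ring
  have hO : (fun y : ℝ => (s0 - 1) + y * ((s1 - α / 2) + y * ((s2 - (α / 3 + α * (α - 1) / 8)) +
      y * ((s3 - (α / 4 + α * (α - 1) / 6 + α * (α - 1) * (α - 2) / 48)) + y * 0))))
      =O[𝓝[>] 0] fun y : ℝ => y ^ 4 := by
    have hb : (fun y : ℝ => y ^ 4 * ∑' n, t4 n * (1 - y) ^ n) =O[𝓝[>] 0] fun y : ℝ => y ^ 4 := by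
      refine IsBigO.of_bound (∑' n, |t4 n|) ?_
      filter_upwards [Ioo_mem_nhdsGT (zero_lt_one (α := ℝ))] with y hy
      rw [norm_mul, mul_comm]
      refine mul_le_mul_of_nonneg_right ?_ (norm_nonneg _)
      refine tsum_of_norm_bounded (summable_geometric_bound h4).hasSum fun n => ?_
      rw [norm_mul, norm_pow, Real.norm_eq_abs]
      refine mul_le_of_le_one_right (abs_nonneg _) (pow_le_one₀ (norm_nonneg _) ?_)
      rw [Real.norm_eq_abs, abs_le]
      constructor <;> linarith [hy.1, hy.2]
    refine (((bdfQuot_rpow_taylor α).mono nhdsWithin_le_nhds).sub hb).congr' ?_ EventuallyEq.rfl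
    filter_upwards [Ioo_mem_nhdsGT (zero_lt_one (α := ℝ))] with y hy
    rw [hval y hy]
    ring
  obtain ⟨e0, hO⟩ := eq_zero_of_add_mul_isBigO (by fun_prop) hO
  obtain ⟨e1, hO⟩ := eq_zero_of_add_mul_isBigO (by fun_prop) hO
  obtain ⟨e2, hO⟩ := eq_zero_of_add_mul_isBigO (by fun_prop) hO
  obtain ⟨e3, -⟩ := eq_zero_of_add_mul_isBigO (k := 0) continuous_const hO
  refine ⟨t4, _, h4, ?_⟩
  rw [mk_eq_tailSeq (summable_geometric_bound h0).of_abs,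
    mk_eq_tailSeq (summable_geometric_bound h1).of_abs,
    mk_eq_tailSeq (summable_geometric_bound h2).of_abs,
    mk_eq_tailSeq (summable_geometric_bound h3).of_abs]
  change PowerSeries.C s0 + _ * (PowerSeries.C s1 + _ * (PowerSeries.C s2 + _ *
    (PowerSeries.C s3 + _ * PowerSeries.mk t4))) = _
  rw [sub_eq_zero.1 e0, sub_eq_zero.1 e1, sub_eq_zero.1 e2, sub_eq_zero.1 e3, map_one]
  ring

end RieszDiffusion
end

noncomputable section
namespace RieszDiffusion

open Finset Filter Topology Asymptotics

/-! Sequences of order `n ^ (-α)`. -/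

/-- `f n = O((n + 1) ^ (-α))`, uniformly in `n`. -/
def Decays (α : ℝ) (f : ℕ → ℝ) : Prop := ∃ C : ℝ, ∀ n, |f n| ≤ C * ((n : ℝ) + 1) ^ (-α)

theorem Decays.add {α : ℝ} {f g : ℕ → ℝ} (hf : Decays α f) (hg : Decays α g) :
    Decays α fun n => f n + g n := by
  obtain ⟨C, hC⟩ := hf
  obtain ⟨D, hD⟩ := hg
  refine ⟨C + D, fun n => (abs_add_le _ _).trans ?_⟩
  rw [add_mul]
  exact add_le_add (hC n) (hD n)

theorem Decays.const_mul {α : ℝ} {f : ℕ → ℝ} (hf : Decays α f) (a : ℝ) :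
    Decays α fun n => a * f n := by
  obtain ⟨C, hC⟩ := hf
  refine ⟨|a| * C, fun n => ?_⟩
  rw [abs_mul, mul_assoc]
  exact mul_le_mul_of_nonneg_left (hC n) (abs_nonneg _)

theorem Decays.congr {α : ℝ} {f g : ℕ → ℝ} (hf : Decays α f) (h : ∀ n, f n = g n) :
    Decays α g := by
  have : f = g := funext h
  rwa [← this]

/-- Since (0 : ℝ) ^ (-α) = 0, a bound by n^{-α} would force the value at n = 0 to vanish. The shift
to n + 1 in `Decays` absorbs finitely many initial terms. -/
theorem Decays.of_isBigO {α : ℝ} (h0 : 0 < α) {f : ℕ → ℝ}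
    (h : f =O[atTop] fun n : ℕ => (n : ℝ) ^ (-α)) : Decays α f := by
  have h1 : (fun n : ℕ => (n : ℝ) ^ (-α)) =O[atTop] fun n : ℕ => ((n : ℝ) + 1) ^ (-α) := by
    refine IsBigO.of_bound (2 ^ α) ?_
    filter_upwards [eventually_ge_atTop 1] with n hn
    have hn' : (1 : ℝ) ≤ n := by exact_mod_cast hn
    rw [Real.norm_of_nonneg (by positivity), Real.norm_of_nonneg (by positivity),
      Real.rpow_neg (by positivity), Real.rpow_neg (by positivity), ← div_eq_mul_inv,
      ← Real.div_rpow (by norm_num) (by positivity), ← Real.inv_rpow (by positivity)]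
    refine Real.rpow_le_rpow (by positivity) ?_ h0.le
    rw [inv_eq_one_div, div_le_div_iff₀ (by positivity) (by positivity)]
    linarith
  obtain ⟨C, -, hC⟩ := bound_of_isBigO_nat_atTop (h.trans h1)
  refine ⟨C, fun n => ?_⟩
  have hpos : 0 < ((n : ℝ) + 1) ^ (-α) := by positivity
  have := hC (x := n) hpos.ne'
  rwa [Real.norm_eq_abs, Real.norm_of_nonneg hpos.le] at this

theorem Decays.shift {α : ℝ} (h0 : 0 < α) {f : ℕ → ℝ} (hf : Decays α f) :
    Decays α fun n => f (n - 1) := by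
  obtain ⟨C, hC⟩ := hf
  have hC0 : 0 ≤ C := by
    have := (abs_nonneg _).trans (hC 0)
    simpa using this
  refine ⟨C * 2 ^ α, fun n => (hC _).trans ?_⟩
  rw [mul_assoc]
  refine mul_le_mul_of_nonneg_left ?_ hC0
  cases n with
  | zero => simpa using Real.one_le_rpow (by norm_num : (1 : ℝ) ≤ 2) h0.le
  | succ n =>
    rw [Nat.add_sub_cancel, Real.rpow_neg (by positivity), Real.rpow_neg (by positivity),
      ← div_eq_mul_inv, ← Real.div_rpow (by norm_num) (by positivity),
      ← Real.inv_rpow (by positivity)]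
    refine Real.rpow_le_rpow (by positivity) ?_ h0.le
    rw [inv_eq_one_div, div_le_div_iff₀ (by positivity) (by positivity)]
    push_cast
    linarith

theorem Decays.one_sub_X_mul {α : ℝ} (h0 : 0 < α) {f : PowerSeries ℝ}
    (hf : Decays α fun n => PowerSeries.coeff n f) :
    Decays α fun n => PowerSeries.coeff n ((1 - PowerSeries.X) * f) := by
  obtain ⟨C, hC⟩ := hf.add ((hf.shift h0).const_mul (-1))
  obtain ⟨D, hD⟩ := hf
  refine ⟨max C D, fun n => ?_⟩
  have hpos : 0 < ((n : ℝ) + 1) ^ (-α) := by positivity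
  -- At n = 0 the truncated index n - 1 is again 0, so this case is bounded by the estimate for f
  -- itself.
  cases n with
  | zero =>
    refine le_trans ?_ (mul_le_mul_of_nonneg_right (le_max_right C D) hpos.le)
    simpa [sub_mul] using hD 0
  | succ n =>
    refine le_trans ?_ (mul_le_mul_of_nonneg_right (le_max_left C D) hpos.le)
    have := hC (n + 1)
    simp only [Nat.add_sub_cancel] at this
    beta_reduce
    rw [sub_mul, one_mul, map_sub, PowerSeries.coeff_succ_X_mul]
    simpa [sub_eq_add_neg] using this

theorem Decays.mul_geometric {α : ℝ} (h0 : 0 < α) (h1 : α < 1) {f : PowerSeries ℝ}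
    (hf : Decays α fun n => PowerSeries.coeff n f) {r : ℕ → ℝ} {K : ℝ}
    (hr : ∀ n, |r n| ≤ K * (5 / 6) ^ n) :
    Decays α fun n => PowerSeries.coeff n (PowerSeries.mk r * f) := by
  obtain ⟨C, hC⟩ := hf
  have hC0 : 0 ≤ C := by
    have := (abs_nonneg _).trans (hC 0)
    simpa using this
  have hK0 : 0 ≤ K := by
    have := (abs_nonneg _).trans (hr 0)
    simpa using this
  have hsum : Summable fun i : ℕ => ((i : ℝ) + 1) * (5 / 6) ^ i := by
    have h1 := summable_pow_mul_geometric_of_norm_lt_one 1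
      (r := (5 / 6 : ℝ)) (by rw [Real.norm_of_nonneg] <;> norm_num)
    have h2 := summable_geometric_of_lt_one (r := (5 / 6 : ℝ)) (by norm_num) (by norm_num)
    refine (h1.add h2).congr fun i => ?_
    ring
  refine ⟨K * C * ∑' i : ℕ, ((i : ℝ) + 1) * (5 / 6) ^ i, fun n => ?_⟩
  beta_reduce
  rw [PowerSeries.coeff_mul]
  have hterm : ∀ p ∈ antidiagonal n, |PowerSeries.coeff p.1 (PowerSeries.mk r) * PowerSeries.coeff p.2 f|
      ≤ K * C * ((n : ℝ) + 1) ^ (-α) * (((p.1 : ℝ) + 1) * (5 / 6) ^ p.1) := by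
    intro p hp
    have hp' : (p.1 : ℝ) + p.2 = n := by exact_mod_cast mem_antidiagonal.1 hp
    have hi : (0 : ℝ) ≤ p.1 := p.1.cast_nonneg
    have hj : (0 : ℝ) ≤ p.2 := p.2.cast_nonneg
    have hn : (0 : ℝ) ≤ n := n.cast_nonneg
    rw [abs_mul, PowerSeries.coeff_mk]
    -- From n + 1 ≤ (i+1)(j+1) for i + j = n, and (i+1)^α ≤ i+1. The extra factor i+1 is harmless
    -- against (5/6)^i.
    have hq : ((p.2 : ℝ) + 1) ^ (-α) ≤ ((n : ℝ) + 1) ^ (-α) * ((p.1 : ℝ) + 1) := by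
      have h2 : ((n : ℝ) + 1) ^ α ≤ ((p.1 : ℝ) + 1) ^ α * ((p.2 : ℝ) + 1) ^ α := by
        rw [← Real.mul_rpow (by positivity) (by positivity)]
        refine Real.rpow_le_rpow (by positivity) ?_ h0.le
        nlinarith
      have h3 : ((p.1 : ℝ) + 1) ^ α ≤ (p.1 : ℝ) + 1 := by
        conv_rhs => rw [← Real.rpow_one ((p.1 : ℝ) + 1)]
        exact Real.rpow_le_rpow_of_exponent_le (by linarith) h1.le
      rw [Real.rpow_neg (by positivity), Real.rpow_neg (by positivity), inv_mul_eq_div,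
        le_div_iff₀ (by positivity), inv_mul_le_iff₀ (by positivity)]
      calc ((n : ℝ) + 1) ^ α ≤ ((p.1 : ℝ) + 1) ^ α * ((p.2 : ℝ) + 1) ^ α := h2
        _ ≤ ((p.1 : ℝ) + 1) * ((p.2 : ℝ) + 1) ^ α := by gcongr
        _ = _ := mul_comm _ _
    calc |r p.1| * |PowerSeries.coeff p.2 f|
        ≤ (K * (5 / 6) ^ p.1) * (C * ((p.2 : ℝ) + 1) ^ (-α)) := by
          gcongr
          · exact hr _
          · exact hC _
      _ ≤ (K * (5 / 6) ^ p.1) * (C * (((n : ℝ) + 1) ^ (-α) * ((p.1 : ℝ) + 1))) := by gcongr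
      _ = _ := by ring
  refine (abs_sum_le_sum_abs _ _).trans ((sum_le_sum hterm).trans ?_)
  rw [← mul_sum, Finset.Nat.sum_antidiagonal_eq_sum_range_succ_mk]
  simp only
  have hle := hsum.sum_le_tsum (range n.succ) fun i _ => by positivity
  calc _ ≤ K * C * ((n : ℝ) + 1) ^ (-α) * ∑' i : ℕ, ((i : ℝ) + 1) * (5 / 6) ^ i := by gcongr
    _ = _ := by ring

/-! Products of power series with generalized binomial coefficients. -/

theorem one_sub_X_mul_mk_gb (β : ℝ) :
    (1 - PowerSeries.X) * PowerSeries.mk (gb β) = PowerSeries.mk (gb (β - 1)) := by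
  ext n
  cases n with
  | zero => simp [sub_mul]
  | succ n =>
    rw [sub_mul, one_mul, map_sub, PowerSeries.coeff_succ_X_mul]
    simp only [PowerSeries.coeff_mk]
    exact gb_succ_sub β n

theorem one_sub_X_pow_mul_mk_gb (β : ℝ) (k : ℕ) :
    (1 - PowerSeries.X) ^ k * PowerSeries.mk (gb β) = PowerSeries.mk (gb (β - k)) := by
  induction k with
  | zero => simp
  | succ k ih =>
    rw [pow_succ', mul_assoc, ih, one_sub_X_mul_mk_gb]
    push_cast
    ring_nf

theorem mk_gb_neg_one : PowerSeries.mk (gb (-1)) = 1 := by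
  ext n
  cases n with
  | zero => simp
  | succ n => simpa [PowerSeries.coeff_one] using gb_sub_one_succ 0 n

theorem mk_weight (α : ℝ) :
    PowerSeries.mk (weight α) = PowerSeries.mk (gb (-α - 1)) * PowerSeries.mk (quotCoeff α) := by
  ext n
  rw [PowerSeries.coeff_mul, PowerSeries.coeff_mk, weight_eq]
  simp

/-- Formally (1-X)^α (1-X)^{-i-1} = (1-X)^{-(i-α)-1}. Multiplying by (1-X)^{i+1} reduces this to
integer powers, because `gb (-1)` is the unit series. -/
theorem mk_weight_mul_mk_gb (α : ℝ) (i : ℕ) :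
    PowerSeries.mk (weight α) * PowerSeries.mk (gb i) =
      PowerSeries.mk (gb (i - α)) * PowerSeries.mk (quotCoeff α) := by
  have h1 := one_sub_X_pow_mul_mk_gb (i : ℝ) (i + 1)
  have h2 := one_sub_X_pow_mul_mk_gb (i - α : ℝ) (i + 1)
  rw [show (i : ℝ) - ((i + 1 : ℕ) : ℝ) = -1 by push_cast; ring, mk_gb_neg_one] at h1
  rw [show (i : ℝ) - α - ((i + 1 : ℕ) : ℝ) = -α - 1 by push_cast; ring] at h2
  rw [mk_weight, ← h2]
  linear_combination (PowerSeries.mk (gb (i - α)) * PowerSeries.mk (quotCoeff α)) * h1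

theorem decays_gb_neg {α : ℝ} (h0 : 0 < α) (h1 : α < 1) : Decays α (gb (-α)) := by
  have h := tendsto_gb_div (show (-1 : ℝ) < -α by linarith)
  have hΓ : 0 < Real.Gamma (-α + 1) := Real.Gamma_pos_of_pos (by linarith)
  refine Decays.of_isBigO h0 ?_
  have h2 := (h.isBigO_one ℝ).mul (isBigO_refl (fun n : ℕ => (n : ℝ) ^ (-α)) atTop)
  have h3 := h2.const_mul_left (Real.Gamma (-α + 1))⁻¹
  simp only [one_mul] at h3
  refine h3.congr' ?_ EventuallyEq.rfl
  filter_upwards [eventually_ge_atTop 1] with n hn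
  have hn0 : (0 : ℝ) < n := by exact_mod_cast hn
  have := (Real.rpow_pos_of_pos hn0 (-α)).ne'
  field_simp

theorem decays_gb_sub {α : ℝ} (h0 : 0 < α) (h1 : α < 1) (k : ℕ) : Decays α (gb (-α - k)) := by
  induction k with
  | zero => simpa using decays_gb_neg h0 h1
  | succ k ih =>
    have h := Decays.one_sub_X_mul h0 (f := PowerSeries.mk (gb (-α - k))) (by simpa using ih)
    rw [one_sub_X_mul_mk_gb] at h
    refine h.congr fun n => ?_
    rw [PowerSeries.coeff_mk]
    push_cast
    ring_nf

end RieszDiffusion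
end

noncomputable section
namespace RieszDiffusion

open Finset Filter Topology Asymptotics

/-! Convolution of the weights with monomials. -/

/-- The coefficient of `y²` in `(1 + y/2 + y²/3 + y³/4) ^ α`. -/
def quotTaylor₂ (α : ℝ) : ℝ := α / 3 + α * (α - 1) / 8

/-- The coefficient of `y³` in `(1 + y/2 + y²/3 + y³/4) ^ α`. -/
def quotTaylor₃ (α : ℝ) : ℝ := α / 4 + α * (α - 1) / 6 + α * (α - 1) * (α - 2) / 48

/-- The convolution of the weights with `gb i`. -/
def weightGb (α : ℝ) (i n : ℕ) : ℝ :=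
  PowerSeries.coeff n (PowerSeries.mk (weight α) * PowerSeries.mk (gb i))

/-- For `i ≤ 4` the convolution of the weights with `gb i` is given by four generalized binomial
coefficients up to order `n ^ (-α)`. -/
theorem decays_weightGb {α : ℝ} (h0 : 0 < α) (h1 : α < 1) {i : ℕ} (hi : i ≤ 4) :
    Decays α fun n => weightGb α i n - (gb (i - α) n + α / 2 * gb (i - α - 1) n +
      quotTaylor₂ α * gb (i - α - 2) n + quotTaylor₃ α * gb (i - α - 3) n) := by
  obtain ⟨r, K, hr, he⟩ := exists_quotCoeff_expansion α
  have h : PowerSeries.mk (weight α) * PowerSeries.mk (gb i) =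
      PowerSeries.mk (gb (i - α)) + PowerSeries.C (α / 2) * PowerSeries.mk (gb (i - α - 1)) +
      PowerSeries.C (quotTaylor₂ α) * PowerSeries.mk (gb (i - α - 2)) +
      PowerSeries.C (quotTaylor₃ α) * PowerSeries.mk (gb (i - α - 3)) +
      PowerSeries.mk r * PowerSeries.mk (gb (i - α - 4)) := by
    have e1 := one_sub_X_pow_mul_mk_gb (i - α) 1
    have e2 := one_sub_X_pow_mul_mk_gb (i - α) 2
    have e3 := one_sub_X_pow_mul_mk_gb (i - α) 3
    have e4 := one_sub_X_pow_mul_mk_gb (i - α) 4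
    push_cast at e1 e2 e3 e4
    rw [mk_weight_mul_mk_gb, he, ← e1, ← e2, ← e3, ← e4, quotTaylor₂, quotTaylor₃]
    ring
  have hd : Decays α fun n => PowerSeries.coeff n (PowerSeries.mk r *
      PowerSeries.mk (gb (i - α - 4))) := by
    refine Decays.mul_geometric h0 h1 ?_ hr
    -- The exponent i - α - 4 equals -α - (4-i); this is where i ≤ 4 is needed.
    have := decays_gb_sub h0 h1 (4 - i)
    refine this.congr fun n => ?_
    rw [PowerSeries.coeff_mk]
    push_cast [hi]
    ring_nf
  refine hd.congr fun n => ?_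
  rw [weightGb, h]
  simp only [map_add, PowerSeries.coeff_C_mul, PowerSeries.coeff_mk]
  ring

/-- The leading part of `gb (m - α) n`. -/
theorem decays_gb_sub_main {α : ℝ} (h0 : 0 < α) (h1 : α < 1) {m : ℕ} (hm : m ≤ 4) :
    Decays α fun n => Real.Gamma (m - α + 1) * gb (m - α) n -
      (n : ℝ) ^ (m - α) * gbExpansion (m - α) (1 / n) := by
  have hβ : (-1 : ℝ) < m - α := by
    have : (0 : ℝ) ≤ m := m.cast_nonneg
    linarith
  refine Decays.of_isBigO h0 ((gb_asymptotics hβ).trans ?_)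
  refine IsBigO.of_bound 1 ?_
  filter_upwards [eventually_ge_atTop 1] with n hn
  have hn' : (1 : ℝ) ≤ n := by exact_mod_cast hn
  have hn0 : (0 : ℝ) < n := by linarith
  rw [one_mul, Real.norm_of_nonneg (by positivity), Real.norm_of_nonneg (by positivity),
    one_div, inv_pow, ← Real.rpow_natCast, ← Real.rpow_neg hn0.le, ← Real.rpow_add hn0]
  refine Real.rpow_le_rpow_of_exponent_le hn' ?_
  have : (m : ℝ) ≤ 4 := by exact_mod_cast hm
  push_cast
  linarith

theorem decays_pow_mul {α : ℝ} (h0 : 0 < α) (k : ℕ) :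
    Decays α fun n : ℕ => (n : ℝ) ^ (-α) * (1 / (n : ℝ)) ^ k := by
  refine Decays.of_isBigO h0 (IsBigO.of_bound 1 ?_)
  filter_upwards [eventually_ge_atTop 1] with n hn
  have hn' : (1 : ℝ) ≤ n := by exact_mod_cast hn
  rw [one_mul, norm_mul]
  refine mul_le_of_le_one_right (norm_nonneg _) ?_
  rw [Real.norm_of_nonneg (by positivity)]
  refine pow_le_one₀ (by positivity) ?_
  rw [div_le_one (by linarith)]
  exact hn'

/-- The quadratic coefficient of `gbExpansion`. -/
def gbExp₂ (β : ℝ) : ℝ := β * (β ^ 2 - 1) * (3 * β + 2) / 24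

/-- The cubic coefficient of `gbExpansion`. -/
def gbExp₃ (β : ℝ) : ℝ := β ^ 2 * (β + 1) ^ 2 * (β - 1) * (β - 2) / 48

theorem rpow_nat_sub {α : ℝ} (n : ℕ) (hn : n ≠ 0) (m : ℕ) :
    (n : ℝ) ^ ((m : ℝ) - α) = (n : ℝ) ^ m * (n : ℝ) ^ (-α) := by
  rw [sub_eq_add_neg, Real.rpow_add (by positivity), Real.rpow_natCast]

theorem Decays.congr_of_ne {α : ℝ} {f g : ℕ → ℝ} (hf : Decays α f) (h : ∀ n, n ≠ 0 → f n = g n) :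
    Decays α g := by
  obtain ⟨C, hC⟩ := hf
  refine ⟨max C |g 0|, fun n => ?_⟩
  have hpos : 0 < ((n : ℝ) + 1) ^ (-α) := by positivity
  rcases eq_or_ne n 0 with rfl | hn
  · simp
  · rw [← h n hn]
    exact (hC n).trans (mul_le_mul_of_nonneg_right (le_max_left _ _) hpos.le)

/-- In the expansion of `gb (m - α)` the powers n^{-α} and below are moved into the error. Here and
in the next three lemmas only the powers from n^{m-α} down to n^{1-α} are kept. -/
theorem decays_gb_one {α : ℝ} (h0 : 0 < α) (h1 : α < 1) :
    Decays α fun n => Real.Gamma (2 - α) * gb (1 - α) n - (n : ℝ) ^ (-α) * n := by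
  have h := decays_gb_sub_main h0 h1 (m := 1) (by norm_num)
  have p0 := (decays_pow_mul h0 0).const_mul ((1 - α) * (1 - α + 1) / 2)
  have p1 := (decays_pow_mul h0 1).const_mul (gbExp₂ (1 - α))
  have p2 := (decays_pow_mul h0 2).const_mul (gbExp₃ (1 - α))
  refine (((h.add p0).add p1).add p2).congr_of_ne fun n hn => ?_
  have hn0 : (n : ℝ) ≠ 0 := by exact_mod_cast hn
  rw [rpow_nat_sub n hn, gbExpansion, gbExp₂, gbExp₃]
  push_cast
  rw [show (1 : ℝ) - α + 1 = 2 - α by ring]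
  field_simp
  ring

theorem decays_gb_two {α : ℝ} (h0 : 0 < α) (h1 : α < 1) :
    Decays α fun n => Real.Gamma (3 - α) * gb (2 - α) n -
      (n : ℝ) ^ (-α) * ((n : ℝ) ^ 2 + (2 - α) * (3 - α) / 2 * n) := by
  have h := decays_gb_sub_main h0 h1 (m := 2) (by norm_num)
  have p1 := (decays_pow_mul h0 0).const_mul (gbExp₂ (2 - α))
  have p2 := (decays_pow_mul h0 1).const_mul (gbExp₃ (2 - α))
  refine ((h.add p1).add p2).congr_of_ne fun n hn => ?_
  have hn0 : (n : ℝ) ≠ 0 := by exact_mod_cast hn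
  rw [rpow_nat_sub n hn, gbExpansion, gbExp₂, gbExp₃]
  push_cast
  rw [show (2 : ℝ) - α + 1 = 3 - α by ring]
  field_simp
  ring

theorem decays_gb_three {α : ℝ} (h0 : 0 < α) (h1 : α < 1) :
    Decays α fun n => Real.Gamma (4 - α) * gb (3 - α) n -
      (n : ℝ) ^ (-α) * ((n : ℝ) ^ 3 + (3 - α) * (4 - α) / 2 * (n : ℝ) ^ 2 + gbExp₂ (3 - α) * n) := by
  have h := decays_gb_sub_main h0 h1 (m := 3) (by norm_num)
  have p2 := (decays_pow_mul h0 0).const_mul (gbExp₃ (3 - α))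
  refine (h.add p2).congr_of_ne fun n hn => ?_
  have hn0 : (n : ℝ) ≠ 0 := by exact_mod_cast hn
  rw [rpow_nat_sub n hn, gbExpansion, gbExp₂, gbExp₃]
  push_cast
  rw [show (3 : ℝ) - α + 1 = 4 - α by ring]
  field_simp
  ring

theorem decays_gb_four {α : ℝ} (h0 : 0 < α) (h1 : α < 1) :
    Decays α fun n => Real.Gamma (5 - α) * gb (4 - α) n -
      (n : ℝ) ^ (-α) * ((n : ℝ) ^ 4 + (4 - α) * (5 - α) / 2 * (n : ℝ) ^ 3 +
        gbExp₂ (4 - α) * (n : ℝ) ^ 2 + gbExp₃ (4 - α) * n) := by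
  have h := decays_gb_sub_main h0 h1 (m := 4) (by norm_num)
  refine h.congr_of_ne fun n hn => ?_
  have hn0 : (n : ℝ) ≠ 0 := by exact_mod_cast hn
  rw [rpow_nat_sub n hn, gbExpansion, gbExp₂, gbExp₃]
  push_cast
  rw [show (4 : ℝ) - α + 1 = 5 - α by ring]
  field_simp

theorem gamma_relations {α : ℝ} (h1 : α < 1) :
    Real.Gamma (3 - α) = (2 - α) * Real.Gamma (2 - α) ∧
    Real.Gamma (4 - α) = (3 - α) * ((2 - α) * Real.Gamma (2 - α)) ∧
    Real.Gamma (5 - α) = (4 - α) * ((3 - α) * ((2 - α) * Real.Gamma (2 - α))) := by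
  have e3 : Real.Gamma (3 - α) = (2 - α) * Real.Gamma (2 - α) := by
    rw [← Real.Gamma_add_one (by linarith)]; ring_nf
  have e4 : Real.Gamma (4 - α) = (3 - α) * Real.Gamma (3 - α) := by
    rw [← Real.Gamma_add_one (by linarith)]; ring_nf
  have e5 : Real.Gamma (5 - α) = (4 - α) * Real.Gamma (4 - α) := by
    rw [← Real.Gamma_add_one (by linarith)]; ring_nf
  exact ⟨e3, by rw [e4, e3], by rw [e5, e4, e3]⟩

/-- The convolution of the weights with `n ^ j / j!`. -/
def weightMonomial (α : ℝ) (j n : ℕ) : ℝ :=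
  ∑ l ∈ range (n + 1), weight α l * (((n : ℝ) - l) ^ j / j.factorial)

theorem weightMonomial_eq (α : ℝ) (j n : ℕ) :
    weightMonomial α j n = PowerSeries.coeff n (PowerSeries.mk (weight α) *
      PowerSeries.mk fun n : ℕ => (n : ℝ) ^ j / j.factorial) := by
  rw [PowerSeries.coeff_mul]
  simp only [PowerSeries.coeff_mk]
  rw [Finset.Nat.sum_antidiagonal_eq_sum_range_succ
    (fun i k => weight α i * ((k : ℝ) ^ j / j.factorial)), weightMonomial]
  refine sum_congr rfl fun l hl => ?_
  rw [Nat.cast_sub (by have := mem_range.1 hl; omega)]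

theorem gb_nat (n : ℕ) : gb 0 n = 1 ∧ gb 1 n = n + 1 ∧ gb 2 n = (n + 1) * (n + 2) / 2 ∧
    gb 3 n = (n + 1) * (n + 2) * (n + 3) / 6 ∧
    gb 4 n = (n + 1) * (n + 2) * (n + 3) * (n + 4) / 24 := by
  induction n with
  | zero => norm_num
  | succ n ih =>
    obtain ⟨i0, i1, i2, i3, i4⟩ := ih
    have : (n : ℝ) + 1 ≠ 0 := by positivity
    refine ⟨?_, ?_, ?_, ?_, ?_⟩ <;>
    · rw [gb_succ]
      first | rw [i0] | rw [i1] | rw [i2] | rw [i3] | rw [i4]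
      push_cast
      field_simp
      try ring

/-- The sequences `gb 0`, …, `gb 4` form a basis of the polynomials in n of degree at most 4, and
the vectors passed to `key` are the coordinates of n^j/j! in it. -/
theorem weightMonomial_combination (α : ℝ) (n : ℕ) :
    weightMonomial α 0 n = weightGb α 0 n ∧
    weightMonomial α 1 n = weightGb α 1 n - weightGb α 0 n ∧
    weightMonomial α 2 n = weightGb α 2 n - 3 / 2 * weightGb α 1 n + 1 / 2 * weightGb α 0 n ∧
    weightMonomial α 3 n = weightGb α 3 n - 2 * weightGb α 2 n + 7 / 6 * weightGb α 1 n
      - 1 / 6 * weightGb α 0 n ∧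
    weightMonomial α 4 n = weightGb α 4 n - 5 / 2 * weightGb α 3 n + 25 / 12 * weightGb α 2 n
      - 5 / 8 * weightGb α 1 n + 1 / 24 * weightGb α 0 n := by
  have key : ∀ (j : ℕ) (c : Fin 5 → ℝ), (∀ n : ℕ, (n : ℝ) ^ j / j.factorial =
      c 0 * gb 0 n + c 1 * gb 1 n + c 2 * gb 2 n + c 3 * gb 3 n + c 4 * gb 4 n) →
      weightMonomial α j n = c 0 * weightGb α 0 n + c 1 * weightGb α 1 n + c 2 * weightGb α 2 n +
        c 3 * weightGb α 3 n + c 4 * weightGb α 4 n := by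
    intro j c h
    have e : (PowerSeries.mk fun n : ℕ => (n : ℝ) ^ j / j.factorial) =
        PowerSeries.C (c 0) * PowerSeries.mk (gb 0) + PowerSeries.C (c 1) * PowerSeries.mk (gb 1) +
        PowerSeries.C (c 2) * PowerSeries.mk (gb 2) + PowerSeries.C (c 3) * PowerSeries.mk (gb 3) +
        PowerSeries.C (c 4) * PowerSeries.mk (gb 4) := by
      ext n
      simpa using h n
    rw [weightMonomial_eq, e]
    simp only [weightGb, ← PowerSeries.coeff_C_mul, ← map_add]
    push_cast
    congr 1
    ring
  refine ⟨?_, ?_, ?_, ?_, ?_⟩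
  · rw [key 0 ![1, 0, 0, 0, 0] fun n => by simp [gb_nat n]]
    simp
  · rw [key 1 ![-1, 1, 0, 0, 0] fun n => by simp [gb_nat n]]
    simp; ring
  · rw [key 2 ![1 / 2, -3 / 2, 1, 0, 0] fun n => by simp [gb_nat n]; ring]
    simp; ring
  · rw [key 3 ![-1 / 6, 7 / 6, -2, 1, 0] fun n => by simp [gb_nat n, Nat.factorial]; ring]
    simp; ring
  · rw [key 4 ![1 / 24, -5 / 8, 25 / 12, -5 / 2, 1] fun n => by
      simp [gb_nat n, Nat.factorial]; ring]
    simp; ring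

/-- The convolution of the weights with `n ^ j / j!` is `n ^ (j - α) / Γ(j + 1 - α)` up to order
`n ^ (-α)`. -/
def MonomialConsistent (α : ℝ) (j : ℕ) : Prop :=
  Decays α fun n => weightMonomial α j n - (n : ℝ) ^ (-α) * ((n : ℝ) ^ j / Real.Gamma (j + 1 - α))

theorem decays_weightGb_zero {α : ℝ} (h0 : 0 < α) (h1 : α < 1) :
    Decays α (weightGb α 0) := by
  have d1 := (decays_gb_sub h0 h1 1).const_mul (α / 2)
  have d2 := (decays_gb_sub h0 h1 2).const_mul (quotTaylor₂ α)
  have d3 := (decays_gb_sub h0 h1 3).const_mul (quotTaylor₃ α)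
  refine (((((decays_weightGb h0 h1 (i := 0) (by norm_num)).add (decays_gb_neg h0 h1)).add d1).add
    d2).add d3).congr fun n => ?_
  push_cast
  simp only [zero_sub]
  ring

theorem decays_weightGb_one {α : ℝ} (h0 : 0 < α) (h1 : α < 1) :
    Decays α fun n => weightGb α 1 n - gb (1 - α) n := by
  have d1 := (decays_gb_sub h0 h1 0).const_mul (α / 2)
  have d2 := (decays_gb_sub h0 h1 1).const_mul (quotTaylor₂ α)
  have d3 := (decays_gb_sub h0 h1 2).const_mul (quotTaylor₃ α)
  refine ((((decays_weightGb h0 h1 (i := 1) (by norm_num)).add d1).add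
    d2).add d3).congr fun n => ?_
  push_cast
  rw [show (1 : ℝ) - α - 1 = -α - 0 by ring, show (1 : ℝ) - α - 2 = -α - 1 by ring,
    show (1 : ℝ) - α - 3 = -α - 2 by ring]
  ring

theorem decays_weightGb_two {α : ℝ} (h0 : 0 < α) (h1 : α < 1) :
    Decays α fun n => weightGb α 2 n - (gb (2 - α) n + α / 2 * gb (1 - α) n) := by
  have d2 := (decays_gb_sub h0 h1 0).const_mul (quotTaylor₂ α)
  have d3 := (decays_gb_sub h0 h1 1).const_mul (quotTaylor₃ α)
  refine (((decays_weightGb h0 h1 (i := 2) (by norm_num)).add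
    d2).add d3).congr fun n => ?_
  push_cast
  rw [show (2 : ℝ) - α - 1 = 1 - α by ring, show (2 : ℝ) - α - 2 = -α - 0 by ring,
    show (2 : ℝ) - α - 3 = -α - 1 by ring]
  ring

theorem decays_weightGb_three {α : ℝ} (h0 : 0 < α) (h1 : α < 1) :
    Decays α fun n => weightGb α 3 n - (gb (3 - α) n + α / 2 * gb (2 - α) n +
      quotTaylor₂ α * gb (1 - α) n) := by
  have d3 := (decays_gb_sub h0 h1 0).const_mul (quotTaylor₃ α)
  refine ((decays_weightGb h0 h1 (i := 3) (by norm_num)).add d3).congr fun n => ?_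
  push_cast
  rw [show (3 : ℝ) - α - 1 = 2 - α by ring, show (3 : ℝ) - α - 2 = 1 - α by ring,
    show (3 : ℝ) - α - 3 = -α - 0 by ring]
  ring

theorem decays_weightGb_four {α : ℝ} (h0 : 0 < α) (h1 : α < 1) :
    Decays α fun n => weightGb α 4 n - (gb (4 - α) n + α / 2 * gb (3 - α) n +
      quotTaylor₂ α * gb (2 - α) n + quotTaylor₃ α * gb (1 - α) n) := by
  refine (decays_weightGb h0 h1 (i := 4) (by norm_num)).congr fun n => ?_
  push_cast
  rw [show (4 : ℝ) - α - 1 = 3 - α by ring, show (4 : ℝ) - α - 2 = 2 - α by ring,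
    show (4 : ℝ) - α - 3 = 1 - α by ring]

/-- Each combination is expanded in n^{j-α}, …, n^{1-α}. All coefficients below the leading one
cancel, which is the algebraic form of Q(e^{-x})^α = x^α(1 + O(x⁴)). -/
theorem monomialConsistent {α : ℝ} (h0 : 0 < α) (h1 : α < 1) {j : ℕ} (hj : j ≤ 4) :
    MonomialConsistent α j := by
  have hΓ : 0 < Real.Gamma (2 - α) := Real.Gamma_pos_of_pos (by linarith)
  obtain ⟨g3, g4, g5⟩ := gamma_relations h1
  have n2 : 2 - α ≠ 0 := by linarith
  have n3 : 3 - α ≠ 0 := by linarith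
  have n4 : 4 - α ≠ 0 := by linarith
  have w0 := decays_weightGb_zero h0 h1
  have w1 := decays_weightGb_one h0 h1
  have w2 := decays_weightGb_two h0 h1
  have w3 := decays_weightGb_three h0 h1
  have w4 := decays_weightGb_four h0 h1
  have c1 := (decays_gb_one h0 h1)
  have c2 := (decays_gb_two h0 h1)
  have c3 := (decays_gb_three h0 h1)
  have c4 := (decays_gb_four h0 h1)
  rw [g3] at c2
  rw [g4] at c3
  rw [g5] at c4
  unfold MonomialConsistent
  set G := Real.Gamma (2 - α) with hG
  have hG0 := hΓ.ne'
  interval_cases j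
  · have p := (decays_pow_mul h0 0).const_mul (-1 / Real.Gamma (0 + 1 - α))
    refine (w0.add p).congr fun n => ?_
    rw [(weightMonomial_combination α n).1]
    push_cast
    ring
  · refine ((w1.add (w0.const_mul (-1))).add (c1.const_mul (1 / G))).congr fun n => ?_
    rw [(weightMonomial_combination α n).2.1]
    push_cast
    rw [show (1 : ℝ) + 1 - α = 2 - α by ring, ← hG]
    field_simp
    ring
  · refine ((((w2.add (w1.const_mul (-3 / 2))).add (w0.const_mul (1 / 2))).add
      (c2.const_mul (1 / ((2 - α) * G)))).add
      (c1.const_mul ((α / 2 - 3 / 2) / G))).congr fun n => ?_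
    rw [(weightMonomial_combination α n).2.2.1]
    push_cast
    rw [show (2 : ℝ) + 1 - α = 3 - α by ring, g3]
    field_simp
    ring
  · refine ((((((w3.add (w2.const_mul (-2))).add (w1.const_mul (7 / 6))).add
      (w0.const_mul (-1 / 6))).add
      (c3.const_mul (1 / ((3 - α) * ((2 - α) * G))))).add
      (c2.const_mul ((α / 2 - 2) / ((2 - α) * G)))).add
      (c1.const_mul ((quotTaylor₂ α - 2 * (α / 2) + 7 / 6) / G))).congr fun n => ?_
    rw [(weightMonomial_combination α n).2.2.2.1]
    push_cast
    rw [show (3 : ℝ) + 1 - α = 4 - α by ring, g4]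
    simp only [quotTaylor₂, gbExp₂]
    field_simp
    ring
  · refine ((((((((w4.add (w3.const_mul (-5 / 2))).add (w2.const_mul (25 / 12))).add
      (w1.const_mul (-5 / 8))).add (w0.const_mul (1 / 24))).add
      (c4.const_mul (1 / ((4 - α) * ((3 - α) * ((2 - α) * G)))))).add
      (c3.const_mul ((α / 2 - 5 / 2) / ((3 - α) * ((2 - α) * G))))).add
      (c2.const_mul ((quotTaylor₂ α - 5 / 2 * (α / 2) + 25 / 12) / ((2 - α) * G)))).add
      (c1.const_mul ((quotTaylor₃ α - 5 / 2 * quotTaylor₂ α + 25 / 12 * (α / 2) - 5 / 8) / G))).congr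
      fun n => ?_
    rw [(weightMonomial_combination α n).2.2.2.2]
    push_cast
    rw [show (4 : ℝ) + 1 - α = 5 - α by ring, g5]
    simp only [quotTaylor₂, quotTaylor₃, gbExp₂, gbExp₃]
    field_simp
    ring

end RieszDiffusion
end

noncomputable section
namespace RieszDiffusion

open Finset Filter Topology Asymptotics

/-! The Peano kernel of the weights. -/

/-- The kernel `∑ ϖ_l (s - l)₊⁴ / 4! - s ^ (4 - α) / Γ(5 - α)` of the quadrature error. -/
def peanoKernel (α : ℝ) (n : ℕ) (s : ℝ) : ℝ :=
  ∑ l ∈ range (n + 1), weight α l * (max (s - l) 0 ^ 4 / 24) - s ^ (4 - α) / Real.Gamma (5 - α)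

/-- As θ < 1, only the indices l ≤ m contribute; for these, (m - l + θ)⁴/4! is expanded by the
binomial theorem. -/
theorem peanoKernel_sum_eq {α : ℝ} {m n : ℕ} (hmn : m ≤ n) {θ : ℝ} (h0 : 0 ≤ θ) (h1 : θ < 1) :
    ∑ l ∈ range (n + 1), weight α l * (max ((m : ℝ) + θ - l) 0 ^ 4 / 24) =
      weightMonomial α 4 m + θ * weightMonomial α 3 m + θ ^ 2 / 2 * weightMonomial α 2 m +
        θ ^ 3 / 6 * weightMonomial α 1 m + θ ^ 4 / 24 * weightMonomial α 0 m := by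
  have e1 : ∑ l ∈ range (m + 1), weight α l * (max ((m : ℝ) + θ - l) 0 ^ 4 / 24) =
      ∑ l ∈ range (n + 1), weight α l * (max ((m : ℝ) + θ - l) 0 ^ 4 / 24) := by
    refine sum_subset (range_mono (by omega)) fun l _ hl => ?_
    have hl' : (m : ℝ) + 1 ≤ l := by
      have : m + 1 ≤ l := by simpa using hl
      exact_mod_cast this
    rw [max_eq_right (by linarith)]
    simp
  rw [← e1]
  simp only [weightMonomial, mul_sum, ← sum_add_distrib]
  refine sum_congr rfl fun l hl => ?_
  have hl' : (l : ℝ) ≤ m := by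
    have : l ≤ m := by have := mem_range.1 hl; omega
    exact_mod_cast this
  rw [max_eq_left (by linarith)]
  simp [Nat.factorial]
  ring

/-- Taylor expansion of a power at `m`, uniformly on `[m, m + 1]`. -/
theorem exists_rpow_add_taylor (α : ℝ) : ∃ (m0 : ℕ) (C : ℝ), 1 ≤ m0 ∧ ∀ m : ℕ, m0 ≤ m →
    ∀ θ ∈ Set.Icc (0 : ℝ) 1, |((m : ℝ) + θ) ^ (4 - α) - (m : ℝ) ^ (-α) * ((m : ℝ) ^ 4 +
      (4 - α) * θ * (m : ℝ) ^ 3 + (4 - α) * (3 - α) / 2 * θ ^ 2 * (m : ℝ) ^ 2 +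
      (4 - α) * (3 - α) * (2 - α) / 6 * θ ^ 3 * m)| ≤ C * (m : ℝ) ^ (-α) := by
  have h := (one_sub_rpow_taylor (4 - α) 4)
  obtain ⟨C, hC0, hC⟩ := h.exists_pos
  rw [IsBigOWith, Metric.eventually_nhds_iff] at hC
  obtain ⟨ε, hε, hC⟩ := hC
  obtain ⟨k, hk⟩ := exists_nat_gt (1 / ε)
  refine ⟨k + 1, C, by omega, fun m hm θ hθ => ?_⟩
  have hm' : (k : ℝ) + 1 ≤ m := by exact_mod_cast hm
  have hk0 : (0 : ℝ) ≤ k := k.cast_nonneg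
  have hm0 : (0 : ℝ) < m := by linarith
  have hθm : θ / m < ε := by
    rw [div_lt_iff₀ hm0]
    rw [div_lt_iff₀ hε] at hk
    nlinarith [hθ.2]
  have hθm0 : 0 ≤ θ / m := div_nonneg hθ.1 hm0.le
  have h1 := hC (y := -(θ / m)) (by
    rw [Real.dist_eq, sub_zero, abs_neg, abs_of_nonneg hθm0]; exact hθm)
  rw [Real.norm_eq_abs, Real.norm_of_nonneg (by positivity), sub_neg_eq_add] at h1
  simp only [sum_range_succ, sum_range_zero, gb_succ, gb_zero] at h1
  have e : ((m : ℝ) + θ) ^ (4 - α) = (m : ℝ) ^ 4 * (m : ℝ) ^ (-α) * (1 + θ / m) ^ (4 - α) := by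
    have hm1 : m ≠ 0 := by omega
    have := rpow_nat_sub (α := α) m hm1 4
    push_cast at this
    rw [← this, ← Real.mul_rpow hm0.le (by positivity)]
    congr 1
    field_simp
  rw [e]
  have hfac : 0 ≤ (m : ℝ) ^ 4 * (m : ℝ) ^ (-α) := by positivity
  have h2 := mul_le_mul_of_nonneg_left h1 hfac
  nth_rw 1 [← abs_of_nonneg hfac] at h2
  rw [← abs_mul] at h2
  have e2 : (m : ℝ) ^ 4 * (m : ℝ) ^ (-α) * (C * (-(θ / m)) ^ 4) = C * (m : ℝ) ^ (-α) * θ ^ 4 := by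
    field_simp
  rw [e2] at h2
  refine le_trans (le_of_eq ?_) (h2.trans ?_)
  · congr 1
    push_cast
    field_simp
    ring
  · refine mul_le_of_le_one_right (by positivity) ?_
    exact pow_le_one₀ hθ.1 hθ.2

theorem Decays.le_of_ne {α : ℝ} (h0 : 0 < α) {f : ℕ → ℝ} (hf : Decays α f) :
    ∃ C : ℝ, 0 ≤ C ∧ ∀ n : ℕ, n ≠ 0 → |f n| ≤ C * (n : ℝ) ^ (-α) := by
  obtain ⟨C, hC⟩ := hf
  have hC0 : 0 ≤ C := by
    have := (abs_nonneg _).trans (hC 0)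
    simpa using this
  refine ⟨C, hC0, fun n hn => (hC n).trans (mul_le_mul_of_nonneg_left ?_ hC0)⟩
  have : (0 : ℝ) < n := by positivity
  exact Real.rpow_le_rpow_of_nonpos this (by linarith) (by linarith)

/-- For s = m + θ with m large, both terms of the kernel are expanded in θ and compared coefficient
by coefficient using `monomialConsistent`. For bounded s the kernel is bounded, and s^{-α} is
bounded below. -/
theorem exists_peanoKernel_bound {α : ℝ} (h0 : 0 < α) (h1 : α < 1) : ∃ C : ℝ, 0 ≤ C ∧
    ∀ (n : ℕ) (s : ℝ), 0 < s → s ≤ n → |peanoKernel α n s| ≤ C * s ^ (-α) := by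
  obtain ⟨C0, hC0, k0⟩ := (monomialConsistent h0 h1 (j := 0) (by norm_num)).le_of_ne h0
  obtain ⟨C1, hC1, k1⟩ := (monomialConsistent h0 h1 (j := 1) (by norm_num)).le_of_ne h0
  obtain ⟨C2, hC2, k2⟩ := (monomialConsistent h0 h1 (j := 2) (by norm_num)).le_of_ne h0
  obtain ⟨C3, hC3, k3⟩ := (monomialConsistent h0 h1 (j := 3) (by norm_num)).le_of_ne h0
  obtain ⟨C4, hC4, k4⟩ := (monomialConsistent h0 h1 (j := 4) (by norm_num)).le_of_ne h0
  obtain ⟨m0, CT, hm0, kT⟩ := exists_rpow_add_taylor α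
  obtain ⟨g3, g4, g5⟩ := gamma_relations h1
  have hG : 0 < Real.Gamma (2 - α) := Real.Gamma_pos_of_pos (by linarith)
  have hG1 : 0 < Real.Gamma (1 - α) := Real.Gamma_pos_of_pos (by linarith)
  have hG5 : 0 < Real.Gamma (5 - α) := Real.Gamma_pos_of_pos (by linarith)
  have n2 : 2 - α ≠ 0 := by linarith
  have n3 : 3 - α ≠ 0 := by linarith
  have n4 : 4 - α ≠ 0 := by linarith
  set D := C4 + C3 + C2 + C1 + C0 + 1 / Real.Gamma (1 - α) + |CT| / Real.Gamma (5 - α) with hD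
  have hD0 : 0 ≤ D := by positivity
  set E := (∑' l, |weight α l|) * (m0 : ℝ) ^ 4 + (m0 : ℝ) ^ (4 - α) / Real.Gamma (5 - α) with hE
  have hE0 : 0 ≤ E := by
    have : 0 ≤ ∑' l, |weight α l| := tsum_nonneg fun _ => abs_nonneg _
    positivity
  have hm0' : (0 : ℝ) < m0 := by exact_mod_cast hm0
  refine ⟨D * 2 + E * (m0 : ℝ) ^ α, by positivity, fun n s hs hsn => ?_⟩
  have hspos : 0 < s ^ (-α) := Real.rpow_pos_of_pos hs _
  by_cases hsm : s < m0
  · have hb : |peanoKernel α n s| ≤ E := by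
      rw [peanoKernel]
      refine (abs_sub _ _).trans (add_le_add ?_ ?_)
      · refine (abs_sum_le_sum_abs _ _).trans ?_
        have hw := summable_abs_weight h0 h1
        refine le_trans ?_ (mul_le_mul_of_nonneg_right
          (hw.sum_le_tsum (range (n + 1)) fun _ _ => abs_nonneg _) (by positivity))
        rw [sum_mul]
        refine sum_le_sum fun l _ => ?_
        rw [abs_mul]
        refine mul_le_mul_of_nonneg_left ?_ (abs_nonneg _)
        rw [abs_of_nonneg (by positivity)]
        have hmx : max (s - l) 0 ≤ m0 := max_le (by
          have : (0 : ℝ) ≤ l := l.cast_nonneg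
          linarith) hm0'.le
        have := pow_le_pow_left₀ (le_max_right (s - (l : ℝ)) 0) hmx 4
        have h4 : 0 ≤ max (s - (l : ℝ)) 0 ^ 4 := by positivity
        linarith
      · rw [abs_of_nonneg (by positivity)]
        gcongr
        linarith
    have hge : 1 ≤ (m0 : ℝ) ^ α * s ^ (-α) := by
      rw [Real.rpow_neg hs.le, ← div_eq_mul_inv, one_le_div (by positivity)]
      exact Real.rpow_le_rpow hs.le hsm.le h0.le
    calc |peanoKernel α n s| ≤ E := hb
      _ ≤ E * ((m0 : ℝ) ^ α * s ^ (-α)) := le_mul_of_one_le_right hE0 hge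
      _ ≤ _ := by
        have : 0 ≤ D * 2 * s ^ (-α) := by positivity
        rw [add_mul]
        linarith [mul_assoc E ((m0 : ℝ) ^ α) (s ^ (-α))]
  · push Not at hsm
    set m := ⌊s⌋₊ with hm
    set θ := s - m with hθ
    have hms : (m : ℝ) ≤ s := Nat.floor_le hs.le
    have hsm1 : s < m + 1 := Nat.lt_floor_add_one s
    have hθ0 : 0 ≤ θ := by linarith
    have hθ1 : θ < 1 := by linarith
    have hmm0 : m0 ≤ m := Nat.le_floor hsm
    have hmn : m ≤ n := by
      have : (m : ℝ) ≤ n := hms.trans hsn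
      exact_mod_cast this
    have hmne : m ≠ 0 := by omega
    have hmpos : (0 : ℝ) < m := by positivity
    have hs' : s = m + θ := by rw [hθ]; ring
    have hX : 0 < (m : ℝ) ^ (-α) := by positivity
    have a0 := k0 m hmne
    have a1 := k1 m hmne
    have a2 := k2 m hmne
    have a3 := k3 m hmne
    have a4 := k4 m hmne
    have aT := kT m hmm0 θ ⟨hθ0, hθ1.le⟩
    have hmain : |peanoKernel α n s| ≤ D * (m : ℝ) ^ (-α) := by
      rw [peanoKernel, hs', peanoKernel_sum_eq hmn hθ0 hθ1]
      set X := (m : ℝ) ^ (-α)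
      push_cast at a0 a1 a2 a3 a4
      rw [show (0 : ℝ) + 1 - α = 1 - α by ring] at a0
      rw [show (1 : ℝ) + 1 - α = 2 - α by ring] at a1
      rw [show (2 : ℝ) + 1 - α = 3 - α by ring] at a2
      rw [show (3 : ℝ) + 1 - α = 4 - α by ring] at a3
      rw [show (4 : ℝ) + 1 - α = 5 - α by ring] at a4
      set u0 := weightMonomial α 0 m - X * ((m : ℝ) ^ 0 / Real.Gamma (1 - α)) with hu0
      set u1 := weightMonomial α 1 m - X * ((m : ℝ) ^ 1 / Real.Gamma (2 - α)) with hu1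
      set u2 := weightMonomial α 2 m - X * ((m : ℝ) ^ 2 / Real.Gamma (3 - α)) with hu2
      set u3 := weightMonomial α 3 m - X * ((m : ℝ) ^ 3 / Real.Gamma (4 - α)) with hu3
      set u4 := weightMonomial α 4 m - X * ((m : ℝ) ^ 4 / Real.Gamma (5 - α)) with hu4
      set v := ((m : ℝ) + θ) ^ (4 - α) - X * ((m : ℝ) ^ 4 +
        (4 - α) * θ * (m : ℝ) ^ 3 + (4 - α) * (3 - α) / 2 * θ ^ 2 * (m : ℝ) ^ 2 +
        (4 - α) * (3 - α) * (2 - α) / 6 * θ ^ 3 * m) with hv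
      -- The Taylor polynomial of the power stops at θ³, so the main part m^{-α}/Γ(1-α) of the
      -- zeroth moment has no counterpart. It is itself of the admissible order and is counted as
      -- error.
      have hdecomp : weightMonomial α 4 m + θ * weightMonomial α 3 m +
          θ ^ 2 / 2 * weightMonomial α 2 m + θ ^ 3 / 6 * weightMonomial α 1 m +
          θ ^ 4 / 24 * weightMonomial α 0 m - ((m : ℝ) + θ) ^ (4 - α) / Real.Gamma (5 - α) =
          u4 + θ * u3 + θ ^ 2 / 2 * u2 + θ ^ 3 / 6 * u1 + θ ^ 4 / 24 * u0 +
            θ ^ 4 / 24 * (X / Real.Gamma (1 - α)) - v / Real.Gamma (5 - α) := by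
        simp only [hu0, hu1, hu2, hu3, hu4, hv]
        rw [g5, g4, g3]
        field_simp
        ring
      rw [hdecomp]
      have p2 : θ ^ 2 ≤ 1 := pow_le_one₀ hθ0 hθ1.le
      have p3 : θ ^ 3 ≤ 1 := pow_le_one₀ hθ0 hθ1.le
      have p4 : θ ^ 4 ≤ 1 := pow_le_one₀ hθ0 hθ1.le
      have b : ∀ {t u c : ℝ}, 0 ≤ t → t ≤ 1 → |u| ≤ c → |t * u| ≤ c := by
        intro t u c h0 h1 hu
        rw [abs_mul, abs_of_nonneg h0]
        exact (mul_le_of_le_one_left (abs_nonneg _) h1).trans hu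
      have b3 := b hθ0 hθ1.le a3
      have b2 := b (t := θ ^ 2 / 2) (by positivity) (by linarith) a2
      have b1 := b (t := θ ^ 3 / 6) (by positivity) (by linarith) a1
      have b0 := b (t := θ ^ 4 / 24) (by positivity) (by linarith) a0
      have bX := b (t := θ ^ 4 / 24) (u := X / Real.Gamma (1 - α)) (by positivity) (by linarith)
        (abs_of_nonneg (by positivity)).le
      have bv : |v / Real.Gamma (5 - α)| ≤ |CT| * X / Real.Gamma (5 - α) := by
        rw [abs_div, abs_of_pos hG5]
        gcongr
        exact aT.trans (mul_le_mul_of_nonneg_right (le_abs_self _) hX.le)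
      have hDX : D * X = C4 * X + C3 * X + C2 * X + C1 * X + C0 * X + X / Real.Gamma (1 - α) +
          |CT| * X / Real.Gamma (5 - α) := by
        rw [hD]; ring
      rw [hDX]
      have := abs_add_le (u4 + θ * u3 + θ ^ 2 / 2 * u2 + θ ^ 3 / 6 * u1 + θ ^ 4 / 24 * u0)
        (θ ^ 4 / 24 * (X / Real.Gamma (1 - α)))
      have := abs_add_le (u4 + θ * u3 + θ ^ 2 / 2 * u2 + θ ^ 3 / 6 * u1) (θ ^ 4 / 24 * u0)
      have := abs_add_le (u4 + θ * u3 + θ ^ 2 / 2 * u2) (θ ^ 3 / 6 * u1)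
      have := abs_add_le (u4 + θ * u3) (θ ^ 2 / 2 * u2)
      have := abs_add_le u4 (θ * u3)
      have := abs_sub (u4 + θ * u3 + θ ^ 2 / 2 * u2 + θ ^ 3 / 6 * u1 + θ ^ 4 / 24 * u0 +
        θ ^ 4 / 24 * (X / Real.Gamma (1 - α))) (v / Real.Gamma (5 - α))
      linarith
    have hXs : (m : ℝ) ^ (-α) ≤ 2 * s ^ (-α) := by
      have h2 : s ≤ 2 * m := by
        have : (1 : ℝ) ≤ m := by exact_mod_cast (by omega : 1 ≤ m)
        linarith
      have h3 : s ^ α ≤ 2 * (m : ℝ) ^ α := by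
        calc s ^ α ≤ (2 * (m : ℝ)) ^ α := Real.rpow_le_rpow hs.le h2 h0.le
          _ = 2 ^ α * (m : ℝ) ^ α := Real.mul_rpow (by norm_num) hmpos.le
          _ ≤ 2 * (m : ℝ) ^ α := by
            gcongr
            conv_rhs => rw [← Real.rpow_one 2]
            exact Real.rpow_le_rpow_of_exponent_le (by norm_num) h1.le
      rw [Real.rpow_neg hmpos.le, Real.rpow_neg hs.le, ← div_eq_mul_inv, inv_eq_one_div,
        div_le_div_iff₀ (by positivity) (by positivity)]
      linarith
    have hE1 : 0 ≤ E * (m0 : ℝ) ^ α * s ^ (-α) := by positivity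
    calc |peanoKernel α n s| ≤ D * (m : ℝ) ^ (-α) := hmain
      _ ≤ D * (2 * s ^ (-α)) := by gcongr
      _ ≤ _ := by rw [add_mul]; linarith

end RieszDiffusion
end

noncomputable section
namespace RieszDiffusion

open Finset Filter Topology LaurentPolynomial

/-! Functionals on Laurent polynomials with a nonnegative symbol. -/

/-- The linear functional on Laurent polynomials with `T n ↦ w n`. -/
def lfun (w : ℤ → ℝ) : ℝ[T;T⁻¹] →ₗ[ℝ] ℝ :=
  (Finsupp.linearCombination ℝ w) ∘ₗ (AddMonoidAlgebra.coeffLinearEquiv ℝ).toLinearMap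

theorem lfun_C_mul_T (w : ℤ → ℝ) (a : ℝ) (n : ℤ) : lfun w (C a * T n) = a * w n := by
  rw [← single_eq_C_mul_T]
  exact (Finsupp.linearCombination_single ℝ a n).trans (smul_eq_mul _ _)

theorem lfun_C_mul (w : ℤ → ℝ) (a : ℝ) (P : ℝ[T;T⁻¹]) : lfun w (C a * P) = a * lfun w P := by
  rw [← smul_eq_C_mul, map_smul, smul_eq_mul]

theorem lfun_invert {w : ℤ → ℝ} (hw : ∀ n, w (-n) = w n) (P : ℝ[T;T⁻¹]) :
    lfun w (invert P) = lfun w P := by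
  induction P using LaurentPolynomial.induction_on' with
  | add p q hp hq => rw [map_add, map_add, map_add, hp, hq]
  | C_mul_T n a => rw [map_mul, invert_C, invert_T, lfun_C_mul_T, lfun_C_mul_T, hw]

/-- Evaluation of a Laurent polynomial at `e^{iθ}`. -/
def circleEval (θ : ℝ) : ℝ[T;T⁻¹] →+* ℂ :=
  LaurentPolynomial.eval₂ Complex.ofRealHom (Units.mk0 (mode θ 1) (mode_ne_zero θ 1))

theorem mode_zpow (θ : ℝ) (n : ℤ) : mode θ 1 ^ n = mode θ n := by
  rw [mode, mode, ← Complex.exp_int_mul]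
  push_cast
  ring_nf

theorem circleEval_C_mul_T (θ a : ℝ) (n : ℤ) : circleEval θ (C a * T n) = a * mode θ n := by
  rw [circleEval, eval₂_C_mul_T, Units.val_zpow_eq_zpow_val, Units.val_mk0, mode_zpow]
  rfl

theorem mode_conj (θ : ℝ) (n : ℤ) : (starRingEnd ℂ) (mode θ n) = mode θ (-n) := by
  rw [← mode_zpow, map_zpow₀, ← mode_neg_eq_conj, mode_zpow, mode_neg]

theorem circleEval_invert (θ : ℝ) (P : ℝ[T;T⁻¹]) :
    circleEval θ (invert P) = (starRingEnd ℂ) (circleEval θ P) := by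
  induction P using LaurentPolynomial.induction_on' with
  | add p q hp hq => rw [map_add, map_add, map_add, map_add, hp, hq]
  | C_mul_T n a =>
    rw [map_mul invert, invert_C, invert_T, circleEval_C_mul_T, circleEval_C_mul_T, map_mul,
      mode_conj, Complex.conj_ofReal]

theorem mode_re (θ : ℝ) (n : ℤ) : (mode θ n).re = Real.cos (n * θ) := by
  rw [mode, show Complex.I * n * θ = ((n * θ : ℝ) : ℂ) * Complex.I by push_cast; ring,
    Complex.exp_ofReal_mul_I_re]

theorem continuous_circleEval_re (P : ℝ[T;T⁻¹]) : Continuous fun θ => (circleEval θ P).re := by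
  induction P using LaurentPolynomial.induction_on' with
  | add p q hp hq =>
    simp only [map_add, Complex.add_re]
    exact hp.add hq
  | C_mul_T n a =>
    simp only [circleEval_C_mul_T, Complex.re_ofReal_mul, mode_re]
    fun_prop

theorem lfun_eq_integral {w : ℤ → ℝ} {g : ℝ → ℝ} (hg : Continuous g)
    (hw : ∀ n : ℤ, w n = ∫ θ in -Real.pi..Real.pi, g θ * Real.cos (n * θ)) (P : ℝ[T;T⁻¹]) :
    lfun w P = ∫ θ in -Real.pi..Real.pi, g θ * (circleEval θ P).re := by
  induction P using LaurentPolynomial.induction_on' with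
  | add p q hp hq =>
    rw [map_add, hp, hq, ← intervalIntegral.integral_add]
    · simp only [map_add, Complex.add_re, mul_add]
    · exact (hg.mul (continuous_circleEval_re p)).intervalIntegrable _ _
    · exact (hg.mul (continuous_circleEval_re q)).intervalIntegrable _ _
  | C_mul_T n a =>
    simp only [circleEval_C_mul_T, Complex.re_ofReal_mul, mode_re]
    rw [lfun_C_mul_T, hw, ← intervalIntegral.integral_const_mul]
    congr 1
    funext θ
    ring

/-- On the unit circle `invert` is complex conjugation, so the form equals the integral of g |P|².
-/
theorem lfun_mul_invert_nonneg {w : ℤ → ℝ} {g : ℝ → ℝ} (hg : Continuous g) (hg0 : ∀ θ, 0 ≤ g θ)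
    (hw : ∀ n : ℤ, w n = ∫ θ in -Real.pi..Real.pi, g θ * Real.cos (n * θ)) (P : ℝ[T;T⁻¹]) :
    0 ≤ lfun w (P * invert P) := by
  rw [lfun_eq_integral hg hw]
  refine intervalIntegral.integral_nonneg (by linarith [Real.pi_pos]) fun θ _ => ?_
  rw [map_mul, circleEval_invert, Complex.mul_conj, Complex.ofReal_re]
  exact mul_nonneg (hg0 θ) (Complex.normSq_nonneg _)

theorem integral_cos_int_mul (n : ℤ) : ∫ θ in -Real.pi..Real.pi, Real.cos (n * θ) =
    if n = 0 then 2 * Real.pi else 0 := by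
  split_ifs with h
  · simp [h]; ring
  · have hn : (n : ℝ) ≠ 0 := by exact_mod_cast h
    rw [intervalIntegral.integral_comp_mul_left (fun x => Real.cos x) hn, integral_cos, mul_neg,
      Real.sin_neg, Real.sin_int_mul_pi]
    simp

/-- The functional `P ↦ P.coeff 0`. -/
def deltaWeight (n : ℤ) : ℝ := if n = 0 then 1 else 0

theorem lfun_delta_nonneg (P : ℝ[T;T⁻¹]) : 0 ≤ lfun deltaWeight (P * invert P) := by
  refine lfun_mul_invert_nonneg (g := fun _ => 1 / (2 * Real.pi)) continuous_const
    (fun _ => by have := Real.pi_pos; positivity) (fun n => ?_) P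
  rw [intervalIntegral.integral_const_mul, integral_cos_int_mul, deltaWeight]
  have := Real.pi_pos.ne'
  split_ifs <;> field_simp
  simp

/-- The two-sided extension of the weights. -/
def symWeight (α : ℝ) (n : ℤ) : ℝ := weight α n.natAbs * if n = 0 then 2 else 1

theorem symWeight_neg (α : ℝ) (n : ℤ) : symWeight α (-n) = symWeight α n := by
  simp [symWeight]

theorem hasSum_weightSymbol {α : ℝ} (h0 : 0 < α) (h1 : α < 1) (θ : ℝ) :
    HasSum (fun l : ℕ => 2 * weight α l * Real.cos (l * θ)) (weightSymbol α θ) := by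
  have h := (summable_weight_mul h0 h1 (norm_mode θ 1).le).hasSum
  have h2 := (Complex.hasSum_re h).mul_left 2
  have e : ∀ l : ℕ, 2 * ((weight α l : ℂ) * mode θ 1 ^ l).re = 2 * weight α l * Real.cos (l * θ) := by
    intro l
    rw [← mode_natCast, Complex.re_ofReal_mul, mode_re]
    push_cast
    ring
  simp only [e] at h2
  exact h2

theorem continuous_weightSymbol {α : ℝ} (h0 : 0 < α) (h1 : α < 1) :
    Continuous (weightSymbol α) := by
  have e : weightSymbol α = fun θ => ∑' l : ℕ, 2 * weight α l * Real.cos (l * θ) :=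
    funext fun θ => (hasSum_weightSymbol h0 h1 θ).tsum_eq.symm
  rw [e]
  refine continuous_tsum (fun l => by fun_prop) ((summable_abs_weight h0 h1).mul_left 2)
    fun l θ => ?_
  rw [norm_mul, norm_mul, Real.norm_two, Real.norm_eq_abs, Real.norm_eq_abs]
  exact mul_le_of_le_one_right (by positivity) (Real.abs_cos_le_one _)

/-- Absolute summability permits termwise integration, and orthogonality of the cosines leaves l =
|n|. The factor 2 of `symWeight` at 0 appears because for n = 0 both l - n and l + n vanish. -/
theorem symWeight_eq_integral {α : ℝ} (h0 : 0 < α) (h1 : α < 1) (n : ℤ) :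
    symWeight α n = ∫ θ in -Real.pi..Real.pi,
      (weightSymbol α θ / (2 * Real.pi)) * Real.cos (n * θ) := by
  have hpi := Real.pi_pos
  have hs : HasSum (fun l : ℕ => ∫ θ in -Real.pi..Real.pi,
      (2 * weight α l * Real.cos (l * θ)) * (Real.cos (n * θ) / (2 * Real.pi)))
      (∫ θ in -Real.pi..Real.pi, weightSymbol α θ * (Real.cos (n * θ) / (2 * Real.pi))) := by
    refine intervalIntegral.hasSum_integral_of_dominated_convergence
      (fun l _ => 2 * |weight α l| * (1 / (2 * Real.pi))) (fun l => ?_) (fun l => ?_) ?_ ?_ ?_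
    · exact (by fun_prop : Continuous fun θ : ℝ => (2 * weight α l * Real.cos (l * θ)) *
        (Real.cos (n * θ) / (2 * Real.pi))).aestronglyMeasurable
    · refine Filter.Eventually.of_forall fun θ _ => ?_
      rw [norm_mul, norm_div, norm_mul, norm_mul, Real.norm_two, Real.norm_eq_abs,
        Real.norm_eq_abs, Real.norm_eq_abs, Real.norm_of_nonneg (by positivity : 0 ≤ 2 * Real.pi)]
      have c1 := Real.abs_cos_le_one (l * θ)
      have c2 := Real.abs_cos_le_one (n * θ)
      exact mul_le_mul (mul_le_of_le_one_right (by positivity) c1)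
        (div_le_div_of_nonneg_right c2 (by positivity)) (by positivity) (by positivity)
    · exact Filter.Eventually.of_forall fun θ _ => ((summable_abs_weight h0 h1).mul_left 2).mul_right _
    · exact intervalIntegrable_const
    · exact Filter.Eventually.of_forall fun θ _ => (hasSum_weightSymbol h0 h1 θ).mul_right _
  have hterm : ∀ l : ℕ, ∫ θ in -Real.pi..Real.pi,
      (2 * weight α l * Real.cos (l * θ)) * (Real.cos (n * θ) / (2 * Real.pi)) =
      if l = n.natAbs then symWeight α n else 0 := by
    intro l
    have e : ∀ θ : ℝ, (2 * weight α l * Real.cos (l * θ)) * (Real.cos (n * θ) / (2 * Real.pi)) =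
        weight α l / (2 * Real.pi) * (Real.cos (((l - n : ℤ) : ℝ) * θ) +
          Real.cos (((l + n : ℤ) : ℝ) * θ)) := by
      intro θ
      push_cast
      rw [sub_mul, add_mul, Real.cos_sub, Real.cos_add]
      ring
    simp only [e]
    rw [intervalIntegral.integral_const_mul, intervalIntegral.integral_add
      ((by fun_prop : Continuous _).intervalIntegrable _ _)
      ((by fun_prop : Continuous _).intervalIntegrable _ _), integral_cos_int_mul,
      integral_cos_int_mul, symWeight]
    have hp := hpi.ne'
    by_cases hl : l = n.natAbs
    · subst hl
      by_cases hn : n = 0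
      · subst hn; simp; field_simp
        try ring
      · rw [if_pos rfl, if_neg hn]
        rcases lt_or_gt_of_ne hn with h | h
        · rw [if_neg (by omega), if_pos (by omega)]; field_simp; try ring
        · rw [if_pos (by omega), if_neg (by omega)]; field_simp; try ring
    · rw [if_neg hl, if_neg (by omega), if_neg (by omega)]
      simp
  simp only [hterm] at hs
  have h3 := hs.unique (hasSum_ite_eq n.natAbs (symWeight α n))
  rw [← h3]
  congr 1
  funext θ
  ring

theorem lfun_symWeight_nonneg {α : ℝ} (h0 : 0 < α) (hα : α ≤ alphaMax) (P : ℝ[T;T⁻¹]) :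
    0 ≤ lfun (symWeight α) (P * invert P) := by
  have h1 := hα.trans_lt alphaMax_lt_one
  refine lfun_mul_invert_nonneg (g := fun θ => weightSymbol α θ / (2 * Real.pi))
    ((continuous_weightSymbol h0 h1).div_const _) (fun θ => ?_) (symWeight_eq_integral h0 h1) P
  exact div_nonneg (weightSymbol_nonneg h0 hα θ) (by have := Real.pi_pos; positivity)

end RieszDiffusion
end

noncomputable section
namespace RieszDiffusion

open Finset Filter Topology LaurentPolynomial

/-! Grid functions as Laurent polynomials. -/

/-- The Laurent polynomial with coefficients `v 0, …, v M`. -/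
def ofGrid (M : ℕ) (v : ℤ → ℝ) : ℝ[T;T⁻¹] := ∑ j ∈ Finset.Icc (0 : ℤ) M, C (v j) * T j

theorem lfun_ofGrid_mul_invert (w : ℤ → ℝ) (M : ℕ) (u v : ℤ → ℝ) :
    lfun w (ofGrid M u * invert (ofGrid M v)) =
      ∑ i ∈ Finset.Icc (0 : ℤ) M, ∑ j ∈ Finset.Icc (0 : ℤ) M, u i * v j * w (i - j) := by
  simp only [ofGrid, map_sum, Finset.sum_mul_sum, map_mul invert, invert_C, invert_T]
  refine Finset.sum_congr rfl fun i _ => Finset.sum_congr rfl fun j _ => ?_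
  rw [mul_mul_mul_comm, ← map_mul, ← T_add, lfun_C_mul_T, sub_eq_add_neg]

theorem lfun_delta_ofGrid (M : ℕ) (u v : ℤ → ℝ) :
    lfun deltaWeight (ofGrid M u * invert (ofGrid M v)) =
      ∑ j ∈ Finset.Icc (0 : ℤ) M, u j * v j := by
  rw [lfun_ofGrid_mul_invert]
  refine Finset.sum_congr rfl fun i hi => ?_
  rw [Finset.sum_eq_single_of_mem i hi]
  · simp [deltaWeight]
  · intro j _ hj
    simp [deltaWeight, sub_eq_zero, hj.symm]

/-- The three-point stencil as a multiplier. -/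
def stencilPoly (c₁ c₂ c₃ : ℝ) : ℝ[T;T⁻¹] := C c₁ * T 1 + C c₂ + C c₃ * T (-1)

/-- A grid function vanishing at 0 and M, and outside, may be shifted by one place without leaving
the index range 0, …, M. -/
theorem ofGrid_shift {M : ℕ} {v : ℤ → ℝ} (hv : ZeroBoundary M v) (c : ℝ) {k : ℤ} (hk : |k| ≤ 1) :
    C c * T k * ofGrid M v = ofGrid M fun j => c * v (j - k) := by
  have hk' := abs_le.1 hk
  have e1 : C c * T k * ofGrid M v =
      ∑ j ∈ Finset.Icc (-1 : ℤ) (M + 1), C (c * v j) * T (j + k) := by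
    rw [ofGrid, Finset.mul_sum]
    have e3 : ∀ j ∈ Finset.Icc (0 : ℤ) M, C c * T k * (C (v j) * T j) =
        C (c * v j) * (T (j + k) : ℝ[T;T⁻¹]) := fun j _ => by
      rw [mul_mul_mul_comm, ← map_mul, ← T_add, add_comm k]
    rw [Finset.sum_congr rfl e3]
    refine Finset.sum_subset (Finset.Icc_subset_Icc (by omega) (by omega)) fun j _ hj => ?_
    rw [hv j (by simp at hj; omega)]
    simp
  rw [e1, ofGrid]
  have e2 : ∑ j ∈ Finset.Icc (-1 : ℤ) (M + 1), C (c * v j) * (T (j + k) : ℝ[T;T⁻¹]) =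
      ∑ j ∈ Finset.Icc (-1 + k : ℤ) (M + 1 + k), C (c * v (j - k)) * T j := by
    rw [← Finset.image_add_right_Icc, Finset.sum_image (by intro a _ b _ h; simpa using h)]
    simp
  rw [e2]
  symm
  refine Finset.sum_subset (Finset.Icc_subset_Icc (by omega) (by omega)) fun j _ hj => ?_
  rw [hv (j - k) (by simp at hj; omega)]
  simp

theorem ofGrid_add (M : ℕ) (u v : ℤ → ℝ) :
    ofGrid M (fun j => u j + v j) = ofGrid M u + ofGrid M v := by
  simp [ofGrid, add_mul, Finset.sum_add_distrib]

theorem stencilPoly_mul_ofGrid {M : ℕ} {v : ℤ → ℝ} (hv : ZeroBoundary M v) (c₁ c₂ c₃ : ℝ) :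
    stencilPoly c₁ c₂ c₃ * ofGrid M v = ofGrid M (stencil c₁ c₂ c₃ v) := by
  have h2 := ofGrid_shift hv c₂ (k := 0) (by simp)
  rw [T_zero, mul_one] at h2
  rw [stencilPoly, add_mul, add_mul, ofGrid_shift hv c₁ (by simp), ofGrid_shift hv c₃ (by simp),
    h2, ← ofGrid_add, ← ofGrid_add]
  congr 1
  funext j
  simp [stencil]

/-- As w is even, opposite shifts of W · `invert W` have the same value. Every form built from two
three-point stencils is therefore a combination of three numbers r₀, r₁, r₂, belonging to the shifts
by 0, 1, 2. -/
theorem lfun_stencilPoly {w : ℤ → ℝ} (hw : ∀ n, w (-n) = w n) (c₁ c₂ c₃ e₁ e₂ e₃ : ℝ)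
    (W : ℝ[T;T⁻¹]) :
    lfun w (stencilPoly c₁ c₂ c₃ * W * invert (stencilPoly e₁ e₂ e₃ * W)) =
      (c₁ * e₁ + c₂ * e₂ + c₃ * e₃) * lfun w (W * invert W)
      + (c₁ * e₂ + c₂ * e₁ + c₂ * e₃ + c₃ * e₂) * lfun w (T 1 * (W * invert W))
      + (c₁ * e₃ + c₃ * e₁) * lfun w (T 2 * (W * invert W)) := by
  have hT : ∀ n : ℤ, lfun w (T (-n) * (W * invert W)) = lfun w (T n * (W * invert W)) := by
    intro n
    rw [← lfun_invert hw (T n * (W * invert W)), map_mul invert, map_mul invert, invert_T]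
    congr 2
    rw [mul_comm]
    congr 1
    ext; simp
  have e : stencilPoly c₁ c₂ c₃ * W * invert (stencilPoly e₁ e₂ e₃ * W) =
      C (c₁ * e₁ + c₂ * e₂ + c₃ * e₃) * (W * invert W)
      + C (c₁ * e₂ + c₂ * e₃) * (T 1 * (W * invert W))
      + C (c₂ * e₁ + c₃ * e₂) * (T (-1) * (W * invert W))
      + C (c₁ * e₃) * (T 2 * (W * invert W)) + C (c₃ * e₁) * (T (-2) * (W * invert W)) := by
    have t1 : (T 1 : ℝ[T;T⁻¹]) * T (-1) = 1 := by rw [← T_add]; simp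
    have t2 : (T 2 : ℝ[T;T⁻¹]) = T 1 * T 1 := by rw [← T_add]; rfl
    have t3 : (T (-2) : ℝ[T;T⁻¹]) = T (-1) * T (-1) := by rw [← T_add]; rfl
    simp only [stencilPoly, map_mul invert, map_add invert, invert_C, invert_T, t2, t3, neg_neg,
      map_add C, map_mul C]
    linear_combination ((C c₁ * C e₁ + C c₃ * C e₃) * (W * invert W)) * t1
  rw [e]
  simp only [map_add (lfun w), lfun_C_mul, hT]
  ring

theorem deltaWeight_neg (n : ℤ) : deltaWeight (-n) = deltaWeight n := by simp [deltaWeight]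

/-- Positivity applied to the factors 1 ± T⁻¹, T - T⁻¹ and the second difference (up to sign and
shift) yields the linear inequalities between r₀, r₁, r₂ from which all later form estimates follow.
-/
theorem lfun_shift_le {w : ℤ → ℝ} (hw : ∀ n, w (-n) = w n)
    (hpos : ∀ P : ℝ[T;T⁻¹], 0 ≤ lfun w (P * invert P)) (W : ℝ[T;T⁻¹]) :
    0 ≤ lfun w (W * invert W) ∧ |lfun w (T 1 * (W * invert W))| ≤ lfun w (W * invert W) ∧
      lfun w (T 2 * (W * invert W)) ≤ lfun w (W * invert W) ∧
      0 ≤ 3 * lfun w (W * invert W) - 4 * lfun w (T 1 * (W * invert W))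
        + lfun w (T 2 * (W * invert W)) := by
  have h1 := hpos (stencilPoly 1 1 0 * W)
  have h2 := hpos (stencilPoly 1 (-1) 0 * W)
  have h3 := hpos (stencilPoly 1 0 (-1) * W)
  have h4 := hpos (stencilPoly 1 (-2) 1 * W)
  rw [lfun_stencilPoly hw] at h1 h2 h3 h4
  refine ⟨hpos W, abs_le.2 ⟨?_, ?_⟩, ?_, ?_⟩ <;> linarith

theorem sum_Icc_int_eq {E : Type*} [AddCommMonoid E] {M : ℕ} (hM : 0 < M) (g : ℤ → E) :
    ∑ j ∈ Finset.Icc (0 : ℤ) M, g j = g 0 + ∑ j ∈ Finset.Ico 1 M, g (j : ℤ) + g M := by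
  have e : Finset.Icc (0 : ℤ) M = (Finset.range (M + 1)).map Nat.castEmbedding := by
    ext j
    simp only [Finset.mem_Icc, Finset.mem_map, Finset.mem_range, Nat.castEmbedding_apply]
    exact ⟨fun h => ⟨j.toNat, by omega, by omega⟩, by rintro ⟨a, ha, rfl⟩; omega⟩
  rw [e, Finset.sum_map, Finset.sum_range_succ, Finset.range_eq_Ico,
    Finset.sum_eq_sum_Ico_succ_bot hM]
  simp

/-- The two one-sided sums form a Toeplitz matrix applied to the averages on 0, …, M. The index l =
0 occurs in both, whence the doubled diagonal of `symWeight`. -/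
theorem bracket_eq_sum {M j : ℕ} (hj : j ≤ M) (α d₁ d₂ h : ℝ) (v : ℤ → ℝ) :
    bracket α d₁ d₂ h M v j =
      ∑ i ∈ Finset.Icc (0 : ℤ) M, avg d₁ d₂ h v i * symWeight α (i - j) := by
  have e1 : ∑ l ∈ Finset.range (j + 1), weight α l * avg d₁ d₂ h v ((j : ℤ) - l) =
      ∑ i ∈ Finset.Icc (0 : ℤ) M, if i ≤ j then weight α (i - j).natAbs * avg d₁ d₂ h v i else 0 := by
    rw [← Finset.sum_filter]
    refine Finset.sum_bij' (fun l _ => (j : ℤ) - l) (fun i _ => ((j : ℤ) - i).toNat) ?_ ?_ ?_ ?_ ?_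
    · intro l hl; simp at hl ⊢; omega
    · intro i hi; simp at hi ⊢; omega
    · intro l hl; simp
    · intro i hi; simp at hi ⊢; omega
    · intro l hl
      congr 2
      simp
  have e2 : ∑ l ∈ Finset.range (M - j + 1), weight α l * avg d₁ d₂ h v ((j : ℤ) + l) =
      ∑ i ∈ Finset.Icc (0 : ℤ) M, if (j : ℤ) ≤ i then weight α (i - j).natAbs * avg d₁ d₂ h v i else 0 := by
    rw [← Finset.sum_filter]
    refine Finset.sum_bij' (fun l _ => (j : ℤ) + l) (fun i _ => (i - (j : ℤ)).toNat) ?_ ?_ ?_ ?_ ?_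
    · intro l hl; simp at hl ⊢; omega
    · intro i hi; simp at hi ⊢; omega
    · intro l hl; simp
    · intro i hi; simp at hi ⊢; omega
    · intro l hl
      congr 2
      simp
  rw [bracket, e1, e2, ← Finset.sum_add_distrib]
  refine Finset.sum_congr rfl fun i _ => ?_
  rw [symWeight]
  rcases lt_trichotomy i j with h | h | h
  · rw [if_pos h.le, if_neg (by omega), if_neg (by omega)]; ring
  · rw [if_pos h.le, if_pos h.ge, if_pos (by omega)]; ring
  · rw [if_neg (by omega), if_pos h.le, if_neg (by omega)]; ring

end RieszDiffusion
end

noncomputable section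
namespace RieszDiffusion

open Finset Filter Topology LaurentPolynomial

/-! Quadratic forms of the scheme. -/

/-- The spatial operator of the scheme. -/
def spaceOp (α d₁ d₂ dα h : ℝ) (M : ℕ) (v : ℤ → ℝ) (j : ℕ) : ℝ :=
  stencil (b₁ d₁ d₂ h) (b₂ d₁ d₂ h) (b₃ d₁ d₂ h) v j - nu α dα h * bracket α d₁ d₂ h M v j

/-- The sum of the squared differences of a grid function. -/
def diffEnergy (M : ℕ) (v : ℤ → ℝ) : ℝ := ∑ j ∈ Finset.Icc (0 : ℤ) M, (v (j - 1) - v j) ^ 2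

theorem diffEnergy_nonneg (M : ℕ) (v : ℤ → ℝ) : 0 ≤ diffEnergy M v :=
  Finset.sum_nonneg fun _ _ => sq_nonneg _

theorem ZeroBoundary.left {M : ℕ} {v : ℤ → ℝ} (hv : ZeroBoundary M v) : v 0 = 0 :=
  hv 0 (Or.inl le_rfl)

theorem ZeroBoundary.right {M : ℕ} {v : ℤ → ℝ} (hv : ZeroBoundary M v) : v M = 0 :=
  hv M (Or.inr le_rfl)

theorem sum_mul_eq_lfun {M : ℕ} (hM : 0 < M) (u : ℤ → ℝ) {x : ℤ → ℝ} (hx : ZeroBoundary M x) :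
    ∑ j ∈ Finset.Ico 1 M, u (j : ℤ) * x j =
      lfun deltaWeight (ofGrid M u * invert (ofGrid M x)) := by
  rw [lfun_delta_ofGrid, sum_Icc_int_eq hM fun j => u j * x j, hx.left, hx.right]
  ring

theorem sum_bracket_mul_eq_lfun {M : ℕ} (hM : 0 < M) (α d₁ d₂ h : ℝ) (v : ℤ → ℝ) {x : ℤ → ℝ}
    (hx : ZeroBoundary M x) :
    ∑ j ∈ Finset.Ico 1 M, bracket α d₁ d₂ h M v j * x j =
      lfun (symWeight α) (ofGrid M (avg d₁ d₂ h v) * invert (ofGrid M x)) := by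
  rw [lfun_ofGrid_mul_invert, Finset.sum_comm,
    sum_Icc_int_eq hM fun j => ∑ i ∈ Finset.Icc (0 : ℤ) M, avg d₁ d₂ h v i * x j * symWeight α (i - j),
    hx.left, hx.right]
  simp only [mul_zero, zero_mul, Finset.sum_const_zero, zero_add, add_zero]
  refine Finset.sum_congr rfl fun j hj => ?_
  rw [bracket_eq_sum (Finset.mem_Ico.1 hj).2.le, Finset.sum_mul]
  exact Finset.sum_congr rfl fun i _ => by ring

theorem stencilPoly_one (P : ℝ[T;T⁻¹]) : stencilPoly 0 1 0 * P = P := by simp [stencilPoly]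

theorem stencilPoly_avg {M : ℕ} {v : ℤ → ℝ} (hv : ZeroBoundary M v) (d₁ d₂ h : ℝ) :
    stencilPoly (a₁ d₁ d₂ h) a₂ (a₃ d₁ d₂ h) * ofGrid M v = ofGrid M (avg d₁ d₂ h v) :=
  stencilPoly_mul_ofGrid hv _ _ _

/-- The form is (5/6) r₀ + (1/6) r₁, the odd parts cancelling, and r₁ ≥ -r₀. -/
theorem avg_form_ge {M : ℕ} (hM : 0 < M) (d₁ d₂ h : ℝ) {x : ℤ → ℝ} (hx : ZeroBoundary M x) :
    2 / 3 * ∑ j ∈ Finset.Ico 1 M, x (j : ℤ) ^ 2 ≤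
      ∑ j ∈ Finset.Ico 1 M, avg d₁ d₂ h x j * x j := by
  have e : ∑ j ∈ Finset.Ico 1 M, x (j : ℤ) ^ 2 = ∑ j ∈ Finset.Ico 1 M, x (j : ℤ) * x j :=
    Finset.sum_congr rfl fun j _ => sq _
  rw [e, sum_mul_eq_lfun hM _ hx, sum_mul_eq_lfun hM _ hx, ← stencilPoly_avg hx]
  have h1 := lfun_stencilPoly deltaWeight_neg (a₁ d₁ d₂ h) a₂ (a₃ d₁ d₂ h) 0 1 0 (ofGrid M x)
  obtain ⟨h2, h3, -, -⟩ := lfun_shift_le deltaWeight_neg lfun_delta_nonneg (ofGrid M x)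
  rw [stencilPoly_one] at h1
  rw [h1, a₁, a₂, a₃]
  have := abs_le.1 h3
  linarith

/-- Tested with x itself, the convection drops out by antisymmetry. The diffusion gives a multiple
of r₁ - r₀, and the fractional part gives -ν((5/6)s₀ + (1/6)s₁) ≤ 0, with s₀, s₁ the analogous
numbers for the Toeplitz weights. This holds on every grid. -/
theorem spaceOp_form_nonpos {α d₁ d₂ dα h : ℝ} (h0 : 0 < α) (hα : α ≤ alphaMax) (hd₂ : 0 < d₂)
    (hdα : 0 < dα) (hh : 0 < h) {M : ℕ} (hM : 0 < M) {x : ℤ → ℝ} (hx : ZeroBoundary M x) :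
    ∑ j ∈ Finset.Ico 1 M, spaceOp α d₁ d₂ dα h M x j * x j ≤ 0 := by
  have hnu := nu_nonneg h0 (hα.trans_lt alphaMax_lt_one) hdα hh
  simp only [spaceOp, sub_mul, Finset.sum_sub_distrib, mul_assoc, ← Finset.mul_sum]
  rw [sum_bracket_mul_eq_lfun hM _ _ _ _ _ hx,
    sum_mul_eq_lfun hM _ hx, ← stencilPoly_avg hx, ← stencilPoly_mul_ofGrid hx]
  have h1 := lfun_stencilPoly (symWeight_neg α) (a₁ d₁ d₂ h) a₂ (a₃ d₁ d₂ h) 0 1 0 (ofGrid M x)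
  have h2 := lfun_stencilPoly deltaWeight_neg (b₁ d₁ d₂ h) (b₂ d₁ d₂ h) (b₃ d₁ d₂ h) 0 1 0
    (ofGrid M x)
  obtain ⟨h3, h4, -, -⟩ := lfun_shift_le deltaWeight_neg lfun_delta_nonneg (ofGrid M x)
  obtain ⟨h5, h6, -, -⟩ := lfun_shift_le (symWeight_neg α) (lfun_symWeight_nonneg h0 hα) (ofGrid M x)
  rw [stencilPoly_one] at h1 h2
  rw [h1, h2, a₁, a₂, a₃, b₁, b₂, b₃]
  have k4 := abs_le.1 h4
  have k6 := abs_le.1 h6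
  generalize lfun deltaWeight (ofGrid M x * invert (ofGrid M x)) = r0 at *
  generalize lfun deltaWeight (T 1 * (ofGrid M x * invert (ofGrid M x))) = r1 at *
  generalize lfun (symWeight α) (ofGrid M x * invert (ofGrid M x)) = s0 at *
  generalize lfun (symWeight α) (T 1 * (ofGrid M x * invert (ofGrid M x))) = s1 at *
  have hK : 0 ≤ d₂ / h ^ 2 + d₁ ^ 2 / (12 * d₂) := by positivity
  have m1 := mul_nonneg hK (sub_nonneg.2 k4.2)
  have m2 : 0 ≤ nu α dα h * (5 / 6 * s0 + 1 / 6 * s1) :=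
    mul_nonneg hnu (by linarith)
  linarith

theorem sum_stencil_mul_avg_le {d₁ d₂ h : ℝ} (hd₂ : 0 < d₂) (hh : 0 < h) {M : ℕ}
    {w : ℤ → ℝ} (hw : ZeroBoundary M w) :
    ∑ j ∈ Finset.Icc (0 : ℤ) M,
      stencil (b₁ d₁ d₂ h) (b₂ d₁ d₂ h) (b₃ d₁ d₂ h) w j * avg d₁ d₂ h w j ≤
      -(2 / 3 * (d₂ / h ^ 2) * diffEnergy M w) := by
  have e1 : diffEnergy M w = ∑ j ∈ Finset.Icc (0 : ℤ) M,
      stencil 1 (-1) 0 w j * stencil 1 (-1) 0 w j :=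
    Finset.sum_congr rfl fun j _ => by simp [stencil]; ring
  rw [e1, ← lfun_delta_ofGrid, ← lfun_delta_ofGrid, ← stencilPoly_avg hw,
    ← stencilPoly_mul_ofGrid hw, ← stencilPoly_mul_ofGrid hw, lfun_stencilPoly deltaWeight_neg,
    lfun_stencilPoly deltaWeight_neg]
  obtain ⟨h3, h4, h5, h6⟩ := lfun_shift_le deltaWeight_neg lfun_delta_nonneg (ofGrid M w)
  have k4 := abs_le.1 h4
  generalize lfun deltaWeight (ofGrid M w * invert (ofGrid M w)) = r0 at *
  generalize lfun deltaWeight (T 1 * (ofGrid M w * invert (ofGrid M w))) = r1 at *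
  generalize lfun deltaWeight (T 2 * (ofGrid M w * invert (ofGrid M w))) = r2 at *
  have m1 : 0 ≤ d₂ / h ^ 2 * (r0 - r2) := mul_nonneg (by positivity) (by linarith)
  have m2 : 0 ≤ d₁ ^ 2 / d₂ * (3 * r0 - 4 * r1 + r2) := mul_nonneg (by positivity) h6
  -- The form splits into the difference energy 2r₀ - 2r₁ and two further contributions, each of the
  -- favourable sign by `lfun_shift_le`.
  have key : (b₁ d₁ d₂ h * a₁ d₁ d₂ h + b₂ d₁ d₂ h * a₂ + b₃ d₁ d₂ h * a₃ d₁ d₂ h) * r0 +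
      (b₁ d₁ d₂ h * a₂ + b₂ d₁ d₂ h * a₁ d₁ d₂ h + b₂ d₁ d₂ h * a₃ d₁ d₂ h + b₃ d₁ d₂ h * a₂) * r1 +
      (b₁ d₁ d₂ h * a₃ d₁ d₂ h + b₃ d₁ d₂ h * a₁ d₁ d₂ h) * r2 =
      -(2 / 3 * (d₂ / h ^ 2) * (2 * r0 - 2 * r1)) - 1 / 6 * (d₂ / h ^ 2 * (r0 - r2))
        - 1 / 36 * (d₁ ^ 2 / d₂ * (3 * r0 - 4 * r1 + r2)) := by
    rw [a₁, a₂, a₃, b₁, b₂, b₃]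
    field_simp
    ring
  rw [key]
  linarith

end RieszDiffusion
end

/-! ### The spatial operator tested against averages. -/

noncomputable section
namespace RieszDiffusion

open Finset Filter Topology LaurentPolynomial

/-- The absolute sum of the weights. -/
def weightSum (α : ℝ) : ℝ := ∑' l, |weight α l|

theorem abs_weight_le {α : ℝ} (h0 : 0 < α) (h1 : α < 1) (l : ℕ) : |weight α l| ≤ weightSum α :=
  (summable_abs_weight h0 h1).le_tsum l fun _ _ => abs_nonneg _

theorem weightSum_nonneg (α : ℝ) : 0 ≤ weightSum α := tsum_nonneg fun _ => abs_nonneg _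

theorem abs_symWeight_le {α : ℝ} (h0 : 0 < α) (h1 : α < 1) (n : ℤ) :
    |symWeight α n| ≤ 2 * weightSum α := by
  have h := abs_weight_le h0 h1 n.natAbs
  have hS := weightSum_nonneg α
  rw [symWeight, abs_mul]
  split_ifs <;> simp only [abs_two, abs_one] <;> linarith

theorem lfun_mul_invert_comm {w : ℤ → ℝ} (hw : ∀ n, w (-n) = w n) (P Q : ℝ[T;T⁻¹]) :
    lfun w (P * invert Q) = lfun w (Q * invert P) := by
  rw [← lfun_invert hw, map_mul invert, mul_comm]
  congr 2
  ext; simp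

/-- Completing the square: (Y + E)Y* and |Y + E/2|² - |E|²/4 have the same value under the symmetric
functional. -/
theorem lfun_add_mul_invert_ge {w : ℤ → ℝ} (hw : ∀ n, w (-n) = w n)
    (hpos : ∀ P : ℝ[T;T⁻¹], 0 ≤ lfun w (P * invert P)) (Y E : ℝ[T;T⁻¹]) :
    -(lfun w (E * invert E) / 4) ≤ lfun w ((Y + E) * invert Y) := by
  have h := hpos (Y + C (1 / 2) * E)
  have e : (Y + C (1 / 2) * E) * invert (Y + C (1 / 2) * E) = Y * invert Y +
      C (1 / 2) * (E * invert Y) + C (1 / 2) * (Y * invert E) + C (1 / 4) * (E * invert E) := by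
    have hC : (C (1 / 4 : ℝ) : ℝ[T;T⁻¹]) = C (1 / 2) * C (1 / 2) := by rw [← map_mul]; norm_num
    rw [map_add invert, map_mul invert, invert_C, hC]
    ring
  rw [e, map_add, map_add, map_add, lfun_C_mul, lfun_C_mul, lfun_C_mul,
    lfun_mul_invert_comm hw Y E] at h
  rw [add_mul, map_add]
  linarith

/-- The bracket involves the averages at 0 and M, but the test sum does not. Splitting them off as
E, the square completion costs a quarter of the form of E, and `|symWeight| ≤ 2 * weightSum` bounds
that form by four times `weightSum` (p² + q²). -/
theorem sum_bracket_mul_avg_ge {α : ℝ} (h0 : 0 < α) (hα : α ≤ alphaMax) {M : ℕ} (hM : 0 < M)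
    (d₁ d₂ h : ℝ) (w : ℤ → ℝ) :
    -(weightSum α * ((avg d₁ d₂ h w 0) ^ 2 + (avg d₁ d₂ h w M) ^ 2)) ≤
      ∑ j ∈ Finset.Ico 1 M, bracket α d₁ d₂ h M w j * avg d₁ d₂ h w j := by
  set p := avg d₁ d₂ h w 0 with hp
  set q := avg d₁ d₂ h w M with hq
  have h1 := hα.trans_lt alphaMax_lt_one
  let y : ℤ → ℝ := fun j => if 0 < j ∧ j < M then avg d₁ d₂ h w j else 0
  have hy : ZeroBoundary M y := fun j hj => if_neg (by omega)
  have hM' : (M : ℤ) ≠ 0 := by omega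
  have hE : ofGrid M (avg d₁ d₂ h w) = ofGrid M y + (C p + C q * T M) := by
    rw [ofGrid, ofGrid, sum_Icc_int_eq hM, sum_Icc_int_eq hM, hy.left, hy.right]
    have e : ∑ j ∈ Finset.Ico 1 M, C (y j) * (T j : ℝ[T;T⁻¹]) =
        ∑ j ∈ Finset.Ico 1 M, C (avg d₁ d₂ h w j) * T j := by
      refine Finset.sum_congr rfl fun j hj => ?_
      have := Finset.mem_Ico.1 hj
      simp only [y]
      rw [if_pos (by omega)]
    rw [e, ← hp, ← hq, map_zero, T_zero]
    ring
  have hs : ∑ j ∈ Finset.Ico 1 M, bracket α d₁ d₂ h M w j * avg d₁ d₂ h w j =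
      ∑ j ∈ Finset.Ico 1 M, bracket α d₁ d₂ h M w j * y j := by
    refine Finset.sum_congr rfl fun j hj => ?_
    have := Finset.mem_Ico.1 hj
    simp only [y]
    rw [if_pos (by omega)]
  rw [hs, sum_bracket_mul_eq_lfun hM _ _ _ _ _ hy, hE]
  refine le_trans ?_ (lfun_add_mul_invert_ge (symWeight_neg α) (lfun_symWeight_nonneg h0 hα) _ _)
  have e : (C p + C q * T M) * invert (C p + C q * T M) =
      C (p ^ 2 + q ^ 2) * T 0 + C (p * q) * T M + C (p * q) * (T (-M) : ℝ[T;T⁻¹]) := by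
    have t1 : (T M : ℝ[T;T⁻¹]) * T (-M) = 1 := by rw [← T_add]; simp
    simp only [map_mul invert, map_add invert, invert_C, invert_T, map_add C, map_mul C, sq, T_zero]
    linear_combination (C q * C q) * t1
  rw [e, map_add, map_add, lfun_C_mul_T, lfun_C_mul_T, lfun_C_mul_T, symWeight_neg]
  have k0 := abs_le.1 (abs_symWeight_le h0 h1 0)
  have k1 := abs_le.1 (abs_symWeight_le h0 h1 M)
  nlinarith [mul_nonneg (sq_nonneg (p + q)) (by linarith : 0 ≤ 2 * weightSum α - symWeight α M),
    mul_nonneg (sq_nonneg (p - q)) (by linarith : 0 ≤ 2 * weightSum α + symWeight α M),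
    mul_nonneg (add_nonneg (sq_nonneg p) (sq_nonneg q)) (by linarith : 0 ≤ 2 * weightSum α - symWeight α 0)]

/-- The stencil estimate runs over 0, …, M. Removing its end terms b₃a₃w₁² and b₁a₁w_{M-1}² improves
the bound for the interior sum, and on a fine grid this gain dominates the loss ν `weightSum`
(a₃²w₁² + a₁²w_{M-1}²) from the bracket. -/
theorem spaceOp_avg_form_le {α d₁ d₂ dα h : ℝ} (h0 : 0 < α) (hα : α ≤ alphaMax) (hd₁ : 0 < d₁)
    (hd₂ : 0 < d₂) (hdα : 0 < dα) (hh : 0 < h) (hPe : d₁ * h ≤ d₂)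
    (hsmall : nu α dα h * weightSum α ≤ d₂ / h ^ 2) {M : ℕ} (hM : 0 < M) {w : ℤ → ℝ}
    (hw : ZeroBoundary M w) :
    ∑ j ∈ Finset.Ico 1 M, spaceOp α d₁ d₂ dα h M w j * avg d₁ d₂ h w j ≤
      -(2 / 3 * (d₂ / h ^ 2) * diffEnergy M w) := by
  have hnu := nu_nonneg h0 (hα.trans_lt alphaMax_lt_one) hdα hh
  have k1 := sum_stencil_mul_avg_le (d₁ := d₁) hd₂ hh hw
  rw [sum_Icc_int_eq hM] at k1
  have k2 := mul_le_mul_of_nonneg_left (sum_bracket_mul_avg_ge h0 hα hM d₁ d₂ h w) hnu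
  simp only [spaceOp, sub_mul, Finset.sum_sub_distrib, mul_assoc, ← Finset.mul_sum]
  have v0 : w 0 = 0 := hw.left
  have vm : w (-1) = 0 := hw _ (by omega)
  have vM : w M = 0 := hw.right
  have vM1 : w (M + 1) = 0 := hw _ (by omega)
  have i1 : (0 : ℤ) - 1 = -1 := rfl
  simp only [avg, stencil, i1, v0, vm, vM, vM1, smul_eq_mul, mul_zero, zero_add, add_zero] at k1 k2 ⊢
  set p := w 1
  set q := w (M - 1)
  have hu : d₁ * h / (24 * d₂) ≤ 1 / 24 := by rw [div_le_div_iff₀ (by positivity) (by norm_num)]; linarith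
  have hu0 : 0 ≤ d₁ * h / (24 * d₂) := by positivity
  have A1 : 0 ≤ a₁ d₁ d₂ h := by rw [a₁]; linarith
  have A3 : 0 ≤ a₃ d₁ d₂ h := by rw [a₃]; linarith
  have A1' : a₁ d₁ d₂ h ≤ 1 / 2 := by rw [a₁]; linarith
  have A3' : a₃ d₁ d₂ h ≤ 1 / 2 := by rw [a₃]; linarith
  have hb : d₁ / (2 * h) ≤ 1 / 2 * (d₂ / h ^ 2) := by
    rw [← mul_div_assoc, div_le_div_iff₀ (by positivity) (by positivity)]
    nlinarith
  have hb0 : 0 ≤ d₁ / (2 * h) := by positivity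
  have hb1 : 0 ≤ d₁ ^ 2 / (12 * d₂) := by positivity
  have hX : 0 ≤ nu α dα h * weightSum α := mul_nonneg hnu (weightSum_nonneg α)
  -- Both inequalities use aᵢ ≤ 1/2 on the left and a remaining diffusion of at least d₂/(2h²) on
  -- the right.
  have B1 : nu α dα h * weightSum α * a₁ d₁ d₂ h ≤ b₁ d₁ d₂ h := by
    rw [b₁]; nlinarith
  have B3 : nu α dα h * weightSum α * a₃ d₁ d₂ h ≤ b₃ d₁ d₂ h := by
    rw [b₃]; nlinarith
  have m1 := mul_nonneg (mul_nonneg A1 (sub_nonneg.2 B1)) (sq_nonneg q)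
  have m3 := mul_nonneg (mul_nonneg A3 (sub_nonneg.2 B3)) (sq_nonneg p)
  linarith

end RieszDiffusion
end

/-! ### Energy estimate for one time step on a fine grid. -/

noncomputable section
namespace RieszDiffusion

open Finset Filter Topology LaurentPolynomial

/-- The sum of the squares of the interior values of a grid function. -/
def gridSq (M : ℕ) (v : ℤ → ℝ) : ℝ := ∑ j ∈ Finset.Ico 1 M, v (j : ℤ) ^ 2

theorem gridSq_nonneg (M : ℕ) (v : ℤ → ℝ) : 0 ≤ gridSq M v :=
  Finset.sum_nonneg fun _ _ => sq_nonneg _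

/-- Discrete Sobolev inequality: the value is a sum of at most M differences starting from the
boundary value 0, and Cauchy–Schwarz applies. -/
theorem sq_le_diffEnergy {M : ℕ} (hM : 0 < M) {w : ℤ → ℝ} (hw : ZeroBoundary M w) (j : ℤ) :
    w j ^ 2 ≤ M * diffEnergy M w := by
  have hD := diffEnergy_nonneg M w
  by_cases hj : j ≤ 0 ∨ (M : ℤ) ≤ j
  · rw [hw j hj, zero_pow two_ne_zero]
    positivity
  obtain ⟨n, rfl⟩ : ∃ n : ℕ, j = n := ⟨j.toNat, by omega⟩
  have hn : n ≤ M := by omega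
  have e : w n = ∑ i ∈ Finset.range n, (w ((i + 1 : ℕ) : ℤ) - w (i : ℤ)) := by
    rw [Finset.sum_range_sub fun i : ℕ => w i]
    simp [hw.left]
  have e2 : ∑ i ∈ Finset.range M, (w ((i + 1 : ℕ) : ℤ) - w (i : ℤ)) ^ 2 ≤ diffEnergy M w := by
    rw [diffEnergy, sum_Icc_int_eq hM, add_assoc,
      ← Finset.sum_Ico_succ_top (f := fun j : ℕ => (w ((j : ℤ) - 1) - w (j : ℤ)) ^ 2) (by omega),
      Finset.sum_Ico_eq_sum_range]
    refine le_add_of_nonneg_of_le (sq_nonneg _) (le_of_eq ?_)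
    refine Finset.sum_congr (by simp) fun i _ => ?_
    rw [← neg_sq]
    push_cast
    ring_nf
  rw [e]
  refine sq_sum_le_card_mul_sum_sq.trans ?_
  rw [Finset.card_range]
  refine mul_le_mul (by exact_mod_cast hn) (le_trans ?_ e2)
    (Finset.sum_nonneg fun _ _ => sq_nonneg _) (by positivity)
  exact Finset.sum_le_sum_of_subset_of_nonneg (Finset.range_subset_range.2 hn)
    fun _ _ _ => sq_nonneg _

theorem gridSq_avg_le {M : ℕ} (hM : 0 < M) {d₁ d₂ h : ℝ} (h1 : 0 ≤ a₁ d₁ d₂ h)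
    (h3 : 0 ≤ a₃ d₁ d₂ h) {x : ℤ → ℝ} (hx : ZeroBoundary M x) :
    gridSq M (avg d₁ d₂ h x) ≤ gridSq M x := by
  have e1 : gridSq M (avg d₁ d₂ h x) ≤
      ∑ j ∈ Finset.Icc (0 : ℤ) M, avg d₁ d₂ h x j * avg d₁ d₂ h x j := by
    rw [sum_Icc_int_eq hM, gridSq]
    simp only [sq]
    linarith [mul_self_nonneg (avg d₁ d₂ h x 0), mul_self_nonneg (avg d₁ d₂ h x M)]
  have e2 : gridSq M x = ∑ j ∈ Finset.Ico 1 M, x (j : ℤ) * x j :=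
    Finset.sum_congr rfl fun j _ => sq _
  refine e1.trans ?_
  rw [e2, sum_mul_eq_lfun hM _ hx, ← lfun_delta_ofGrid, ← stencilPoly_avg hx,
    lfun_stencilPoly deltaWeight_neg]
  obtain ⟨k1, k2, k3, -⟩ := lfun_shift_le deltaWeight_neg lfun_delta_nonneg (ofGrid M x)
  have k4 := abs_le.1 k2
  have hs : a₃ d₁ d₂ h = 1 / 6 - a₁ d₁ d₂ h := by rw [a₁, a₃]; ring
  rw [a₂]
  rw [hs] at h3 ⊢
  nlinarith [mul_nonneg (mul_nonneg h1 h3) (sub_nonneg.2 k3)]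

/-- Expand 0 ≤ ‖Ax - (2/3)x‖² and insert `avg_form_ge`. With `gridSq_avg_le` this makes ‖Ax‖ an
equivalent norm. -/
theorem gridSq_le_avg {M : ℕ} (hM : 0 < M) (d₁ d₂ h : ℝ) {x : ℤ → ℝ} (hx : ZeroBoundary M x) :
    4 / 9 * gridSq M x ≤ gridSq M (avg d₁ d₂ h x) := by
  have h1 : 2 / 3 * gridSq M x ≤ _ := avg_form_ge hM d₁ d₂ h hx
  have h2 : 0 ≤ ∑ j ∈ Finset.Ico 1 M, (avg d₁ d₂ h x j - 2 / 3 * x j) ^ 2 :=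
    Finset.sum_nonneg fun _ _ => sq_nonneg _
  have e : ∑ j ∈ Finset.Ico 1 M, (avg d₁ d₂ h x j - 2 / 3 * x j) ^ 2 =
      gridSq M (avg d₁ d₂ h x) - 4 / 3 * ∑ j ∈ Finset.Ico 1 M, avg d₁ d₂ h x j * x j
        + 4 / 9 * gridSq M x := by
    rw [gridSq, gridSq, Finset.mul_sum, Finset.mul_sum, ← Finset.sum_sub_distrib,
      ← Finset.sum_add_distrib]
    exact Finset.sum_congr rfl fun j _ => by ring
  linarith

/-- `x` is the new and `y` the old time level of the scheme with residual `f`. -/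
def IsStep (α d₁ d₂ dα τ h : ℝ) (M : ℕ) (f : ℕ → ℝ) (x y : ℤ → ℝ) : Prop :=
  ∀ j : ℕ, 1 ≤ j → j < M → 2 / τ * (avg d₁ d₂ h x j - avg d₁ d₂ h y j) =
    spaceOp α d₁ d₂ dα h M x j + spaceOp α d₁ d₂ dα h M y j + 2 * f j

theorem stencil_add (c₁ c₂ c₃ : ℝ) (u v : ℤ → ℝ) (j : ℤ) :
    stencil c₁ c₂ c₃ (fun i => u i + v i) j = stencil c₁ c₂ c₃ u j + stencil c₁ c₂ c₃ v j := by
  simp only [stencil, smul_eq_mul]; ring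

theorem stencil_const_mul (c₁ c₂ c₃ c : ℝ) (u : ℤ → ℝ) (j : ℤ) :
    stencil c₁ c₂ c₃ (fun i => c * u i) j = c * stencil c₁ c₂ c₃ u j := by
  simp only [stencil, smul_eq_mul]; ring

theorem avg_add (d₁ d₂ h : ℝ) (u v : ℤ → ℝ) (j : ℤ) :
    avg d₁ d₂ h (fun i => u i + v i) j = avg d₁ d₂ h u j + avg d₁ d₂ h v j := stencil_add ..

theorem avg_const_mul (d₁ d₂ h c : ℝ) (u : ℤ → ℝ) (j : ℤ) :
    avg d₁ d₂ h (fun i => c * u i) j = c * avg d₁ d₂ h u j := stencil_const_mul ..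

theorem bracket_add (α d₁ d₂ h : ℝ) (M : ℕ) (u v : ℤ → ℝ) (j : ℕ) :
    bracket α d₁ d₂ h M (fun i => u i + v i) j =
      bracket α d₁ d₂ h M u j + bracket α d₁ d₂ h M v j := by
  simp only [bracket, avg_add, mul_add, Finset.sum_add_distrib]
  ring

theorem bracket_const_mul (α d₁ d₂ h c : ℝ) (M : ℕ) (u : ℤ → ℝ) (j : ℕ) :
    bracket α d₁ d₂ h M (fun i => c * u i) j = c * bracket α d₁ d₂ h M u j := by
  simp only [bracket, avg_const_mul, mul_add, Finset.mul_sum, mul_left_comm]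

theorem spaceOp_add (α d₁ d₂ dα h : ℝ) (M : ℕ) (u v : ℤ → ℝ) (j : ℕ) :
    spaceOp α d₁ d₂ dα h M (fun i => u i + v i) j =
      spaceOp α d₁ d₂ dα h M u j + spaceOp α d₁ d₂ dα h M v j := by
  simp only [spaceOp, stencil_add, bracket_add]
  ring

theorem spaceOp_const_mul (α d₁ d₂ dα h c : ℝ) (M : ℕ) (u : ℤ → ℝ) (j : ℕ) :
    spaceOp α d₁ d₂ dα h M (fun i => c * u i) j = c * spaceOp α d₁ d₂ dα h M u j := by
  simp only [spaceOp, stencil_const_mul, bracket_const_mul]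
  ring

theorem ZeroBoundary.add {M : ℕ} {u v : ℤ → ℝ} (hu : ZeroBoundary M u) (hv : ZeroBoundary M v) :
    ZeroBoundary M fun i => u i + v i := fun j hj => by simp [hu j hj, hv j hj]

theorem ZeroBoundary.const_mul {M : ℕ} {u : ℤ → ℝ} (hu : ZeroBoundary M u) (c : ℝ) :
    ZeroBoundary M fun i => c * u i := fun j hj => by simp [hu j hj]

/-- Multiplying the step by the average of w = x + y turns the left side into a difference of
energies. The source is paired as L¹ against the maximum norm of w, which is at most √(MD), and the
dissipation D absorbs it. The L¹ norm of the source matters because the truncation error is singular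
at the end points. -/
theorem IsStep.fine_le {α d₁ d₂ dα τ h L F : ℝ} (h0 : 0 < α) (hα : α ≤ alphaMax) (hd₁ : 0 < d₁)
    (hd₂ : 0 < d₂) (hdα : 0 < dα) (hτ : 0 < τ) (hh : 0 < h) (hPe : d₁ * h ≤ d₂)
    (hsmall : nu α dα h * weightSum α ≤ d₂ / h ^ 2) {M : ℕ} (hM : 0 < M) (hL : h * M ≤ L)
    {f : ℕ → ℝ} (hF : h * ∑ j ∈ Finset.Ico 1 M, |f j| ≤ F) {x y : ℤ → ℝ}
    (hx : ZeroBoundary M x) (hy : ZeroBoundary M y) (hs : IsStep α d₁ d₂ dα τ h M f x y) :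
    h * gridSq M (avg d₁ d₂ h x) ≤
      h * gridSq M (avg d₁ d₂ h y) + τ * (L / d₂ * F ^ 2) := by
  set w : ℤ → ℝ := fun i => x i + y i with hwdef
  have hw : ZeroBoundary M w := hx.add hy
  have hform := spaceOp_avg_form_le h0 hα hd₁ hd₂ hdα hh hPe hsmall hM hw
  set D := diffEnergy M w
  have hD : 0 ≤ D := diffEnergy_nonneg M w
  have hu : d₁ * h / (24 * d₂) ≤ 1 / 24 := by
    rw [div_le_div_iff₀ (by positivity) (by norm_num)]; linarith
  have hu0 : 0 ≤ d₁ * h / (24 * d₂) := by positivity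
  have A1 : 0 ≤ a₁ d₁ d₂ h := by rw [a₁]; linarith
  have A3 : 0 ≤ a₃ d₁ d₂ h := by rw [a₃]; linarith
  have hsup : ∀ j, |w j| ≤ Real.sqrt (M * D) := fun j =>
    Real.abs_le_sqrt (sq_le_diffEnergy hM hw j)
  have havg : ∀ j, |avg d₁ d₂ h w j| ≤ Real.sqrt (M * D) := by
    intro j
    have e : a₁ d₁ d₂ h + a₂ + a₃ d₁ d₂ h = 1 := by rw [a₁, a₂, a₃]; ring
    have A2 : 0 ≤ a₂ := by norm_num [a₂]
    have q1 := abs_le.1 (hsup (j - 1))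
    have q2 := abs_le.1 (hsup j)
    have q3 := abs_le.1 (hsup (j + 1))
    simp only [avg, stencil, smul_eq_mul]
    set m := Real.sqrt (M * D)
    rw [abs_le]
    constructor <;> nlinarith
  have hident : 2 / τ * (gridSq M (avg d₁ d₂ h x) - gridSq M (avg d₁ d₂ h y)) =
      ∑ j ∈ Finset.Ico 1 M, spaceOp α d₁ d₂ dα h M w j * avg d₁ d₂ h w j +
        2 * ∑ j ∈ Finset.Ico 1 M, f j * avg d₁ d₂ h w j := by
    rw [gridSq, gridSq, ← Finset.sum_sub_distrib, Finset.mul_sum, Finset.mul_sum,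
      ← Finset.sum_add_distrib]
    refine Finset.sum_congr rfl fun j hj => ?_
    have hj' := Finset.mem_Ico.1 hj
    have := hs j hj'.1 hj'.2
    rw [hwdef, spaceOp_add, avg_add]
    linear_combination (avg d₁ d₂ h x j + avg d₁ d₂ h y j) * this
  have hfsum : ∑ j ∈ Finset.Ico 1 M, f j * avg d₁ d₂ h w j ≤
      (∑ j ∈ Finset.Ico 1 M, |f j|) * Real.sqrt (M * D) := by
    rw [Finset.sum_mul]
    refine Finset.sum_le_sum fun j _ => (le_abs_self _).trans ?_
    rw [abs_mul]
    exact mul_le_mul_of_nonneg_left (havg j) (abs_nonneg _)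
  set Φ := ∑ j ∈ Finset.Ico 1 M, |f j|
  have hΦ : 0 ≤ Φ := Finset.sum_nonneg fun _ _ => abs_nonneg _
  set m := Real.sqrt (M * D)
  have hm : m ^ 2 = M * D := Real.sq_sqrt (by positivity)
  have hMpos : (0 : ℝ) < M := by exact_mod_cast hM
  have hmain : gridSq M (avg d₁ d₂ h x) - gridSq M (avg d₁ d₂ h y) ≤
      τ / 2 * (2 * (Φ * m) - 2 / 3 * (d₂ / h ^ 2) * D) := by
    have e : gridSq M (avg d₁ d₂ h x) - gridSq M (avg d₁ d₂ h y) =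
        τ / 2 * (2 / τ * (gridSq M (avg d₁ d₂ h x) - gridSq M (avg d₁ d₂ h y))) := by
      field_simp
    rw [e]
    refine mul_le_mul_of_nonneg_left ?_ (by positivity)
    rw [hident]
    linarith
  have hAG : 2 * (Φ * m) - 2 / 3 * (d₂ / h ^ 2) * D ≤ 2 * (L / d₂ * F ^ 2 / h) := by
    have hF2 : (h * Φ) ^ 2 ≤ F ^ 2 := by gcongr
    have hL0 : 0 ≤ L := le_trans (by positivity) hL
    -- Young's inequality, with weights chosen so that the m² term equals the available dissipation
    -- exactly.
    have h1 : 2 * (Φ * m) ≤ 3 / 2 * (M * h ^ 2 / d₂ * Φ ^ 2) + 2 / 3 * (d₂ / (M * h ^ 2)) * m ^ 2 := by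
      have := sq_nonneg (3 * (M * h ^ 2) * Φ - 2 * d₂ * m)
      have e : 3 / 2 * (M * h ^ 2 / d₂ * Φ ^ 2) + 2 / 3 * (d₂ / (M * h ^ 2)) * m ^ 2 - 2 * (Φ * m) =
          (3 * (M * h ^ 2) * Φ - 2 * d₂ * m) ^ 2 / (6 * d₂ * (M * h ^ 2)) := by
        field_simp
        ring
      have : 0 ≤ (3 * (M * h ^ 2) * Φ - 2 * d₂ * m) ^ 2 / (6 * d₂ * (M * h ^ 2)) := by positivity
      linarith
    have h2 : 2 / 3 * (d₂ / (M * h ^ 2)) * m ^ 2 = 2 / 3 * (d₂ / h ^ 2) * D := by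
      rw [hm]; field_simp
    have h3 : 3 / 2 * (M * h ^ 2 / d₂ * Φ ^ 2) ≤ 2 * (L / d₂ * F ^ 2 / h) := by
      have e : M * h ^ 2 / d₂ * Φ ^ 2 = (h * M) / d₂ * (h * Φ) ^ 2 / h := by field_simp
      rw [e]
      have : (h * M) / d₂ * (h * Φ) ^ 2 / h ≤ L / d₂ * F ^ 2 / h := by gcongr
      have : 0 ≤ L / d₂ * F ^ 2 / h := by positivity
      linarith
    linarith
  have hfin := mul_le_mul_of_nonneg_left (hmain.trans
    (mul_le_mul_of_nonneg_left hAG (by positivity : 0 ≤ τ / 2))) hh.le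
  have e : h * (τ / 2 * (2 * (L / d₂ * F ^ 2 / h))) = τ * (L / d₂ * F ^ 2) := by
    field_simp
  rw [e] at hfin
  linarith

end RieszDiffusion
end

/-! ### One time step on an arbitrary fixed grid; solvability. -/

noncomputable section
namespace RieszDiffusion

open Finset Filter Topology

theorem gridNorm_eq (h : ℝ) (M : ℕ) (v : ℤ → ℝ) : gridNorm h M v = Real.sqrt (h * gridSq M v) := rfl

theorem gridNorm_nonneg (h : ℝ) (M : ℕ) (v : ℤ → ℝ) : 0 ≤ gridNorm h M v := Real.sqrt_nonneg _

theorem gridNorm_sq {h : ℝ} (hh : 0 ≤ h) (M : ℕ) (v : ℤ → ℝ) :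
    gridNorm h M v ^ 2 = h * gridSq M v :=
  Real.sq_sqrt (mul_nonneg hh (gridSq_nonneg _ _))

theorem gridNorm_eq_mul {h : ℝ} (hh : 0 ≤ h) (M : ℕ) (v : ℤ → ℝ) :
    gridNorm h M v = Real.sqrt h * gridNorm 1 M v := by
  rw [gridNorm_eq, gridNorm_eq, one_mul, Real.sqrt_mul hh]

theorem abs_le_gridNorm_one {M j : ℕ} (h1 : 1 ≤ j) (hj : j < M) (v : ℤ → ℝ) :
    |v j| ≤ gridNorm 1 M v := by
  rw [gridNorm_eq, one_mul]
  exact Real.abs_le_sqrt (Finset.single_le_sum (f := fun j : ℕ => v (j : ℤ) ^ 2)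
    (fun _ _ => sq_nonneg _) (Finset.mem_Ico.2 ⟨h1, hj⟩))

theorem gridNorm_one_le_add (M : ℕ) (u v : ℤ → ℝ) :
    gridNorm 1 M u ≤ gridNorm 1 M v + gridNorm 1 M fun j => u j - v j := by
  have h := Real.Lp_add_le (Finset.Ico 1 M) (fun j : ℕ => v j) (fun j : ℕ => u j - v j)
    (p := 2) (by norm_num)
  simp only [gridNorm, one_mul, Real.sqrt_eq_rpow]
  norm_num at h ⊢
  exact h

theorem gridNorm_one_mul_sum_le {M : ℕ} (f : ℕ → ℝ) (z : ℤ → ℝ) :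
    ∑ j ∈ Finset.Ico 1 M, f j * z j ≤ (∑ j ∈ Finset.Ico 1 M, |f j|) * gridNorm 1 M z := by
  rw [Finset.sum_mul]
  refine Finset.sum_le_sum fun j hj => (le_abs_self _).trans ?_
  rw [abs_mul]
  have := Finset.mem_Ico.1 hj
  exact mul_le_mul_of_nonneg_left (abs_le_gridNorm_one this.1 this.2 z) (abs_nonneg _)

theorem abs_stencil_le (c₁ c₂ c₃ : ℝ) {v : ℤ → ℝ} {m : ℝ} (hv : ∀ j, |v j| ≤ m) (j : ℤ) :
    |stencil c₁ c₂ c₃ v j| ≤ (|c₁| + |c₂| + |c₃|) * m := by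
  simp only [stencil, smul_eq_mul]
  refine (abs_add_three _ _ _).trans ?_
  rw [abs_mul, abs_mul, abs_mul, add_mul, add_mul]
  gcongr <;> exact hv _

theorem abs_sum_weight_mul_le {α : ℝ} (h0 : 0 < α) (h1 : α < 1) (n : ℕ) {g : ℕ → ℝ} {m : ℝ}
    (hm : 0 ≤ m) (hg : ∀ l, |g l| ≤ m) :
    |∑ l ∈ Finset.range n, weight α l * g l| ≤ weightSum α * m := by
  refine (Finset.abs_sum_le_sum_abs _ _).trans ?_
  have : ∑ l ∈ Finset.range n, |weight α l * g l| ≤ ∑ l ∈ Finset.range n, |weight α l| * m :=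
    Finset.sum_le_sum fun l _ => by
      rw [abs_mul]; exact mul_le_mul_of_nonneg_left (hg l) (abs_nonneg _)
  refine this.trans ?_
  rw [← Finset.sum_mul]
  exact mul_le_mul_of_nonneg_right
    ((summable_abs_weight h0 h1).sum_le_tsum _ fun _ _ => abs_nonneg _) hm

theorem exists_abs_spaceOp_le {α : ℝ} (h0 : 0 < α) (h1 : α < 1) (d₁ d₂ dα h : ℝ) (M : ℕ) :
    ∃ K : ℝ, 0 ≤ K ∧ ∀ v : ℤ → ℝ, ZeroBoundary M v → ∀ j : ℕ,
      |spaceOp α d₁ d₂ dα h M v j| ≤ K * gridNorm 1 M v := by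
  set c := |a₁ d₁ d₂ h| + |a₂| + |a₃ d₁ d₂ h| with hc
  have hc0 : 0 ≤ c := by positivity
  have hS := weightSum_nonneg α
  refine ⟨|b₁ d₁ d₂ h| + |b₂ d₁ d₂ h| + |b₃ d₁ d₂ h| + |nu α dα h| * (2 * weightSum α * c),
    by positivity, fun v hv j => ?_⟩
  have hm := gridNorm_nonneg 1 M v
  have hv' : ∀ j, |v j| ≤ gridNorm 1 M v := by
    intro j
    by_cases hj : j ≤ 0 ∨ (M : ℤ) ≤ j
    · rw [hv j hj, abs_zero]; exact hm
    · obtain ⟨n, rfl⟩ : ∃ n : ℕ, j = n := ⟨j.toNat, by omega⟩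
      exact abs_le_gridNorm_one (by omega) (by omega) v
  have ha : ∀ j, |avg d₁ d₂ h v j| ≤ c * gridNorm 1 M v := abs_stencil_le _ _ _ hv'
  have hb : |bracket α d₁ d₂ h M v j| ≤ 2 * weightSum α * c * gridNorm 1 M v := by
    refine (abs_add_le _ _).trans ?_
    have k1 := abs_sum_weight_mul_le h0 h1 (j + 1) (mul_nonneg hc0 hm)
      fun l : ℕ => ha ((j : ℤ) - l)
    have k2 := abs_sum_weight_mul_le h0 h1 (M - j + 1) (mul_nonneg hc0 hm)
      fun l : ℕ => ha ((j : ℤ) + l)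
    linarith
  refine (abs_sub _ _).trans ?_
  rw [add_mul, abs_mul, mul_assoc |nu α dα h|]
  exact add_le_add (abs_stencil_le _ _ _ hv' j) (mul_le_mul_of_nonneg_left hb (abs_nonneg _))

/-- On a coarse grid the convection and the boundary terms may spoil `spaceOp_avg_form_le`, so the
step is tested with the increment z = x - y and only `spaceOp_form_nonpos` is used. The operator at
the old level is bounded crudely, so K depends on M and h, but not on τ. -/
theorem exists_coarse_le {α d₁ d₂ dα h : ℝ} (h0 : 0 < α) (hα : α ≤ alphaMax) (hd₂ : 0 < d₂)
    (hdα : 0 < dα) (hh : 0 < h) {M : ℕ} (hM : 0 < M) :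
    ∃ K : ℝ, 0 ≤ K ∧ ∀ (τ : ℝ) (f : ℕ → ℝ) (x y : ℤ → ℝ), 0 < τ → ZeroBoundary M x →
      ZeroBoundary M y → IsStep α d₁ d₂ dα τ h M f x y →
      gridNorm 1 M x ≤ (1 + K * τ) * gridNorm 1 M y +
        2 * τ * ∑ j ∈ Finset.Ico 1 M, |f j| := by
  obtain ⟨K, hK, hG⟩ := exists_abs_spaceOp_le h0 (hα.trans_lt alphaMax_lt_one) d₁ d₂ dα h M
  refine ⟨2 * (M * K), by positivity, fun τ f x y hτ hx hy hs => ?_⟩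
  set z : ℤ → ℝ := fun i => x i + (-1) * y i with hzdef
  have hz : ZeroBoundary M z := hx.add (hy.const_mul (-1))
  have k1 : 2 / 3 * gridSq M z ≤ _ := avg_form_ge hM d₁ d₂ h hz
  have k2 := spaceOp_form_nonpos (d₁ := d₁) h0 hα hd₂ hdα hh hM hz
  have k3 := gridNorm_one_mul_sum_le (M := M) f z
  have k4 := gridNorm_one_mul_sum_le (M := M) (fun j => spaceOp α d₁ d₂ dα h M y j) z
  have k5 : ∑ j ∈ Finset.Ico 1 M, |spaceOp α d₁ d₂ dα h M y j| ≤ M * (K * gridNorm 1 M y) := by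
    refine (Finset.sum_le_card_nsmul _ _ _ fun j _ => hG y hy j).trans ?_
    rw [nsmul_eq_mul, Nat.card_Ico]
    refine mul_le_mul_of_nonneg_right (by exact_mod_cast Nat.sub_le _ _)
      (mul_nonneg hK (gridNorm_nonneg _ _ _))
  have hid : 2 / τ * ∑ j ∈ Finset.Ico 1 M, avg d₁ d₂ h z j * z j =
      ∑ j ∈ Finset.Ico 1 M, spaceOp α d₁ d₂ dα h M z j * z j +
      2 * ∑ j ∈ Finset.Ico 1 M, spaceOp α d₁ d₂ dα h M y j * z j +
      2 * ∑ j ∈ Finset.Ico 1 M, f j * z j := by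
    rw [Finset.mul_sum, Finset.mul_sum, Finset.mul_sum, ← Finset.sum_add_distrib,
      ← Finset.sum_add_distrib]
    refine Finset.sum_congr rfl fun j hj => ?_
    have hj' := Finset.mem_Ico.1 hj
    have := hs j hj'.1 hj'.2
    rw [hzdef, spaceOp_add, avg_add, spaceOp_const_mul, avg_const_mul]
    linear_combination (x j - y j) * this
  set n := gridNorm 1 M z with hn
  have hn0 : 0 ≤ n := gridNorm_nonneg _ _ _
  have hn2 : gridSq M z = n * n := by
    rw [← sq, hn, gridNorm_sq zero_le_one, one_mul]
  set Φ := ∑ j ∈ Finset.Ico 1 M, |f j|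
  have hΦ : 0 ≤ Φ := Finset.sum_nonneg fun _ _ => abs_nonneg _
  have hy0 := gridNorm_nonneg 1 M y
  have hb0 : 0 ≤ M * (K * gridNorm 1 M y) + Φ := by positivity
  have hmain : 4 / (3 * τ) * (n * n) ≤ 2 * (M * (K * gridNorm 1 M y) + Φ) * n := by
    have e : 4 / (3 * τ) * (n * n) = 2 / τ * (2 / 3 * gridSq M z) := by rw [hn2]; field_simp; ring
    rw [e]
    refine (mul_le_mul_of_nonneg_left k1 (by positivity)).trans ?_
    rw [hid]
    nlinarith [mul_le_mul_of_nonneg_right k5 hn0]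
  have hn1 : n ≤ 2 * τ * (M * (K * gridNorm 1 M y) + Φ) := by
    rcases hn0.eq_or_lt with h | h
    · rw [← h]; positivity
    · have h2 : 4 / (3 * τ) * n ≤ 2 * (M * (K * gridNorm 1 M y) + Φ) := by
        refine le_of_mul_le_mul_right ?_ h
        linarith
      have h3 : n = 3 * τ / 4 * (4 / (3 * τ) * n) := by field_simp
      rw [h3]
      have := mul_le_mul_of_nonneg_left h2 (by positivity : 0 ≤ 3 * τ / 4)
      nlinarith [mul_nonneg hτ.le hb0]
  have htri := gridNorm_one_le_add M x y
  have hzz : (gridNorm 1 M fun j => x j - y j) = n := by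
    rw [hn, hzdef]; congr 1; funext j; ring
  rw [hzz] at htri
  nlinarith

/-- The new level solves a square linear system in the M - 1 interior values. It is injective
because testing with the solution pairs a positive definite form with a nonpositive one. -/
theorem exists_isStep {α d₁ d₂ dα τ h : ℝ} (h0 : 0 < α) (hα : α ≤ alphaMax) (hd₂ : 0 < d₂)
    (hdα : 0 < dα) (hτ : 0 < τ) (hh : 0 < h) {M : ℕ} (hM : 0 < M) (f : ℕ → ℝ) (y : ℤ → ℝ) :
    ∃ x : ℤ → ℝ, ZeroBoundary M x ∧ IsStep α d₁ d₂ dα τ h M f x y := by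
  let ext : (↥(Finset.Ico 1 M) → ℝ) → ℤ → ℝ := fun v j =>
    if hj : 1 ≤ j ∧ j < M then v ⟨j.toNat, by simp; omega⟩ else 0
  have ext_zero : ∀ v, ZeroBoundary M (ext v) := fun v j hj => dif_neg (by omega)
  have ext_add : ∀ u v, ext (u + v) = fun i => ext u i + ext v i := by
    intro u v; funext j; simp only [ext]; split_ifs <;> simp
  have ext_smul : ∀ (c : ℝ) v, ext (c • v) = fun i => c * ext v i := by
    intro u v; funext j; simp only [ext]; split_ifs <;> simp
  have ext_coe : ∀ v (j : ↥(Finset.Ico 1 M)), ext v ((j : ℕ) : ℤ) = v j := by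
    intro v j
    have := Finset.mem_Ico.1 j.2
    simp only [ext]
    rw [dif_pos (by omega)]
    rfl
  let L : (↥(Finset.Ico 1 M) → ℝ) →ₗ[ℝ] (↥(Finset.Ico 1 M) → ℝ) :=
    { toFun := fun v j => 2 / τ * avg d₁ d₂ h (ext v) (j : ℕ) - spaceOp α d₁ d₂ dα h M (ext v) j
      map_add' := fun u v => by
        funext j
        simp only [ext_add, avg_add, spaceOp_add, Pi.add_apply]
        ring
      map_smul' := fun c v => by
        funext j
        simp only [ext_smul, avg_const_mul, spaceOp_const_mul, Pi.smul_apply, smul_eq_mul,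
          RingHom.id_apply]
        ring }
  have hinj : Function.Injective L := by
    rw [← LinearMap.ker_eq_bot, LinearMap.ker_eq_bot']
    intro v hv
    have k1 : 2 / 3 * gridSq M (ext v) ≤ _ := avg_form_ge hM d₁ d₂ h (ext_zero v)
    have k2 := spaceOp_form_nonpos (d₁ := d₁) h0 hα hd₂ hdα hh hM (ext_zero v)
    have k3 : 2 / τ * ∑ j ∈ Finset.Ico 1 M, avg d₁ d₂ h (ext v) j * ext v j =
        ∑ j ∈ Finset.Ico 1 M, spaceOp α d₁ d₂ dα h M (ext v) j * ext v j := by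
      rw [Finset.mul_sum]
      refine Finset.sum_congr rfl fun j hj => ?_
      have : 2 / τ * avg d₁ d₂ h (ext v) j - spaceOp α d₁ d₂ dα h M (ext v) j = 0 :=
        congrFun hv ⟨j, hj⟩
      linear_combination ext v j * this
    have k4 : gridSq M (ext v) ≤ 0 := by
      have k5 := mul_le_mul_of_nonneg_left k1 (by positivity : 0 ≤ 2 / τ)
      have k6 : 2 / τ * (2 / 3 * gridSq M (ext v)) ≤ 0 := by linarith
      have : 0 < 2 / τ := by positivity
      by_contra hc
      have := mul_pos this (by linarith : 0 < 2 / 3 * gridSq M (ext v))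
      linarith
    have k7 := (Finset.sum_eq_zero_iff_of_nonneg fun _ _ => sq_nonneg _).1
      (le_antisymm k4 (gridSq_nonneg _ _))
    funext j
    have := k7 j j.2
    rw [ext_coe] at this
    exact pow_eq_zero_iff two_ne_zero |>.1 this
  obtain ⟨v, hv⟩ := LinearMap.injective_iff_surjective.1 hinj fun j =>
    2 / τ * avg d₁ d₂ h y (j : ℕ) + spaceOp α d₁ d₂ dα h M y j + 2 * f j
  refine ⟨ext v, ext_zero v, fun j h1 h2 => ?_⟩
  have : 2 / τ * avg d₁ d₂ h (ext v) j - spaceOp α d₁ d₂ dα h M (ext v) j =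
      2 / τ * avg d₁ d₂ h y j + spaceOp α d₁ d₂ dα h M y j + 2 * f j :=
    congrFun hv ⟨j, Finset.mem_Ico.2 ⟨h1, h2⟩⟩
  linear_combination this

end RieszDiffusion
end

/-! ### Stability uniform in all grids. -/

noncomputable section
namespace RieszDiffusion

open Finset Filter Topology

/-- Discrete Gronwall: (1 + Kτ)^k ≤ exp(KT), so the constant does not depend on N. -/
theorem exists_stability_fixed {α d₁ d₂ dα L T : ℝ} (h0 : 0 < α) (hα : α ≤ alphaMax) (hd₂ : 0 < d₂)
    (hdα : 0 < dα) (hL : 0 < L) (hT : 0 < T) {M : ℕ} (hM : 0 < M) :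
    ∃ C : ℝ, 0 ≤ C ∧ ∀ (N : ℕ) (x : ℕ → ℤ → ℝ) (f : ℕ → ℕ → ℝ) (F : ℝ), 0 < N → 0 ≤ F →
      (∀ k ≤ N, ZeroBoundary M (x k)) →
      (∀ k < N, IsStep α d₁ d₂ dα (T / N) (L / M) M (f k) (x (k + 1)) (x k)) →
      (∀ k < N, L / M * ∑ j ∈ Finset.Ico 1 M, |f k j| ≤ F) →
      ∀ k ≤ N, gridNorm (L / M) M (x k) ≤ C * (gridNorm (L / M) M (x 0) + F) := by
  have hMpos : (0 : ℝ) < M := by exact_mod_cast hM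
  have hh : 0 < L / M := by positivity
  set h := L / M
  obtain ⟨K, hK, hstep⟩ := exists_coarse_le (d₁ := d₁) h0 hα hd₂ hdα hh hM
  have hs0 : 0 < Real.sqrt h := Real.sqrt_pos.2 hh
  refine ⟨Real.exp (K * T) * (1 + Real.sqrt h * (2 * T / h)), by positivity,
    fun N x f F hN hF hx hs hf k hk => ?_⟩
  have hNpos : (0 : ℝ) < N := by exact_mod_cast hN
  have hτ : 0 < T / N := by positivity
  set τ := T / N with hτdef
  have hind : ∀ k ≤ N, gridNorm 1 M (x k) ≤
      Real.exp (K * (k * τ)) * (gridNorm 1 M (x 0) + k * (2 * τ * (F / h))) := by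
    intro k
    induction k with
    | zero => simp
    | succ k ih =>
      intro hk
      have h1 := hstep τ (f k) _ _ hτ (hx _ hk) (hx k (by omega)) (hs k (by omega))
      have h2 : ∑ j ∈ Finset.Ico 1 M, |f k j| ≤ F / h := by
        rw [le_div_iff₀ hh, mul_comm]; exact hf k (by omega)
      have h3 := ih (by omega)
      have h4 : 1 + K * τ ≤ Real.exp (K * τ) := by linarith [Real.add_one_le_exp (K * τ)]
      have h5 : (1 : ℝ) ≤ Real.exp (K * ((k + 1 : ℕ) * τ)) := Real.one_le_exp (by positivity)
      have h6 : Real.exp (K * ((k + 1 : ℕ) * τ)) = Real.exp (K * τ) * Real.exp (K * (k * τ)) := by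
        rw [← Real.exp_add]; push_cast; ring_nf
      calc gridNorm 1 M (x (k + 1)) ≤ (1 + K * τ) * gridNorm 1 M (x k) +
            2 * τ * ∑ j ∈ Finset.Ico 1 M, |f k j| := h1
        _ ≤ Real.exp (K * τ) * (Real.exp (K * (k * τ)) *
              (gridNorm 1 M (x 0) + k * (2 * τ * (F / h)))) + 2 * τ * (F / h) := by
            refine add_le_add (mul_le_mul h4 h3 (gridNorm_nonneg _ _ _) (Real.exp_nonneg _)) ?_
            exact mul_le_mul_of_nonneg_left h2 (by positivity)
        _ ≤ Real.exp (K * τ) * (Real.exp (K * (k * τ)) *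
              (gridNorm 1 M (x 0) + k * (2 * τ * (F / h)))) +
              Real.exp (K * ((k + 1 : ℕ) * τ)) * (2 * τ * (F / h)) := by
            have : 0 ≤ 2 * τ * (F / h) := by positivity
            nlinarith
        _ = _ := by rw [h6]; push_cast; ring
  have h1 := hind k hk
  have hkT : k * τ ≤ T := by
    rw [hτdef, ← mul_div_assoc, div_le_iff₀ hNpos, mul_comm]
    exact mul_le_mul_of_nonneg_left (by exact_mod_cast hk) hT.le
  have hn0 := gridNorm_nonneg 1 M (x 0)
  have h2 : gridNorm 1 M (x k) ≤ Real.exp (K * T) * (gridNorm 1 M (x 0) + 2 * T * (F / h)) := by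
    refine h1.trans (mul_le_mul ?_ ?_ (by positivity) (Real.exp_nonneg _))
    · exact Real.exp_le_exp.2 (mul_le_mul_of_nonneg_left hkT hK)
    · have : k * (2 * τ * (F / h)) = (k * τ) * (2 * (F / h)) := by ring
      rw [this]
      have : 0 ≤ 2 * (F / h) := by positivity
      nlinarith
  rw [gridNorm_eq_mul hh.le, gridNorm_eq_mul hh.le M (x 0)]
  have hE := Real.exp_pos (K * T)
  calc Real.sqrt h * gridNorm 1 M (x k) ≤
        Real.sqrt h * (Real.exp (K * T) * (gridNorm 1 M (x 0) + 2 * T * (F / h))) :=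
        mul_le_mul_of_nonneg_left h2 hs0.le
    _ = Real.exp (K * T) * (1 * (Real.sqrt h * gridNorm 1 M (x 0)) +
          (Real.sqrt h * (2 * T / h)) * F) := by ring
    _ ≤ Real.exp (K * T) * ((1 + Real.sqrt h * (2 * T / h)) *
          (Real.sqrt h * gridNorm 1 M (x 0) + F)) := by
        refine mul_le_mul_of_nonneg_left ?_ hE.le
        have : 0 ≤ Real.sqrt h * (2 * T / h) := by positivity
        have : 0 ≤ Real.sqrt h * gridNorm 1 M (x 0) := by positivity
        nlinarith
    _ = _ := by ring

/-- ν h² is of order h^{2-α}, which tends to 0, so both smallness conditions hold from some M₀ on.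
-/
theorem exists_fine_grid {α d₁ d₂ dα L : ℝ} (h0 : 0 < α) (h1 : α < 1) (hd₁ : 0 < d₁)
    (hd₂ : 0 < d₂) (hdα : 0 < dα) (hL : 0 < L) :
    ∃ M₀ : ℕ, 0 < M₀ ∧ ∀ M : ℕ, M₀ ≤ M → d₁ * (L / M) ≤ d₂ ∧
      nu α dα (L / M) * weightSum α ≤ d₂ / (L / M) ^ 2 := by
  have hc := nu_nonneg h0 h1 hdα one_pos
  have hS := weightSum_nonneg α
  obtain ⟨n, hn⟩ := exists_nat_gt (L * (1 + d₁ / d₂ + nu α dα 1 * weightSum α / d₂))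
  have hn0 : (0 : ℝ) < n := lt_of_le_of_lt (by positivity) hn
  refine ⟨n, by exact_mod_cast hn0, fun M hM => ?_⟩
  have hM' : (n : ℝ) ≤ M := by exact_mod_cast hM
  have hMpos : (0 : ℝ) < M := hn0.trans_le hM'
  have hh : 0 < L / M := by positivity
  have key : L / M * (1 + d₁ / d₂ + nu α dα 1 * weightSum α / d₂) ≤ 1 := by
    rw [div_mul_eq_mul_div, div_le_one hMpos]; linarith
  set h := L / M
  have p1 : 0 ≤ h * (d₁ / d₂) := by positivity
  have p2 : 0 ≤ h * (nu α dα 1 * weightSum α / d₂) := by positivity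
  have q0 : h ≤ 1 := by linarith
  have q1 : h * (d₁ / d₂) ≤ 1 := by linarith
  have q2 : h * (nu α dα 1 * weightSum α / d₂) ≤ 1 := by linarith
  rw [← mul_div_assoc, div_le_one hd₂] at q1 q2
  refine ⟨by linarith, ?_⟩
  rw [le_div_iff₀ (by positivity)]
  have e : nu α dα h = nu α dα 1 / h ^ α := by
    rw [nu, nu, Real.one_rpow, mul_one, div_div]
  have hp : h ≤ h ^ α := by
    simpa using Real.rpow_le_rpow_of_exponent_ge hh q0 h1.le
  have hpos : 0 < h ^ α := Real.rpow_pos_of_pos hh α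
  rw [e, div_mul_eq_mul_div, div_mul_eq_mul_div, div_le_iff₀ hpos]
  have := mul_nonneg hc hS
  calc nu α dα 1 * weightSum α * h ^ 2 = (h * (nu α dα 1 * weightSum α)) * h := by ring
    _ ≤ d₂ * h := mul_le_mul_of_nonneg_right q2 hh.le
    _ ≤ d₂ * h ^ α := mul_le_mul_of_nonneg_left hp hd₂.le

theorem stability_of_fine {α d₁ d₂ dα L T : ℝ} (h0 : 0 < α) (hα : α ≤ alphaMax) (hd₁ : 0 < d₁)
    (hd₂ : 0 < d₂) (hdα : 0 < dα) (hL : 0 < L) (hT : 0 < T) {M : ℕ} (hM : 0 < M)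
    (hPe : d₁ * (L / M) ≤ d₂) (hsmall : nu α dα (L / M) * weightSum α ≤ d₂ / (L / M) ^ 2)
    {N : ℕ} {x : ℕ → ℤ → ℝ} {f : ℕ → ℕ → ℝ} {F : ℝ} (hN : 0 < N) (hF : 0 ≤ F)
    (hx : ∀ k ≤ N, ZeroBoundary M (x k))
    (hs : ∀ k < N, IsStep α d₁ d₂ dα (T / N) (L / M) M (f k) (x (k + 1)) (x k))
    (hf : ∀ k < N, L / M * ∑ j ∈ Finset.Ico 1 M, |f k j| ≤ F) :
    ∀ k ≤ N, gridNorm (L / M) M (x k) ≤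
      3 / 2 * (1 + T * (L / d₂)) * (gridNorm (L / M) M (x 0) + F) := by
  have hMpos : (0 : ℝ) < M := by exact_mod_cast hM
  have hNpos : (0 : ℝ) < N := by exact_mod_cast hN
  have hh : 0 < L / M := by positivity
  have hLM : L / M * M ≤ L := by rw [div_mul_cancel₀ _ hMpos.ne']
  set h := L / M
  have hτ : 0 < T / N := by positivity
  set τ := T / N with hτdef
  have hu : d₁ * h / (24 * d₂) ≤ 1 / 24 := by
    rw [div_le_div_iff₀ (by positivity) (by norm_num)]; linarith
  have hu0 : 0 ≤ d₁ * h / (24 * d₂) := by positivity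
  have A1 : 0 ≤ a₁ d₁ d₂ h := by rw [a₁]; linarith
  have A3 : 0 ≤ a₃ d₁ d₂ h := by rw [a₃]; linarith
  have hind : ∀ k ≤ N, h * gridSq M (avg d₁ d₂ h (x k)) ≤
      h * gridSq M (avg d₁ d₂ h (x 0)) + k * (τ * (L / d₂ * F ^ 2)) := by
    intro k
    induction k with
    | zero => simp
    | succ k ih =>
      intro hk
      have h1 := (hs k (by omega)).fine_le h0 hα hd₁ hd₂ hdα hτ hh hPe hsmall hM hLM
        (hf k (by omega)) (hx _ hk) (hx k (by omega))
      have h2 := ih (by omega)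
      push_cast
      linarith
  intro k hk
  have h1 := hind k hk
  have h2 := mul_le_mul_of_nonneg_left (gridSq_le_avg hM d₁ d₂ h (hx k hk)) hh.le
  have h3 := mul_le_mul_of_nonneg_left (gridSq_avg_le hM A1 A3 (hx 0 (Nat.zero_le _))) hh.le
  have hkT : k * τ ≤ T := by
    rw [hτdef, ← mul_div_assoc, div_le_iff₀ hNpos, mul_comm]
    exact mul_le_mul_of_nonneg_left (by exact_mod_cast hk) hT.le
  have hc0 : 0 ≤ L / d₂ := by positivity
  have h4 : k * (τ * (L / d₂ * F ^ 2)) ≤ T * (L / d₂) * F ^ 2 := by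
    have := mul_le_mul_of_nonneg_right hkT (by positivity : 0 ≤ L / d₂ * F ^ 2)
    linarith
  have e1 := gridNorm_sq hh.le M (x k)
  have e2 := gridNorm_sq hh.le M (x 0)
  have hg := gridNorm_nonneg h M (x 0)
  have hC : 0 ≤ T * (L / d₂) := by positivity
  set c := T * (L / d₂)
  refine (pow_le_pow_iff_left₀ (gridNorm_nonneg _ _ _) (by positivity) two_ne_zero).1 ?_
  set n := gridNorm h M (x 0)
  have h5 : gridNorm h M (x k) ^ 2 ≤ 9 / 4 * (n ^ 2 + c * F ^ 2) := by linarith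
  refine h5.trans ?_
  have h6 : (3 / 2 * (1 + c) * (n + F)) ^ 2 - 9 / 4 * (n ^ 2 + c * F ^ 2) =
      9 / 4 * (2 * n * F + F ^ 2 + c * F ^ 2 + 2 * c * n ^ 2 + 4 * c * (n * F)
        + c ^ 2 * (n + F) ^ 2) := by ring
  have : 0 ≤ 9 / 4 * (2 * n * F + F ^ 2 + c * F ^ 2 + 2 * c * n ^ 2 + 4 * c * (n * F)
        + c ^ 2 * (n + F) ^ 2) := by positivity
  linarith

theorem exists_stability {α d₁ d₂ dα L T : ℝ} (h0 : 0 < α) (hα : α ≤ alphaMax) (hd₁ : 0 < d₁)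
    (hd₂ : 0 < d₂) (hdα : 0 < dα) (hL : 0 < L) (hT : 0 < T) :
    ∃ C : ℝ, 0 ≤ C ∧ ∀ (M N : ℕ) (x : ℕ → ℤ → ℝ) (f : ℕ → ℕ → ℝ) (F : ℝ), 0 < M → 0 < N → 0 ≤ F →
      (∀ k ≤ N, ZeroBoundary M (x k)) →
      (∀ k < N, IsStep α d₁ d₂ dα (T / N) (L / M) M (f k) (x (k + 1)) (x k)) →
      (∀ k < N, L / M * ∑ j ∈ Finset.Ico 1 M, |f k j| ≤ F) →
      ∀ k ≤ N, gridNorm (L / M) M (x k) ≤ C * (gridNorm (L / M) M (x 0) + F) := by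
  obtain ⟨M₀, hM₀, hfine⟩ := exists_fine_grid h0 (hα.trans_lt alphaMax_lt_one) hd₁ hd₂ hdα hL
  -- The constant at index m belongs to the grid with M = m + 1. Only the finitely many indices
  -- below M₀ are needed, so their sum serves as a common constant.
  have hcoarse := fun m : ℕ => exists_stability_fixed (d₁ := d₁) h0 hα hd₂ hdα hL hT m.succ_pos
  choose c hc0 hc using hcoarse
  have hsum : 0 ≤ ∑ m ∈ Finset.range M₀, c m := Finset.sum_nonneg fun m _ => hc0 m
  have hC1 : 0 ≤ 3 / 2 * (1 + T * (L / d₂)) := by positivity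
  refine ⟨3 / 2 * (1 + T * (L / d₂)) + ∑ m ∈ Finset.range M₀, c m, by positivity,
    fun M N x f F hM hN hF hx hs hf k hk => ?_⟩
  have hnn : 0 ≤ gridNorm (L / M) M (x 0) + F := add_nonneg (gridNorm_nonneg _ _ _) hF
  by_cases h : M₀ ≤ M
  · refine (stability_of_fine h0 hα hd₁ hd₂ hdα hL hT hM (hfine M h).1 (hfine M h).2 hN hF hx hs hf
      k hk).trans (mul_le_mul_of_nonneg_right (by linarith) hnn)
  · obtain ⟨m, rfl⟩ : ∃ m, M = m + 1 := ⟨M - 1, by omega⟩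
    refine (hc m N x f F hN hF hx hs hf k hk).trans (mul_le_mul_of_nonneg_right ?_ hnn)
    have := Finset.single_le_sum (fun i _ => hc0 i) (Finset.mem_range.2 (by omega : m < M₀))
    linarith

theorem newLevel_sub_oldLevel (d₁ d₂ τ h : ℝ) (u v : ℤ → ℝ) (j : ℤ) :
    newLevel d₁ d₂ τ h u j - oldLevel d₁ d₂ τ h v j =
      2 / τ * (avg d₁ d₂ h u j - avg d₁ d₂ h v j) -
      (stencil (b₁ d₁ d₂ h) (b₂ d₁ d₂ h) (b₃ d₁ d₂ h) u j +
        stencil (b₁ d₁ d₂ h) (b₂ d₁ d₂ h) (b₃ d₁ d₂ h) v j) := by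
  simp only [newLevel, oldLevel, avg, stencil, smul_eq_mul]
  ring

theorem isStep_iff {α d₁ d₂ dα τ h : ℝ} {M : ℕ} {f : ℕ → ℝ} {u v : ℤ → ℝ} :
    IsStep α d₁ d₂ dα τ h M f u v ↔ ∀ j : ℕ, 1 ≤ j → j < M →
      newLevel d₁ d₂ τ h u j + nu α dα h * bracket α d₁ d₂ h M u j =
        oldLevel d₁ d₂ τ h v j - nu α dα h * bracket α d₁ d₂ h M v j + 2 * f j := by
  refine forall_congr' fun j => forall_congr' fun _ => forall_congr' fun _ => ?_
  have := newLevel_sub_oldLevel d₁ d₂ τ h u v j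
  simp only [spaceOp]
  constructor <;> intro h <;> linarith

theorem IsStep.sub {α d₁ d₂ dα τ h : ℝ} {M : ℕ} {f g : ℕ → ℝ} {u v x y : ℤ → ℝ}
    (h1 : IsStep α d₁ d₂ dα τ h M f u v) (h2 : IsStep α d₁ d₂ dα τ h M g x y) :
    IsStep α d₁ d₂ dα τ h M (fun j => f j - g j) (fun j => u j - x j) (fun j => v j - y j) := by
  have e : ∀ p q : ℤ → ℝ, (fun j => p j - q j) = fun j => p j + (-1) * q j := fun p q => by
    funext j; ring
  intro j hj1 hj2
  rw [e u x, e v y, avg_add, avg_add, avg_const_mul, avg_const_mul, spaceOp_add, spaceOp_add,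
    spaceOp_const_mul, spaceOp_const_mul]
  linear_combination h1 j hj1 hj2 - h2 j hj1 hj2

theorem exists_isSchemeSolution {α d₁ d₂ dα τ h : ℝ} (h0 : 0 < α) (hα : α ≤ alphaMax)
    (hd₂ : 0 < d₂) (hdα : 0 < dα) (hτ : 0 < τ) (hh : 0 < h) {M : ℕ} (hM : 0 < M) (N : ℕ)
    (S : ℕ → ℤ → ℝ) {v : ℤ → ℝ} (hv : ZeroBoundary M v) :
    ∃ U : ℕ → ℤ → ℝ, IsSchemeSolution α d₁ d₂ dα τ h M N S U ∧ U 0 = v := by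
  have hstep := fun (k : ℕ) (y : ℤ → ℝ) =>
    exists_isStep (d₁ := d₁) h0 hα hd₂ hdα hτ hh hM (fun j => avg d₁ d₂ h (S k) j) y
  choose g hg1 hg2 using hstep
  let U : ℕ → ℤ → ℝ := fun k => Nat.rec v (fun k y => g k y) k
  refine ⟨U, ⟨fun k _ => ?_, fun k _ => isStep_iff.1 (hg2 k (U k))⟩, rfl⟩
  cases k with
  | zero => exact hv
  | succ k => exact hg1 k (U k)

theorem exists_grid_stability {α d₁ d₂ dα L T : ℝ} (h0 : 0 < α) (hα : α ≤ alphaMax) (hd₁ : 0 < d₁)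
    (hd₂ : 0 < d₂) (hdα : 0 < dα) (hL : 0 < L) (hT : 0 < T) :
    ∃ C : ℝ, ∀ M N : ℕ, 0 < M → 0 < N → ∀ S U V : ℕ → ℤ → ℝ,
      IsSchemeSolution α d₁ d₂ dα (T / N) (L / M) M N S U →
      IsSchemeSolution α d₁ d₂ dα (T / N) (L / M) M N S V →
      ∀ k ≤ N, gridNorm (L / M) M (fun j => U k j - V k j) ≤
        C * gridNorm (L / M) M (fun j => U 0 j - V 0 j) := by
  obtain ⟨C, -, hC⟩ := exists_stability h0 hα hd₁ hd₂ hdα hL hT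
  refine ⟨C, fun M N hM hN S U V hU hV k hk => ?_⟩
  have := hC M N (fun k j => U k j - V k j) (fun _ _ => 0) 0 hM hN le_rfl
    (fun k hk j hj => by simp [hU.1 k hk j hj, hV.1 k hk j hj])
    (fun k hk => by
      simpa using (isStep_iff.2 (hU.2 k hk)).sub (isStep_iff.2 (hV.2 k hk)))
    (fun k _ => by simp) k hk
  simpa using this

end RieszDiffusion
end

noncomputable section
namespace RieszDiffusion

open Finset Filter Topology

/-! Consistency of the compact stencil. -/

/-- Induction by the mean value inequality: the derivative of the remainder is the remainder of one
order less for the shifted sequence. The factorial in the error is given up. -/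
theorem abs_sub_taylor_le {a b B : ℝ} (n : ℕ) : ∀ {f : ℕ → ℝ → ℝ},
    (∀ i < n, ∀ x ∈ Set.Icc a b, HasDerivWithinAt (f i) (f (i + 1) x) (Set.Icc a b) x) →
    (∀ x ∈ Set.Icc a b, |f n x| ≤ B) → ∀ x ∈ Set.Icc a b, ∀ y ∈ Set.Icc a b,
    |f 0 y - ∑ m ∈ Finset.range n, f m x * ((y - x) ^ m / m.factorial)| ≤ B * |y - x| ^ n := by
  induction n with
  | zero => intro f _ hB x _ y hy; simpa using hB y hy
  | succ n ih =>
    intro f hd hB x hx y hy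
    have hB0 : 0 ≤ B := (abs_nonneg _).trans (hB x hx)
    have h1 := ih (f := fun i => f (i + 1)) (fun i hi => hd (i + 1) (by omega)) hB x hx
    have hsub : Set.uIcc x y ⊆ Set.Icc a b := Set.OrdConnected.uIcc_subset Set.ordConnected_Icc hx hy
    let R : ℝ → ℝ := fun z =>
      f 0 z - ∑ m ∈ Finset.range (n + 1), f m x * ((z - x) ^ m / m.factorial)
    have hR : ∀ z ∈ Set.uIcc x y, HasDerivWithinAt R
        (f 1 z - ∑ m ∈ Finset.range n, f (m + 1) x * ((z - x) ^ m / m.factorial))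
        (Set.uIcc x y) z := by
      intro z hz
      refine ((hd 0 (by omega) z (hsub hz)).mono hsub).sub (HasDerivAt.hasDerivWithinAt ?_)
      have e : (fun z => ∑ m ∈ Finset.range (n + 1), f m x * ((z - x) ^ m / m.factorial)) =
          fun z => ∑ m ∈ Finset.range n, f (m + 1) x * ((z - x) ^ (m + 1) / (m + 1).factorial)
            + f 0 x := by
        funext z; rw [Finset.sum_range_succ']; simp
      rw [e]
      refine HasDerivAt.add_const _ (HasDerivAt.fun_sum fun m _ => HasDerivAt.const_mul _ ?_)
      have := (((hasDerivAt_id z).sub_const x).pow (m + 1)).div_const ((m + 1).factorial : ℝ)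
      refine this.congr_deriv ?_
      have hm : (m.factorial : ℝ) ≠ 0 := by positivity
      have hm1 : (m : ℝ) + 1 ≠ 0 := by positivity
      simp only [id, Nat.add_sub_cancel, Nat.factorial_succ, mul_one, Nat.cast_mul]
      push_cast
      field_simp
    have hbd : ∀ z ∈ Set.uIcc x y,
        ‖f 1 z - ∑ m ∈ Finset.range n, f (m + 1) x * ((z - x) ^ m / m.factorial)‖ ≤
          B * |y - x| ^ n := by
      intro z hz
      refine (h1 z (hsub hz)).trans ?_
      have := Set.abs_sub_left_of_mem_uIcc hz
      gcongr
    have h2 := (convex_uIcc x y).norm_image_sub_le_of_norm_hasDerivWithin_le hR hbd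
      Set.left_mem_uIcc Set.right_mem_uIcc
    have hRx : R x = 0 := by
      simp only [R]
      rw [Finset.sum_range_succ']
      simp
    rw [hRx, sub_zero, Real.norm_eq_abs, Real.norm_eq_abs, mul_assoc, ← pow_succ] at h2
    exact h2

/-- `f i`, `i ≤ 6`, are the successive derivatives on `[a, b]` of `f 0`; they are bounded by `B`,
and those of order at most three vanish at both end points. -/
structure IsProfile (a b B : ℝ) (f : ℕ → ℝ → ℝ) : Prop where
  hasDeriv : ∀ i < 6, ∀ x ∈ Set.Icc a b, HasDerivWithinAt (f i) (f (i + 1) x) (Set.Icc a b) x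
  bound : ∀ i ≤ 6, ∀ x ∈ Set.Icc a b, |f i x| ≤ B
  left : ∀ i < 4, f i a = 0
  right : ∀ i < 4, f i b = 0

theorem IsProfile.exists_taylor {a b B : ℝ} {f : ℕ → ℝ → ℝ} (hf : IsProfile a b B f) (i n : ℕ)
    (hin : i + n ≤ 6) {x y : ℝ} (hx : x ∈ Set.Icc a b) (hy : y ∈ Set.Icc a b) (hxy : x ≠ y) :
    ∃ r : ℝ, |r| ≤ B ∧
      f i y = ∑ m ∈ Finset.range n, f (i + m) x * ((y - x) ^ m / m.factorial) + r * |y - x| ^ n := by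
  have h := abs_sub_taylor_le n (f := fun m => f (i + m)) (fun m hm => hf.hasDeriv (i + m) (by omega))
    (hf.bound (i + n) hin) x hx y hy
  have hp : 0 < |y - x| ^ n := pow_pos (abs_pos.2 (sub_ne_zero.2 hxy.symm)) n
  refine ⟨(f i y - ∑ m ∈ Finset.range n, f (i + m) x * ((y - x) ^ m / m.factorial)) / |y - x| ^ n,
    ?_, ?_⟩
  · rw [abs_div, abs_of_pos hp, div_le_iff₀ hp]
    exact h
  · rw [div_mul_cancel₀ _ hp.ne']
    ring

/-- The coefficients make the compact stencil exact up to fourth order for -d₁f' + d₂f''. What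
remains are terms in f⁗ and the fifth derivative at x and six Taylor remainders. -/
theorem abs_compact_residual_le {a b B d₁ d₂ h L : ℝ} {f : ℕ → ℝ → ℝ} (hf : IsProfile a b B f)
    (hd₁ : 0 < d₁) (hd₂ : 0 < d₂) (hh : 0 < h) (hL : h ≤ L) {x : ℝ} (hx : x ∈ Set.Icc a b)
    (hxm : x - h ∈ Set.Icc a b) (hxp : x + h ∈ Set.Icc a b) :
    |(b₁ d₁ d₂ h * f 0 (x - h) + b₂ d₁ d₂ h * f 0 x + b₃ d₁ d₂ h * f 0 (x + h)) -
      (a₁ d₁ d₂ h * (d₂ * f 2 (x - h) - d₁ * f 1 (x - h)) + a₂ * (d₂ * f 2 x - d₁ * f 1 x) +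
        a₃ d₁ d₂ h * (d₂ * f 2 (x + h) - d₁ * f 1 (x + h)))| ≤
      (d₁ ^ 2 / d₂ + d₁ + 2 * (d₂ + d₁ ^ 2 * L ^ 2 / d₂ + d₁ * L) +
        2 * (d₂ + d₁) * (1 + d₁ * L / d₂)) * B * h ^ 4 := by
  have hB0 : 0 ≤ B := (abs_nonneg _).trans (hf.bound 0 (by norm_num) x hx)
  have em : |x - h - x| = h := by rw [show x - h - x = -h by ring, abs_neg, abs_of_pos hh]
  have ep : |x + h - x| = h := by rw [show x + h - x = h by ring, abs_of_pos hh]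
  have nm : x ≠ x - h := by intro e; linarith
  have np : x ≠ x + h := by intro e; linarith
  obtain ⟨rm, hrm, e1⟩ := hf.exists_taylor 0 6 (by norm_num) hx hxm nm
  obtain ⟨rp, hrp, e2⟩ := hf.exists_taylor 0 6 (by norm_num) hx hxp np
  obtain ⟨pm, hpm, e3⟩ := hf.exists_taylor 1 4 (by norm_num) hx hxm nm
  obtain ⟨pp, hpp, e4⟩ := hf.exists_taylor 1 4 (by norm_num) hx hxp np
  obtain ⟨qm, hqm, e5⟩ := hf.exists_taylor 2 4 (by norm_num) hx hxm nm
  obtain ⟨qp, hqp, e6⟩ := hf.exists_taylor 2 4 (by norm_num) hx hxp np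
  rw [em, show x - h - x = -h by ring] at e1 e3 e5
  rw [ep, show x + h - x = h by ring] at e2 e4 e6
  simp only [Finset.sum_range_succ, Finset.sum_range_zero, Nat.factorial, zero_add] at e1 e2 e3 e4 e5 e6
  norm_num at e1 e2 e3 e4 e5 e6
  have hf4 := hf.bound 4 (by norm_num) x hx
  have hf5 := hf.bound 5 (by norm_num) x hx
  have key : (b₁ d₁ d₂ h * f 0 (x - h) + b₂ d₁ d₂ h * f 0 x + b₃ d₁ d₂ h * f 0 (x + h)) -
      (a₁ d₁ d₂ h * (d₂ * f 2 (x - h) - d₁ * f 1 (x - h)) + a₂ * (d₂ * f 2 x - d₁ * f 1 x) +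
        a₃ d₁ d₂ h * (d₂ * f 2 (x + h) - d₁ * f 1 (x + h))) =
      ((-(d₁ ^ 2 / d₂) / 144) * f 4 x + (d₁ / 180) * f 5 x
        + (d₂ + d₁ ^ 2 * h ^ 2 / d₂ / 12 - d₁ * h / 2) * rp
        + (d₂ + d₁ ^ 2 * h ^ 2 / d₂ / 12 + d₁ * h / 2) * rm
        + d₂ * (-1 / 12 + d₁ * h / d₂ / 24) * qp + d₂ * (-1 / 12 - d₁ * h / d₂ / 24) * qm
        + -d₁ * (-1 / 12 + d₁ * h / d₂ / 24) * pp + -d₁ * (-1 / 12 - d₁ * h / d₂ / 24) * pm)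
        * h ^ 4 := by
    rw [e1, e2, e3, e4, e5, e6, a₁, a₂, a₃, b₁, b₂, b₃]
    field_simp
    ring
  rw [key, abs_mul, abs_of_pos (by positivity : 0 < h ^ 4)]
  refine mul_le_mul_of_nonneg_right ?_ (by positivity)
  have hb : ∀ {c C v : ℝ}, |c| ≤ C → |v| ≤ B → |c * v| ≤ C * B := fun hc hv => by
    rw [abs_mul]; exact mul_le_mul hc hv (abs_nonneg _) ((abs_nonneg _).trans hc)
  have g1 : 0 ≤ d₁ ^ 2 / d₂ := by positivity
  have g2 : 0 ≤ d₁ ^ 2 * h ^ 2 / d₂ := by positivity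
  have g3 : d₁ ^ 2 * h ^ 2 / d₂ ≤ d₁ ^ 2 * L ^ 2 / d₂ := by gcongr
  have g4 : 0 ≤ d₁ * h := by positivity
  have g5 : d₁ * h ≤ d₁ * L := by gcongr
  have g6 : 0 ≤ d₁ * h / d₂ := by positivity
  have g7 : d₁ * h / d₂ ≤ d₁ * L / d₂ := by gcongr
  have k1 := hb (c := -(d₁ ^ 2 / d₂) / 144) (C := d₁ ^ 2 / d₂) (abs_le.2 ⟨by linarith, by linarith⟩) hf4
  have k2 := hb (c := d₁ / 180) (C := d₁) (abs_le.2 ⟨by linarith, by linarith⟩) hf5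
  have k3 := hb (c := d₂ + d₁ ^ 2 * h ^ 2 / d₂ / 12 - d₁ * h / 2)
    (C := d₂ + d₁ ^ 2 * L ^ 2 / d₂ + d₁ * L) (abs_le.2 ⟨by linarith, by linarith⟩) hrp
  have k4 := hb (c := d₂ + d₁ ^ 2 * h ^ 2 / d₂ / 12 + d₁ * h / 2)
    (C := d₂ + d₁ ^ 2 * L ^ 2 / d₂ + d₁ * L) (abs_le.2 ⟨by linarith, by linarith⟩) hrm
  have c1 : |-1 / 12 + d₁ * h / d₂ / 24| ≤ 1 + d₁ * L / d₂ := abs_le.2 ⟨by linarith, by linarith⟩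
  have c2 : |-1 / 12 - d₁ * h / d₂ / 24| ≤ 1 + d₁ * L / d₂ := abs_le.2 ⟨by linarith, by linarith⟩
  have hc : ∀ {c d C D : ℝ}, |d| ≤ D → |c| ≤ C → |d * c| ≤ D * C := fun hd hc => by
    rw [abs_mul]; exact mul_le_mul hd hc (abs_nonneg _) ((abs_nonneg _).trans hd)
  have d2 : |d₂| ≤ d₂ := (abs_of_pos hd₂).le
  have d1 : |-d₁| ≤ d₁ := by rw [abs_neg, abs_of_pos hd₁]
  have k5 := hb (hc d2 c1) hqp
  have k6 := hb (hc d2 c2) hqm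
  have k7 := hb (hc d1 c1) hpp
  have k8 := hb (hc d1 c2) hpm
  rw [abs_le] at k1 k2 k3 k4 k5 k6 k7 k8 ⊢
  constructor <;> linarith

end RieszDiffusion
end

noncomputable section
namespace RieszDiffusion

open Finset Filter Topology

/-! The Riesz derivative of a function that vanishes to third order at the end points. -/

theorem hasDerivAt_max_rpow {p : ℝ} (hp : 1 < p) (t : ℝ) :
    HasDerivAt (fun t : ℝ => max t 0 ^ p) (p * max t 0 ^ (p - 1)) t := by
  have hp0 : p ≠ 0 := by linarith
  have hp1 : p - 1 ≠ 0 := by linarith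
  rcases lt_trichotomy t 0 with h | rfl | h
  · rw [max_eq_right h.le, Real.zero_rpow hp1, mul_zero]
    refine (hasDerivAt_const t (0 : ℝ)).congr_of_eventuallyEq ?_
    filter_upwards [eventually_lt_nhds h] with s hs
    rw [max_eq_right hs.le, Real.zero_rpow hp0]
  · rw [max_self, Real.zero_rpow hp1, mul_zero, ← hasDerivWithinAt_univ, ← Set.Iic_union_Ici (a := 0)]
    refine HasDerivWithinAt.union ?_ ?_
    · refine (hasDerivWithinAt_const (0 : ℝ) _ (0 : ℝ)).congr (fun s hs => ?_) ?_
      · rw [max_eq_right hs, Real.zero_rpow hp0]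
      · rw [max_self, Real.zero_rpow hp0]
    · have h := (Real.hasDerivAt_rpow_const (x := 0) (p := p) (Or.inr hp.le)).hasDerivWithinAt
        (s := Set.Ici 0)
      rw [Real.zero_rpow hp1, mul_zero] at h
      exact h.congr (fun s hs => by rw [max_eq_left hs]) (by rw [max_self])
  · rw [max_eq_left h.le]
    refine (Real.hasDerivAt_rpow_const (p := p) (Or.inl h.ne')).congr_of_eventuallyEq ?_
    filter_upwards [eventually_gt_nhds h] with s hs
    rw [max_eq_left hs.le]

theorem continuous_max_rpow {p : ℝ} (hp : 0 ≤ p) : Continuous fun t : ℝ => max t 0 ^ p :=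
  (continuous_id.max continuous_const).rpow_const fun _ => Or.inr hp

/-- Truncated powers allow a fixed interval of integration, so the derivative can be taken under the
integral sign without a moving end point. -/
theorem hasDerivAt_integral_max_rpow {p : ℝ} (hp : 1 < p) {a b : ℝ} (hab : a ≤ b) {g : ℝ → ℝ}
    (hg : ContinuousOn g (Set.Icc a b)) (x : ℝ) :
    HasDerivAt (fun z => ∫ y in a..b, max (z - y) 0 ^ p * g y)
      (∫ y in a..b, p * max (x - y) 0 ^ (p - 1) * g y) x := by
  have hg' : ContinuousOn g (Set.uIcc a b) := by rwa [Set.uIcc_of_le hab]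
  have hc : ∀ z : ℝ, ContinuousOn (fun y => max (z - y) 0 ^ p * g y) (Set.uIcc a b) := fun z =>
    ((continuous_max_rpow (by linarith : 0 ≤ p)).comp (continuous_sub_left z)).continuousOn.mul hg'
  have hc' : ContinuousOn (fun y => p * max (x - y) 0 ^ (p - 1) * g y) (Set.uIcc a b) :=
    (((continuous_max_rpow (by linarith : 0 ≤ p - 1)).comp
      (continuous_sub_left x)).const_mul p).continuousOn.mul hg'
  have hbd : ContinuousOn (fun y => p * (|x| + 1 + |y|) ^ (p - 1) * |g y|) (Set.uIcc a b) := by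
    refine ContinuousOn.mul (Continuous.continuousOn ?_) hg'.abs
    exact ((by fun_prop : Continuous fun y : ℝ => |x| + 1 + |y|).rpow_const
      fun _ => Or.inr (by linarith)).const_mul p
  refine (intervalIntegral.hasDerivAt_integral_of_dominated_loc_of_deriv_le
    (F' := fun z y => p * max (z - y) 0 ^ (p - 1) * g y)
    (bound := fun y => p * (|x| + 1 + |y|) ^ (p - 1) * |g y|)
    (Metric.ball_mem_nhds x one_pos) ?_ ((hc x).intervalIntegrable) ?_ ?_
    hbd.intervalIntegrable ?_).2
  · exact Filter.Eventually.of_forall fun z => by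
      rw [Set.uIoc_of_le hab]
      exact ((hc z).intervalIntegrable (μ := MeasureTheory.volume)).aestronglyMeasurable
  · rw [Set.uIoc_of_le hab]
    exact (hc'.intervalIntegrable (μ := MeasureTheory.volume)).aestronglyMeasurable
  · refine Filter.Eventually.of_forall fun y _ z hz => ?_
    have hz' : |z - x| < 1 := by rwa [Metric.mem_ball, Real.dist_eq] at hz
    have h1 : max (z - y) 0 ≤ |x| + 1 + |y| := by
      refine max_le ?_ (by positivity)
      have := abs_le.1 hz'.le
      have := le_abs_self x
      have := neg_abs_le y
      linarith
    rw [norm_mul, norm_mul, Real.norm_eq_abs, Real.norm_eq_abs, Real.norm_eq_abs,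
      abs_of_pos (by linarith : 0 < p), abs_of_nonneg (Real.rpow_nonneg (le_max_right _ _) _)]
    have h2 := Real.rpow_le_rpow (le_max_right _ _) h1 (by linarith : 0 ≤ p - 1)
    have : 0 ≤ p := by linarith
    gcongr
  · refine Filter.Eventually.of_forall fun y _ z _ => ?_
    have h := (hasDerivAt_max_rpow hp (z - y)).comp z ((hasDerivAt_id z).sub_const y)
    rw [mul_one] at h
    exact h.mul_const (g y)

theorem integral_max_rpow_eq {q : ℝ} (hq : 0 < q) {a b z : ℝ} (hz : z ∈ Set.Icc a b) {g : ℝ → ℝ}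
    (hg : ContinuousOn g (Set.Icc a b)) :
    ∫ y in a..b, max (z - y) 0 ^ q * g y = ∫ y in a..z, (z - y) ^ q * g y := by
  have hc : ContinuousOn (fun y => max (z - y) 0 ^ q * g y) (Set.Icc a b) :=
    ((continuous_max_rpow hq.le).comp (continuous_sub_left z)).continuousOn.mul hg
  have i1 : IntervalIntegrable (fun y => max (z - y) 0 ^ q * g y) MeasureTheory.volume a z :=
    (hc.mono (by rw [Set.uIcc_of_le hz.1]; exact Set.Icc_subset_Icc_right hz.2)).intervalIntegrable
  have i2 : IntervalIntegrable (fun y => max (z - y) 0 ^ q * g y) MeasureTheory.volume z b :=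
    (hc.mono (by rw [Set.uIcc_of_le hz.2]; exact Set.Icc_subset_Icc_left hz.1)).intervalIntegrable
  have e2 : ∫ y in z..b, max (z - y) 0 ^ q * g y = 0 := by
    rw [intervalIntegral.integral_congr (g := fun _ => (0 : ℝ)), intervalIntegral.integral_zero]
    intro y hy
    rw [Set.uIcc_of_le hz.2] at hy
    simp only
    rw [max_eq_right (by linarith [hy.1]), Real.zero_rpow hq.ne', zero_mul]
  rw [← intervalIntegral.integral_add_adjacent_intervals i1 i2, e2, add_zero]
  refine intervalIntegral.integral_congr fun y hy => ?_
  rw [Set.uIcc_of_le hz.1] at hy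
  rw [max_eq_left (by linarith [hy.2])]

theorem integral_rpow_mul_by_parts {β : ℝ} (hβ : 0 < β) {a b z : ℝ} (hz : z ∈ Set.Icc a b)
    {g g' : ℝ → ℝ} (hg : ∀ y ∈ Set.Icc a b, HasDerivWithinAt g (g' y) (Set.Icc a b) y)
    (hg' : ContinuousOn g' (Set.Icc a b)) :
    ∫ y in a..z, (z - y) ^ (β - 1) * g y =
      1 / β * (g a * (z - a) ^ β + ∫ y in a..z, (z - y) ^ β * g' y) := by
  have hsub : Set.uIcc a z ⊆ Set.Icc a b := by
    rw [Set.uIcc_of_le hz.1]; exact Set.Icc_subset_Icc_right hz.2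
  have hi : IntervalIntegrable (fun y => (z - y) ^ (β - 1)) MeasureTheory.volume a z := by
    have h := (intervalIntegral.intervalIntegrable_rpow' (a := z - a) (b := 0)
      (by linarith : -1 < β - 1)).comp_sub_left z
    simpa using h
  have h := intervalIntegral.integral_mul_deriv_eq_deriv_mul_of_hasDerivAt (a := a) (b := z)
    (u := g) (u' := g') (v := fun y => -(1 / β * (z - y) ^ β)) (v' := fun y => (z - y) ^ (β - 1))
    (fun y hy => ((hg y (hsub hy)).continuousWithinAt).mono hsub)
    (Continuous.continuousOn ((((continuous_sub_left z).rpow_const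
      fun _ => Or.inr hβ.le).const_mul _).neg))
    (fun y hy => by
      rw [min_eq_left hz.1, max_eq_right hz.1] at hy
      exact (hg y ⟨hy.1.le, hy.2.le.trans hz.2⟩).hasDerivAt
        (Icc_mem_nhds hy.1 (hy.2.trans_le hz.2)))
    (fun y hy => by
      rw [min_eq_left hz.1, max_eq_right hz.1] at hy
      have h1 := (Real.hasDerivAt_rpow_const (x := z - y) (p := β)
        (Or.inl (by linarith [hy.2]))).comp y ((hasDerivAt_id y).const_sub z)
      refine ((h1.const_mul (1 / β)).neg).congr_deriv ?_
      field_simp)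
    (hg'.mono hsub).intervalIntegrable hi
  have e1 : ∫ y in a..z, (z - y) ^ (β - 1) * g y = ∫ y in a..z, g y * (z - y) ^ (β - 1) :=
    intervalIntegral.integral_congr fun y _ => mul_comm _ _
  have e2 : ∫ y in a..z, g' y * -(1 / β * (z - y) ^ β) =
      -(1 / β * ∫ y in a..z, (z - y) ^ β * g' y) := by
    rw [← intervalIntegral.integral_const_mul, ← intervalIntegral.integral_neg]
    exact intervalIntegral.integral_congr fun y _ => by ring
  rw [e1, h, e2, sub_self, Real.zero_rpow hβ.ne']
  ring

theorem IsProfile.continuousOn {a b B : ℝ} {f : ℕ → ℝ → ℝ} (hf : IsProfile a b B f) {i : ℕ}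
    (hi : i < 6) : ContinuousOn (f i) (Set.Icc a b) :=
  fun x hx => (hf.hasDeriv i hi x hx).continuousWithinAt

theorem IsProfile.integral_rpow_mul {a b B : ℝ} {f : ℕ → ℝ → ℝ} (hf : IsProfile a b B f) {β : ℝ}
    (hβ : 0 < β) {z : ℝ} (hz : z ∈ Set.Icc a b) {i : ℕ} (hi : i < 4) :
    ∫ y in a..z, (z - y) ^ (β - 1) * f i y = 1 / β * ∫ y in a..z, (z - y) ^ β * f (i + 1) y := by
  rw [integral_rpow_mul_by_parts hβ hz (hf.hasDeriv i (by omega)) (hf.continuousOn (by omega)),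
    hf.left i hi, zero_mul, zero_add]

theorem IsProfile.integral_rpow_mul_zero {a b B : ℝ} {f : ℕ → ℝ → ℝ} (hf : IsProfile a b B f)
    {β : ℝ} (hβ : 0 < β) {z : ℝ} (hz : z ∈ Set.Icc a b) :
    ∫ y in a..z, (z - y) ^ (β - 1) * f 0 y =
      1 / (β * (β + 1) * (β + 2) * (β + 3)) * ∫ y in a..z, (z - y) ^ (β + 3) * f 4 y := by
  have h1 := hf.integral_rpow_mul hβ hz (i := 0) (by norm_num)
  have h2 := hf.integral_rpow_mul (by linarith : 0 < β + 1) hz (i := 1) (by norm_num)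
  have h3 := hf.integral_rpow_mul (by linarith : 0 < β + 2) hz (i := 2) (by norm_num)
  have h4 := hf.integral_rpow_mul (by linarith : 0 < β + 3) hz (i := 3) (by norm_num)
  rw [show β + 1 - 1 = β by ring] at h2
  rw [show β + 2 - 1 = β + 1 by ring] at h3
  rw [show β + 3 - 1 = β + 2 by ring] at h4
  simp only [zero_add, Nat.reduceAdd] at h1 h2 h3 h4
  rw [h1, h2, h3, h4]
  field_simp

/-- Integration by parts down to the fifth derivative. The fourth derivative need not vanish at the
end point, hence the extra boundary term. -/
theorem IsProfile.eq_integral {a b B : ℝ} {f : ℕ → ℝ → ℝ} (hf : IsProfile a b B f) {z : ℝ}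
    (hz : z ∈ Set.Icc a b) :
    f 0 z = 1 / 24 * (f 4 a * (z - a) ^ 4 + ∫ y in a..z, (z - y) ^ 4 * f 5 y) := by
  have h1 := hf.integral_rpow_mul (by norm_num : (0 : ℝ) < 1) hz (i := 1) (by norm_num)
  have h2 := hf.integral_rpow_mul (by norm_num : (0 : ℝ) < 2) hz (i := 2) (by norm_num)
  have h3 := hf.integral_rpow_mul (by norm_num : (0 : ℝ) < 3) hz (i := 3) (by norm_num)
  have h4 := integral_rpow_mul_by_parts (by norm_num : (0 : ℝ) < 4) hz
    (hf.hasDeriv 4 (by norm_num)) (hf.continuousOn (i := 5) (by norm_num))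
  have hsub : Set.Icc a z ⊆ Set.Icc a b := Set.Icc_subset_Icc_right hz.2
  have h0 : ∫ y in a..z, f 1 y = f 0 z - f 0 a := by
    refine intervalIntegral.integral_eq_sub_of_hasDerivAt_of_le hz.1
      ((hf.continuousOn (i := 0) (by norm_num)).mono hsub) (fun y hy => ?_) ?_
    · exact (hf.hasDeriv 0 (by norm_num) y (hsub ⟨hy.1.le, hy.2.le⟩)).hasDerivAt
        (Icc_mem_nhds hy.1 (hy.2.trans_le hz.2))
    · refine ((hf.continuousOn (i := 1) (by norm_num)).mono ?_).intervalIntegrable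
      rwa [Set.uIcc_of_le hz.1]
  norm_num at h1 h2 h3 h4
  rw [hf.left 0 (by norm_num), sub_zero] at h0
  rw [← h0, h1, h2, h3, h4]
  ring

/-- The left Riemann-Liouville derivative of a function with fourth derivative `g`. -/
def leftInt (a b α : ℝ) (g : ℝ → ℝ) (x : ℝ) : ℝ :=
  1 / Real.Gamma (4 - α) * ∫ y in a..b, max (x - y) 0 ^ (3 - α) * g y

/-- The right Riemann-Liouville derivative of a function with fourth derivative `g`. -/
def rightInt (a b α : ℝ) (g : ℝ → ℝ) (x : ℝ) : ℝ :=
  1 / Real.Gamma (4 - α) * ∫ y in a..b, max (y - x) 0 ^ (3 - α) * g y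

theorem rightInt_eq (a b α : ℝ) (g : ℝ → ℝ) (x : ℝ) :
    rightInt a b α g x = leftInt a b α (fun y => g (a + b - y)) (a + b - x) := by
  rw [rightInt, leftInt]
  congr 1
  have h := intervalIntegral.integral_comp_sub_left (a := a) (b := b)
    (fun y => max (y - x) 0 ^ (3 - α) * g y) (a + b)
  rw [show a + b - b = a by ring, show a + b - a = b by ring] at h
  rw [← h]
  exact intervalIntegral.integral_congr fun y _ => by ring_nf

/-- Four integrations by parts, free of boundary terms, replace the singular kernel (z-y)^{-α} by a
multiple of (z-y)^{4-α}, which can be differentiated classically. The Gamma recurrence collects the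
factors. -/
theorem IsProfile.leftRL_eq {a b B α : ℝ} {f : ℕ → ℝ → ℝ} (hf : IsProfile a b B f)
    (h1 : α < 1) {x : ℝ} (hx : x ∈ Set.Ioo a b) :
    leftRL a α (f 0) x = leftInt a b α (f 4) x := by
  have hab : a ≤ b := (hx.1.trans hx.2).le
  have hc := hf.continuousOn (i := 4) (by norm_num)
  have hd := (hasDerivAt_integral_max_rpow (by linarith : 1 < 4 - α) hab hc x).const_mul
    (1 / ((1 - α) * (2 - α) * (3 - α) * (4 - α)))
  have he : (fun z => ∫ y in a..z, (z - y) ^ (-α) * f 0 y) =ᶠ[𝓝 x] fun z =>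
      1 / ((1 - α) * (2 - α) * (3 - α) * (4 - α)) * ∫ y in a..b, max (z - y) 0 ^ (4 - α) * f 4 y := by
    filter_upwards [Icc_mem_nhds hx.1 hx.2] with z hz
    have h := hf.integral_rpow_mul_zero (by linarith : 0 < 1 - α) hz
    rw [show 1 - α - 1 = -α by ring, show 1 - α + 3 = 4 - α by ring,
      show 1 - α + 1 = 2 - α by ring, show 1 - α + 2 = 3 - α by ring] at h
    rw [h, integral_max_rpow_eq (by linarith : 0 < 4 - α) hz hc]
  have g1 := Real.Gamma_add_one (s := 1 - α) (by linarith)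
  have g2 := Real.Gamma_add_one (s := 2 - α) (by linarith)
  have g3 := Real.Gamma_add_one (s := 3 - α) (by linarith)
  rw [show 1 - α + 1 = 2 - α by ring] at g1
  rw [show 2 - α + 1 = 3 - α by ring] at g2
  rw [show 3 - α + 1 = 4 - α by ring] at g3
  have hG := (Real.Gamma_pos_of_pos (by linarith : 0 < 1 - α)).ne'
  have n1 : 1 - α ≠ 0 := by linarith
  have n2 : 2 - α ≠ 0 := by linarith
  have n3 : 3 - α ≠ 0 := by linarith
  have n4 : 4 - α ≠ 0 := by linarith
  rw [leftRL, he.deriv_eq, hd.deriv, leftInt, g3, g2, g1]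
  simp only [mul_assoc (4 - α)]
  rw [intervalIntegral.integral_const_mul, show 4 - α - 1 = 3 - α by ring]
  field_simp

/-- The reflection y ↦ a + b - y exchanges the end points, so every statement about the right
derivative follows from the left one. -/
theorem rightRL_eq (a b α : ℝ) (f : ℝ → ℝ) (x : ℝ) :
    rightRL b α f x = leftRL a α (fun y => f (a + b - y)) (a + b - x) := by
  have e : (fun z => ∫ y in z..b, (y - z) ^ (-α) * f y) =
      fun z => (fun w => ∫ y in a..w, (w - y) ^ (-α) * f (a + b - y)) (a + b - z) := by
    funext z
    have h := intervalIntegral.integral_comp_sub_left (a := a) (b := a + b - z)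
      (fun y => (y - z) ^ (-α) * f y) (a + b)
    rw [show a + b - (a + b - z) = z by ring, show a + b - a = b by ring] at h
    rw [← h]
    exact intervalIntegral.integral_congr fun y _ => by ring_nf
  rw [rightRL, leftRL, e,
    deriv_comp_const_sub (fun w => ∫ y in a..w, (w - y) ^ (-α) * f (a + b - y)) (a + b) x]
  ring

theorem IsProfile.reflect {a b B : ℝ} {f : ℕ → ℝ → ℝ} (hf : IsProfile a b B f) :
    IsProfile a b B fun i y => (-1) ^ i * f i (a + b - y) := by
  have hm : ∀ x ∈ Set.Icc a b, a + b - x ∈ Set.Icc a b := fun x hx =>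
    ⟨by linarith [hx.2], by linarith [hx.1]⟩
  refine ⟨fun i hi x hx => ?_, fun i hi x hx => ?_, fun i hi => ?_, fun i hi => ?_⟩
  · have h := (hf.hasDeriv i hi _ (hm x hx)).scomp x
      ((hasDerivAt_id x).const_sub (a + b)).hasDerivWithinAt hm
    refine (h.const_mul ((-1) ^ i)).congr_deriv ?_
    simp only [smul_eq_mul]
    ring
  · rw [abs_mul, abs_pow, abs_neg, abs_one, one_pow, one_mul]
    exact hf.bound i hi _ (hm x hx)
  · simp [hf.right i hi]
  · simp [hf.left i hi]

theorem IsProfile.rightRL_eq {a b B α : ℝ} {f : ℕ → ℝ → ℝ} (hf : IsProfile a b B f)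
    (h1 : α < 1) {x : ℝ} (hx : x ∈ Set.Ioo a b) :
    rightRL b α (f 0) x = rightInt a b α (f 4) x := by
  have h := hf.reflect.leftRL_eq h1 (x := a + b - x) ⟨by linarith [hx.2], by linarith [hx.1]⟩
  rw [RieszDiffusion.rightRL_eq a, rightInt_eq]
  simpa [(by norm_num : (-1 : ℝ) ^ 4 = 1)] using h

theorem continuous_leftInt {a b α : ℝ} (hab : a ≤ b) (h1 : α < 1) {g : ℝ → ℝ}
    (hg : ContinuousOn g (Set.Icc a b)) : Continuous (leftInt a b α g) :=
  continuous_const.mul (continuous_iff_continuousAt.2 fun x =>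
    (hasDerivAt_integral_max_rpow (by linarith : 1 < 3 - α) hab hg x).continuousAt)

theorem continuous_rightInt {a b α : ℝ} (hab : a ≤ b) (h1 : α < 1) {g : ℝ → ℝ}
    (hg : ContinuousOn g (Set.Icc a b)) : Continuous (rightInt a b α g) := by
  have e : rightInt a b α g = fun x => leftInt a b α (fun y => g (a + b - y)) (a + b - x) :=
    funext fun x => rightInt_eq a b α g x
  rw [e]
  refine (continuous_leftInt hab h1 ?_).comp (continuous_sub_left _)
  exact hg.comp (continuous_sub_left _).continuousOn fun y hy =>
    ⟨by linarith [hy.2], by linarith [hy.1]⟩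

end RieszDiffusion
end

noncomputable section
namespace RieszDiffusion

open Finset Filter Topology

/-! Consistency of the weights. -/

theorem integral_max_pow_eq {a b z : ℝ} (hz : z ∈ Set.Icc a b) {g : ℝ → ℝ}
    (hg : ContinuousOn g (Set.Icc a b)) :
    ∫ y in a..b, max (z - y) 0 ^ 4 * g y = ∫ y in a..z, (z - y) ^ 4 * g y := by
  have h := integral_max_rpow_eq (q := 4) (by norm_num) hz hg
  simpa only [Real.rpow_ofNat] using h

/-- The error of the weighted sum for the function `max (r - ·) 0 ^ 4 / 24`. -/
def stepKernel (α h : ℝ) (n : ℕ) (r : ℝ) : ℝ :=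
  h ^ (-α) * ∑ l ∈ Finset.range (n + 1), weight α l * (max (r - l * h) 0 ^ 4 / 24)
    - r ^ (4 - α) / Real.Gamma (5 - α)

theorem stepKernel_eq {α h : ℝ} (hh : 0 < h) (n : ℕ) {r : ℝ} (hr : 0 ≤ r) :
    stepKernel α h n r = h ^ (4 - α) * peanoKernel α n (r / h) := by
  have e : ∀ l : ℕ, max (r - l * h) 0 = h * max (r / h - l) 0 := fun l => by
    rw [mul_max_of_nonneg _ _ hh.le, mul_sub, mul_div_cancel₀ _ hh.ne', mul_zero, mul_comm h]
  have e1 : h ^ (-α) * h ^ 4 = h ^ (4 - α) := by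
    rw [← Real.rpow_ofNat, ← Real.rpow_add hh]; ring_nf
  have e2 : r ^ (4 - α) = h ^ (4 - α) * (r / h) ^ (4 - α) := by
    rw [← Real.mul_rpow hh.le (by positivity), mul_div_cancel₀ _ hh.ne']
  rw [stepKernel, peanoKernel, e2, ← e1, mul_sub, Finset.mul_sum, Finset.mul_sum]
  congr 1
  · refine Finset.sum_congr rfl fun l _ => ?_
    rw [e]; ring
  · ring

/-- Homogeneity: h^{4-α}(r/h)^{-α} = h⁴ r^{-α}. -/
theorem abs_stepKernel_le {α h C : ℝ} (hh : 0 < h) {n : ℕ}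
    (hC : ∀ s : ℝ, 0 < s → s ≤ n → |peanoKernel α n s| ≤ C * s ^ (-α)) {r : ℝ} (hr : 0 < r)
    (hrn : r ≤ n * h) : |stepKernel α h n r| ≤ C * h ^ 4 * r ^ (-α) := by
  have h1 := hC (r / h) (by positivity) (by rwa [div_le_iff₀ hh])
  have hp : 0 < h ^ (4 - α) := Real.rpow_pos_of_pos hh _
  rw [stepKernel_eq hh n hr.le, abs_mul, abs_of_pos hp]
  refine (mul_le_mul_of_nonneg_left h1 hp.le).trans (le_of_eq ?_)
  have e1 : h ^ (4 - α) = h ^ 4 * h ^ (-α) := by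
    rw [← Real.rpow_ofNat, ← Real.rpow_add hh]; ring_nf
  have e2 : r ^ (-α) = h ^ (-α) * (r / h) ^ (-α) := by
    rw [← Real.mul_rpow hh.le (by positivity), mul_div_cancel₀ _ hh.ne']
  rw [e1, e2]
  ring

theorem integral_sub_rpow_neg {α a x : ℝ} (h1 : α < 1) :
    ∫ y in a..x, (x - y) ^ (-α) = (x - a) ^ (1 - α) / (1 - α) := by
  rw [intervalIntegral.integral_comp_sub_left (fun y => y ^ (-α)), sub_self,
    integral_rpow (Or.inl (by linarith)), show -α + 1 = 1 - α by ring,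
    Real.zero_rpow (by linarith), sub_zero]

theorem IsProfile.leftInt_eq {a b B α : ℝ} {f : ℕ → ℝ → ℝ} (hf : IsProfile a b B f) (h1 : α < 1)
    {x : ℝ} (hx : x ∈ Set.Icc a b) :
    leftInt a b α (f 4) x = 1 / Real.Gamma (5 - α) *
      (f 4 a * (x - a) ^ (4 - α) + ∫ y in a..x, (x - y) ^ (4 - α) * f 5 y) := by
  have h := integral_rpow_mul_by_parts (by linarith : 0 < 4 - α) hx (hf.hasDeriv 4 (by norm_num))
    (hf.continuousOn (i := 5) (by norm_num))
  rw [show 4 - α - 1 = 3 - α by ring] at h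
  have hG := Real.Gamma_add_one (s := 4 - α) (by linarith)
  rw [show 4 - α + 1 = 5 - α by ring] at hG
  rw [leftInt, integral_max_rpow_eq (by linarith) hx (hf.continuousOn (by norm_num)), h, hG,
    ← mul_assoc, one_div_mul_one_div_rev]

theorem leftInt_left {a b α : ℝ} (hab : a ≤ b) (h1 : α < 1) (g : ℝ → ℝ) :
    leftInt a b α g a = 0 := by
  rw [leftInt, intervalIntegral.integral_congr (g := fun _ => (0 : ℝ)),
    intervalIntegral.integral_zero, mul_zero]
  intro y hy
  rw [Set.uIcc_of_le hab] at hy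
  simp only
  rw [max_eq_right (by linarith [hy.1]), Real.zero_rpow (by linarith), zero_mul]

/-- By `IsProfile.eq_integral` the function is a superposition of truncated fourth powers, with a
point mass f⁗(a) at a and density f 5. The error is the same superposition of `stepKernel`: the
point mass gives (nh)^{-α}, the density the integrable remainder. -/
theorem IsProfile.abs_left_error_le {a b B α C h : ℝ} {f : ℕ → ℝ → ℝ} (hf : IsProfile a b B f)
    (h0 : 0 < α) (h1 : α < 1) (hC0 : 0 ≤ C)
    (hC : ∀ (n : ℕ) (s : ℝ), 0 < s → s ≤ n → |peanoKernel α n s| ≤ C * s ^ (-α))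
    (hh : 0 < h) {n : ℕ} (hn : a + n * h ∈ Set.Icc a b) :
    |h ^ (-α) * ∑ l ∈ Finset.range (n + 1), weight α l * f 0 (a + ((n : ℝ) - l) * h) -
      leftInt a b α (f 4) (a + n * h)| ≤
      C * B * h ^ 4 * ((n * h) ^ (-α) + (b - a) ^ (1 - α) / (1 - α)) := by
  have hab : a ≤ b := hn.1.trans hn.2
  have hB0 : 0 ≤ B := (abs_nonneg _).trans (hf.bound 0 (by norm_num) a ⟨le_rfl, hab⟩)
  have hc0 : 0 ≤ (b - a) ^ (1 - α) / (1 - α) :=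
    div_nonneg (Real.rpow_nonneg (by linarith) _) (by linarith)
  -- At the end point both quantities vanish. The bound is still meaningful there since (0 : ℝ) ^
  -- (-α) = 0.
  rcases Nat.eq_zero_or_pos n with rfl | hnpos
  · have e : leftInt a b α (f 4) (a + (0 : ℕ) * h) = 0 := by
      simp [leftInt_left hab h1]
    rw [e]
    simp only [zero_add, Finset.sum_range_one, Nat.cast_zero, sub_zero, zero_mul, add_zero,
      hf.left 0 (by norm_num), mul_zero, abs_zero, Real.zero_rpow (by linarith : -α ≠ 0)]
    positivity
  set x := a + n * h with hx
  have hxa : x - a = n * h := by rw [hx]; ring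
  have hnh : 0 < n * h := by positivity
  have hax : a ≤ x := hn.1
  have hsub : Set.Icc a x ⊆ Set.Icc a b := Set.Icc_subset_Icc_right hn.2
  have hc5 : ContinuousOn (f 5) (Set.Icc a x) := (hf.continuousOn (i := 5) (by norm_num)).mono hsub
  have hc5' : ContinuousOn (f 5) (Set.uIcc a x) := by rwa [Set.uIcc_of_le hax]
  have hterm : ∀ l ∈ Finset.range (n + 1), weight α l * f 0 (a + ((n : ℝ) - l) * h) =
      f 4 a * (weight α l * (max (n * h - l * h) 0 ^ 4 / 24)) +
        ∫ y in a..x, weight α l * (max (x - y - l * h) 0 ^ 4 / 24) * f 5 y := by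
    intro l hl
    have hl' : (l : ℝ) ≤ n := by exact_mod_cast Nat.lt_succ_iff.1 (Finset.mem_range.1 hl)
    have hz0 : 0 ≤ ((n : ℝ) - l) * h := mul_nonneg (by linarith) hh.le
    have hz : a + ((n : ℝ) - l) * h ∈ Set.Icc a x := by
      refine ⟨by linarith, ?_⟩
      have : 0 ≤ (l : ℝ) * h := by positivity
      rw [hx]; linarith
    rw [hf.eq_integral (hsub hz), ← integral_max_pow_eq hz hc5,
      max_eq_left (by linarith : 0 ≤ n * h - l * h), mul_add, mul_add]
    congr 1
    · ring
    · rw [← intervalIntegral.integral_const_mul, ← intervalIntegral.integral_const_mul]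
      refine intervalIntegral.integral_congr fun y _ => ?_
      rw [show a + ((n : ℝ) - l) * h - y = x - y - l * h by rw [hx]; ring]
      ring
  have hci : ∀ l : ℕ, ContinuousOn
      (fun y => weight α l * (max (x - y - l * h) 0 ^ 4 / 24) * f 5 y) (Set.uIcc a x) := fun l =>
    (by fun_prop : Continuous fun y => weight α l * (max (x - y - l * h) 0 ^ 4 / 24)).continuousOn.mul
      hc5'
  have hcr : ContinuousOn (fun y => (x - y) ^ (4 - α) / Real.Gamma (5 - α) * f 5 y)
      (Set.uIcc a x) :=
    (((continuous_sub_left x).rpow_const fun _ => Or.inr (by linarith : 0 ≤ 4 - α)).div_const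
      _).continuousOn.mul hc5'
  have hcs : ContinuousOn (fun y => h ^ (-α) * ∑ l ∈ Finset.range (n + 1),
      weight α l * (max (x - y - l * h) 0 ^ 4 / 24) * f 5 y) (Set.uIcc a x) :=
    (continuousOn_finsetSum _ fun l _ => hci l).const_mul _ 
  have hid : h ^ (-α) * ∑ l ∈ Finset.range (n + 1), weight α l * f 0 (a + ((n : ℝ) - l) * h) -
      leftInt a b α (f 4) x = f 4 a * stepKernel α h n (x - a) +
        ∫ y in a..x, stepKernel α h n (x - y) * f 5 y := by
    rw [Finset.sum_congr rfl hterm, Finset.sum_add_distrib, ← Finset.mul_sum,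
      ← intervalIntegral.integral_finsetSum fun l _ => (hci l).intervalIntegrable, mul_add,
      ← intervalIntegral.integral_const_mul, hf.leftInt_eq h1 hn]
    have e : ∫ y in a..x, stepKernel α h n (x - y) * f 5 y =
        (∫ y in a..x, h ^ (-α) * ∑ l ∈ Finset.range (n + 1),
          weight α l * (max (x - y - l * h) 0 ^ 4 / 24) * f 5 y) -
        ∫ y in a..x, (x - y) ^ (4 - α) / Real.Gamma (5 - α) * f 5 y := by
      rw [← intervalIntegral.integral_sub hcs.intervalIntegrable hcr.intervalIntegrable]
      refine intervalIntegral.integral_congr fun y _ => ?_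
      simp only [stepKernel]
      rw [← Finset.sum_mul]
      ring
    have e2 : ∫ y in a..x, (x - y) ^ (4 - α) / Real.Gamma (5 - α) * f 5 y =
        1 / Real.Gamma (5 - α) * ∫ y in a..x, (x - y) ^ (4 - α) * f 5 y := by
      rw [← intervalIntegral.integral_const_mul]
      exact intervalIntegral.integral_congr fun y _ => by ring
    rw [e, e2, stepKernel, hxa]
    ring
  rw [hid]
  have k1 : |stepKernel α h n (x - a)| ≤ C * h ^ 4 * (n * h) ^ (-α) := by
    rw [hxa]; exact abs_stepKernel_le hh (hC n) hnh le_rfl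
  have k2 : ‖∫ y in a..x, stepKernel α h n (x - y) * f 5 y‖ ≤
      ∫ y in a..x, C * h ^ 4 * B * (x - y) ^ (-α) := by
    refine intervalIntegral.norm_integral_le_of_norm_le hax ?_ ?_
    · refine Filter.Eventually.of_forall fun y hy => ?_
      have hb5 := hf.bound 5 (by norm_num) y (hsub ⟨hy.1.le, hy.2⟩)
      rw [norm_mul, Real.norm_eq_abs, Real.norm_eq_abs]
      -- The half-open interval contains y = x, where the kernel bound is not available; there the
      -- kernel itself is zero.
      rcases hy.2.eq_or_lt with rfl | hlt
      · have : stepKernel α h n 0 = 0 := by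
          rw [stepKernel_eq hh n le_rfl, zero_div, peanoKernel,
            Real.zero_rpow (by linarith : 4 - α ≠ 0)]
          rw [Finset.sum_eq_zero fun l _ => by
            rw [max_eq_right (by simp : (0 : ℝ) - l ≤ 0)]; ring]
          simp
        rw [sub_self, this, abs_zero, zero_mul]
        have := Real.rpow_nonneg (le_refl (0 : ℝ)) (-α)
        positivity
      · have k := abs_stepKernel_le (α := α) hh (hC n) (by linarith : 0 < x - y)
          (by linarith [hy.1])
        have := Real.rpow_nonneg (by linarith : 0 ≤ x - y) (-α)
        calc _ ≤ C * h ^ 4 * (x - y) ^ (-α) * B :=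
              mul_le_mul k hb5 (abs_nonneg _) (by positivity)
          _ = _ := by ring
    · have hi := (intervalIntegral.intervalIntegrable_rpow' (a := x - a) (b := 0)
        (by linarith : -1 < -α)).comp_sub_left x
      simpa using hi.const_mul (C * h ^ 4 * B)
  rw [intervalIntegral.integral_const_mul, integral_sub_rpow_neg h1] at k2
  have k3 : (x - a) ^ (1 - α) / (1 - α) ≤ (b - a) ^ (1 - α) / (1 - α) :=
    div_le_div_of_nonneg_right (Real.rpow_le_rpow (by linarith) (by linarith [hn.2]) (by linarith))
      (by linarith)
  have k4 := hf.bound 4 (by norm_num) a ⟨le_rfl, hab⟩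
  have hp : 0 ≤ (n * h) ^ (-α) := Real.rpow_nonneg hnh.le _
  calc _ ≤ |f 4 a * stepKernel α h n (x - a)| +
        |∫ y in a..x, stepKernel α h n (x - y) * f 5 y| := abs_add_le _ _
    _ ≤ B * (C * h ^ 4 * (n * h) ^ (-α)) + C * h ^ 4 * B * ((b - a) ^ (1 - α) / (1 - α)) := by
        refine add_le_add ?_ (k2.trans (mul_le_mul_of_nonneg_left k3 (by positivity)))
        rw [abs_mul]
        exact mul_le_mul k4 k1 (abs_nonneg _) hB0
    _ = _ := by ring

/-- Comparison with the integral of x^{-α}, in the form of Bernoulli's inequality for (1 -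
1/m)^{1-α}. The term n = 0 is zero by convention. -/
theorem sum_rpow_neg_le {α : ℝ} (h0 : 0 < α) (h1 : α < 1) (M : ℕ) :
    ∑ n ∈ Finset.range (M + 1), (n : ℝ) ^ (-α) ≤ (M : ℝ) ^ (1 - α) / (1 - α) := by
  have hα : 0 < 1 - α := by linarith
  induction M with
  | zero => simp [Real.zero_rpow hα.ne', Real.zero_rpow (by linarith : -α ≠ 0)]
  | succ M ih =>
    rw [Finset.sum_range_succ]
    refine (add_le_add_left ih _).trans ?_
    have hm : (0 : ℝ) < (M + 1 : ℕ) := by positivity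
    have hM : (M : ℝ) = (M + 1 : ℕ) * (1 + -1 / ((M + 1 : ℕ) : ℝ)) := by
      field_simp; push_cast; ring
    set m : ℝ := ((M + 1 : ℕ) : ℝ)
    have hm1 : 1 ≤ m := by simp [m]
    have hs : -1 ≤ -1 / m := by
      rw [le_div_iff₀ hm]; linarith
    have hb := rpow_one_add_le_one_add_mul_self hs hα.le (by linarith : 1 - α ≤ 1)
    have e : m ^ (-α) = m ^ (1 - α) / m := by
      rw [show -α = 1 - α - 1 by ring, Real.rpow_sub_one hm.ne']
    have hp : 0 ≤ m ^ (1 - α) := Real.rpow_nonneg hm.le _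
    rw [hM, Real.mul_rpow hm.le (by linarith), e, ← sub_nonneg]
    have h2 := mul_le_mul_of_nonneg_left hb hp
    have e2 : m ^ (1 - α) / (1 - α) -
        (m ^ (1 - α) * (1 + -1 / m) ^ (1 - α) / (1 - α) + m ^ (1 - α) / m) =
        (m ^ (1 - α) * (1 + (1 - α) * (-1 / m)) - m ^ (1 - α) * (1 + -1 / m) ^ (1 - α)) /
          (1 - α) := by
      field_simp
      ring
    rw [e2]
    exact div_nonneg (by linarith) hα.le

end RieszDiffusion
end

noncomputable section
namespace RieszDiffusion

open Finset Filter Topology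

/-! Consistency of the spatial operator. -/

/-- The interior grid values of `f` on `a + j * h`, extended by zero. -/
def gridFun (a h : ℝ) (M : ℕ) (f : ℝ → ℝ) (j : ℤ) : ℝ := if 0 < j ∧ j < M then f (a + j * h) else 0

theorem gridFun_zeroBoundary (a h : ℝ) (M : ℕ) (f : ℝ → ℝ) : ZeroBoundary M (gridFun a h M f) :=
  fun _ hj => if_neg (by omega)

theorem gridFun_eq {a b h : ℝ} {M : ℕ} (hb : a + M * h = b) {f : ℝ → ℝ} (hfa : f a = 0)
    (hfb : f b = 0) {j : ℤ} (h0 : 0 ≤ j) (hj : j ≤ M) : gridFun a h M f j = f (a + j * h) := by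
  rw [gridFun]
  split_ifs with h
  · rfl
  · rcases h0.eq_or_lt with rfl | h0
    · simp [hfa]
    · have : j = M := by omega
      rw [this]
      push_cast
      rw [hb, hfb]

/-- The weighted two-sided sums of a grid function. -/
def weightedSum (α : ℝ) (M : ℕ) (v : ℤ → ℝ) (i : ℤ) : ℝ :=
  ∑ l ∈ Finset.range (M + 2), weight α l * (v (i - l) + v (i + l))

/-- Averaging commutes with the weighted sums once the range of l no longer depends on j. Since v
vanishes outside the interior, the sums may be extended to the common range `M + 2`. -/
theorem bracket_eq_avg {M : ℕ} {v : ℤ → ℝ} (hv : ZeroBoundary M v) (α d₁ d₂ h : ℝ) {j : ℕ}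
    (hj : j < M) : bracket α d₁ d₂ h M v j = avg d₁ d₂ h (weightedSum α M v) j := by
  have hz : ∀ i : ℤ, i < 0 ∨ (M : ℤ) < i → avg d₁ d₂ h v i = 0 := by
    intro i hi
    simp only [avg, stencil]
    rw [hv (i - 1) (by omega), hv i (by omega), hv (i + 1) (by omega)]
    simp
  have e1 : ∑ l ∈ Finset.range (j + 1), weight α l * avg d₁ d₂ h v ((j : ℤ) - l) =
      ∑ l ∈ Finset.range (M + 2), weight α l * avg d₁ d₂ h v ((j : ℤ) - l) := by
    refine Finset.sum_subset (Finset.range_subset_range.2 (by omega)) fun l _ hl => ?_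
    rw [hz _ (by simp at hl; omega), mul_zero]
  have e2 : ∑ l ∈ Finset.range (M - j + 1), weight α l * avg d₁ d₂ h v ((j : ℤ) + l) =
      ∑ l ∈ Finset.range (M + 2), weight α l * avg d₁ d₂ h v ((j : ℤ) + l) := by
    refine Finset.sum_subset (Finset.range_subset_range.2 (by omega)) fun l _ hl => ?_
    rw [hz _ (by simp at hl; omega), mul_zero]
  rw [bracket, e1, e2, ← Finset.sum_add_distrib]
  simp only [avg, stencil, weightedSum, smul_eq_mul, Finset.mul_sum]
  rw [← Finset.sum_add_distrib, ← Finset.sum_add_distrib]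
  refine Finset.sum_congr rfl fun l _ => ?_
  rw [show (j : ℤ) - 1 - l = j - l - 1 by ring, show (j : ℤ) + 1 - l = j - l + 1 by ring,
    show (j : ℤ) - 1 + l = j + l - 1 by ring, show (j : ℤ) + 1 + l = j + l + 1 by ring]
  ring

theorem weightedSum_gridFun {a b h : ℝ} {M : ℕ} (hb : a + M * h = b) {f : ℝ → ℝ} (hfa : f a = 0)
    (hfb : f b = 0) (α : ℝ) {n : ℕ} (hn : n ≤ M) :
    weightedSum α M (gridFun a h M f) n =
      ∑ l ∈ Finset.range (n + 1), weight α l * f (a + ((n : ℝ) - l) * h) +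
      ∑ l ∈ Finset.range (M - n + 1),
        weight α l * f (a + b - (a + (((M - n : ℕ) : ℝ) - l) * h)) := by
  have hv := gridFun_zeroBoundary a h M f
  simp only [weightedSum, mul_add, Finset.sum_add_distrib]
  congr 1
  · rw [← Finset.sum_subset (Finset.range_subset_range.2 (by omega : n + 1 ≤ M + 2))]
    · refine Finset.sum_congr rfl fun l hl => ?_
      have := Finset.mem_range.1 hl
      rw [gridFun_eq hb hfa hfb (by omega) (by omega)]
      push_cast
      rfl
    · intro l _ hl
      rw [hv _ (by simp at hl; omega), mul_zero]
  · rw [← Finset.sum_subset (Finset.range_subset_range.2 (by omega : M - n + 1 ≤ M + 2))]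
    · refine Finset.sum_congr rfl fun l hl => ?_
      have := Finset.mem_range.1 hl
      rw [gridFun_eq hb hfa hfb (by omega) (by omega), ← hb, Nat.cast_sub hn]
      push_cast
      congr 2
      ring
    · intro l _ hl
      rw [hv _ (by simp at hl; omega), mul_zero]

/-- The error of the two-sided weighted sums at `a + i * h`. -/
def rieszError (a b α h : ℝ) (M : ℕ) (f : ℕ → ℝ → ℝ) (i : ℤ) : ℝ :=
  h ^ (-α) * weightedSum α M (gridFun a h M (f 0)) i -
    (leftInt a b α (f 4) (a + i * h) + rightInt a b α (f 4) (a + i * h))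

/-- Pointwise the error is only O(h⁴ r^{-α}) near the ends, but h Σ (nh)^{-α} is bounded because α <
1. The right derivative is handled by reflection, which replaces n by M - n. -/
theorem exists_sum_rieszError_le {a b α : ℝ} (hab : a < b) (h0 : 0 < α) (h1 : α < 1) :
    ∃ C : ℝ, 0 ≤ C ∧ ∀ (M : ℕ) (B : ℝ) (f : ℕ → ℝ → ℝ), 0 < M → IsProfile a b B f →
      (b - a) / M * ∑ n ∈ Finset.range (M + 1), |rieszError a b α ((b - a) / M) M f n| ≤
        C * B * ((b - a) / M) ^ 4 := by
  obtain ⟨C, hC0, hC⟩ := exists_peanoKernel_bound h0 h1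
  set c := (b - a) ^ (1 - α) / (1 - α) with hc
  have hc0 : 0 ≤ c := div_nonneg (Real.rpow_nonneg (by linarith) _) (by linarith)
  have hba : 0 < b - a := by linarith
  refine ⟨C * (2 * c + 4 * (b - a) * c), by positivity, fun M B f hM hf => ?_⟩
  have hB0 : 0 ≤ B := (abs_nonneg _).trans (hf.bound 0 (by norm_num) a ⟨le_rfl, hab.le⟩)
  have hMpos : (0 : ℝ) < M := by exact_mod_cast hM
  have hM1 : (1 : ℝ) ≤ M := by exact_mod_cast hM
  have hh : 0 < (b - a) / M := by positivity
  have hMh : M * ((b - a) / M) = b - a := mul_div_cancel₀ _ hMpos.ne'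
  set h := (b - a) / M
  have hb : a + M * h = b := by linarith
  have hmem : ∀ n : ℕ, n ≤ M → a + n * h ∈ Set.Icc a b := by
    intro n hn
    have hn' : (n : ℝ) ≤ M := by exact_mod_cast hn
    have := mul_le_mul_of_nonneg_right hn' hh.le
    exact ⟨by have : 0 ≤ n * h := by positivity
              linarith, by linarith⟩
  have hpt : ∀ n ∈ Finset.range (M + 1), |rieszError a b α h M f n| ≤
      C * B * h ^ 4 * (((n : ℝ) * h) ^ (-α) + (((M - n : ℕ) : ℝ) * h) ^ (-α) + 2 * c) := by
    intro n hn
    have hn' : n ≤ M := Nat.lt_succ_iff.1 (Finset.mem_range.1 hn)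
    have k1 := hf.abs_left_error_le h0 h1 hC0 hC hh (hmem n hn')
    have k2 := hf.reflect.abs_left_error_le h0 h1 hC0 hC hh (hmem (M - n) (Nat.sub_le _ _))
    simp only [pow_zero, one_mul, (by norm_num : (-1 : ℝ) ^ 4 = 1)] at k2
    have e : a + ((M - n : ℕ) : ℝ) * h = a + b - (a + n * h) := by
      rw [Nat.cast_sub hn', ← hb]; ring
    rw [show leftInt a b α (fun y => f 4 (a + b - y)) (a + ((M - n : ℕ) : ℝ) * h) =
      rightInt a b α (f 4) (a + n * h) by rw [rightInt_eq, e]] at k2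
    rw [rieszError, weightedSum_gridFun hb (hf.left 0 (by norm_num)) (hf.right 0 (by norm_num)) α hn',
      Int.cast_natCast, mul_add, add_sub_add_comm]
    refine (abs_add_le _ _).trans ((add_le_add k1 k2).trans (le_of_eq ?_))
    ring
  have hsum1 : h * ∑ n ∈ Finset.range (M + 1), ((n : ℝ) * h) ^ (-α) ≤ c := by
    have e1 : ∀ n ∈ Finset.range (M + 1), ((n : ℝ) * h) ^ (-α) = (n : ℝ) ^ (-α) * h ^ (-α) :=
      fun n _ => Real.mul_rpow (by positivity) hh.le
    rw [Finset.sum_congr rfl e1, ← Finset.sum_mul]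
    have e2 : c = h * ((M : ℝ) ^ (1 - α) / (1 - α) * h ^ (-α)) := by
      rw [hc, ← hMh, Real.mul_rpow hMpos.le hh.le, show (1 - α) = -α + 1 by ring,
        Real.rpow_add_one hh.ne']
      ring
    rw [e2]
    have := Real.rpow_pos_of_pos hh (-α)
    have := sum_rpow_neg_le h0 h1 M
    gcongr
  have hsum2 : ∑ n ∈ Finset.range (M + 1), (((M - n : ℕ) : ℝ) * h) ^ (-α) =
      ∑ n ∈ Finset.range (M + 1), ((n : ℝ) * h) ^ (-α) := by
    rw [← Finset.sum_range_reflect (fun n : ℕ => ((n : ℝ) * h) ^ (-α))]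
    simp
  calc h * ∑ n ∈ Finset.range (M + 1), |rieszError a b α h M f n|
      ≤ h * ∑ n ∈ Finset.range (M + 1),
        C * B * h ^ 4 * (((n : ℝ) * h) ^ (-α) + (((M - n : ℕ) : ℝ) * h) ^ (-α) + 2 * c) :=
        mul_le_mul_of_nonneg_left (Finset.sum_le_sum hpt) hh.le
    _ = C * B * h ^ 4 * (2 * (h * ∑ n ∈ Finset.range (M + 1), ((n : ℝ) * h) ^ (-α)) +
          (M + 1) * h * (2 * c)) := by
        rw [← Finset.mul_sum, Finset.sum_add_distrib, Finset.sum_add_distrib, hsum2,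
          Finset.sum_const, Finset.card_range, nsmul_eq_mul]
        push_cast
        ring
    _ ≤ C * B * h ^ 4 * (2 * c + 4 * (b - a) * c) := by
        have : (M + 1) * h ≤ 2 * (b - a) := by
          rw [← hMh]; nlinarith
        have := mul_le_mul_of_nonneg_right this (by positivity : 0 ≤ 2 * c)
        refine mul_le_mul_of_nonneg_left ?_ (by positivity)
        linarith
    _ = _ := by ring

/-- The spatial part of the equation for a function with derivatives `f i`. -/
def spaceLim (α d₁ d₂ dα a b : ℝ) (f : ℕ → ℝ → ℝ) (x : ℝ) : ℝ :=
  d₂ * f 2 x - d₁ * f 1 x - dα / (2 * Real.cos (Real.pi * α / 2)) *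
    (leftInt a b α (f 4) x + rightInt a b α (f 4) x)

theorem sum_abs_stencil_le {M : ℕ} (c₁ c₂ c₃ : ℝ) (v : ℤ → ℝ) :
    ∑ j ∈ Finset.Ico 1 M, |stencil c₁ c₂ c₃ v j| ≤
      (|c₁| + |c₂| + |c₃|) * ∑ n ∈ Finset.range (M + 1), |v n| := by
  have h1 : ∑ j ∈ Finset.Ico 1 M, |v ((j : ℤ) - 1)| ≤ ∑ n ∈ Finset.range (M + 1), |v n| := by
    rw [Finset.sum_Ico_eq_sum_range]
    refine (Finset.sum_le_sum_of_subset_of_nonneg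
      (Finset.range_subset_range.2 (by omega : M - 1 ≤ M + 1)) fun _ _ _ => abs_nonneg _).trans
      (le_of_eq (Finset.sum_congr rfl fun n _ => ?_))
    push_cast
    ring_nf
  have h2 : ∑ j ∈ Finset.Ico 1 M, |v (j : ℤ)| ≤ ∑ n ∈ Finset.range (M + 1), |v n| := by
    rw [Finset.range_eq_Ico]
    exact Finset.sum_le_sum_of_subset_of_nonneg (Finset.Ico_subset_Ico (by omega) (by omega))
      fun _ _ _ => abs_nonneg _
  have h3 : ∑ j ∈ Finset.Ico 1 M, |v ((j : ℤ) + 1)| ≤ ∑ n ∈ Finset.range (M + 1), |v n| := by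
    have e : ∑ j ∈ Finset.Ico 1 M, |v ((j : ℤ) + 1)| = ∑ j ∈ Finset.Ico 2 (M + 1), |v (j : ℤ)| := by
      rw [← Finset.sum_Ico_add' (fun j : ℕ => |v (j : ℤ)|) 1 M 1]
      simp
    rw [e, Finset.range_eq_Ico]
    exact Finset.sum_le_sum_of_subset_of_nonneg (Finset.Ico_subset_Ico (by omega) le_rfl)
      fun _ _ _ => abs_nonneg _
  have h4 : ∀ j ∈ Finset.Ico 1 M, |stencil c₁ c₂ c₃ v j| ≤
      |c₁| * |v ((j : ℤ) - 1)| + |c₂| * |v (j : ℤ)| + |c₃| * |v ((j : ℤ) + 1)| := fun j _ => by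
    simp only [stencil, smul_eq_mul]
    refine (abs_add_three _ _ _).trans ?_
    rw [abs_mul, abs_mul, abs_mul]
  refine (Finset.sum_le_sum h4).trans ?_
  rw [Finset.sum_add_distrib, Finset.sum_add_distrib, ← Finset.mul_sum, ← Finset.mul_sum,
    ← Finset.mul_sum, add_mul, add_mul]
  gcongr

theorem abs_avg_coeff_le {d₁ d₂ h L : ℝ} (hd₁ : 0 < d₁) (hd₂ : 0 < d₂) (hh : 0 < h) (hL : h ≤ L) :
    |a₁ d₁ d₂ h| + |a₂| + |a₃ d₁ d₂ h| ≤ 1 + d₁ * L / d₂ := by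
  have g1 : 0 ≤ d₁ * h / (24 * d₂) := by positivity
  have g2 : d₁ * h / (24 * d₂) ≤ d₁ * L / (24 * d₂) := by gcongr
  have g3 : d₁ * L / (24 * d₂) = d₁ * L / d₂ / 24 := by field_simp
  have k1 : |a₁ d₁ d₂ h| ≤ 1 / 12 + d₁ * L / d₂ / 24 := by
    rw [a₁, abs_le]; constructor <;> linarith
  have k2 : |a₃ d₁ d₂ h| ≤ 1 / 12 + d₁ * L / d₂ / 24 := by
    rw [a₃, abs_le]; constructor <;> linarith
  have k3 : |a₂| ≤ 5 / 6 := by norm_num [a₂, abs_le]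
  linarith

/-- The difference splits into the compact-stencil residual, pointwise O(h⁴), and the average of the
Riesz error, which is O(h⁴) only in the discrete L¹ norm. -/
theorem exists_space_consistency {a b α d₁ d₂ : ℝ} (hab : a < b) (h0 : 0 < α) (h1 : α < 1)
    (hd₁ : 0 < d₁) (hd₂ : 0 < d₂) (dα : ℝ) :
    ∃ C : ℝ, 0 ≤ C ∧ ∀ (M : ℕ) (B : ℝ) (f : ℕ → ℝ → ℝ), 0 < M → IsProfile a b B f →
      (b - a) / M * ∑ j ∈ Finset.Ico 1 M,
        |spaceOp α d₁ d₂ dα ((b - a) / M) M (gridFun a ((b - a) / M) M (f 0)) j -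
          avg d₁ d₂ ((b - a) / M)
            (fun i => spaceLim α d₁ d₂ dα a b f (a + i * ((b - a) / M))) j| ≤
        C * B * ((b - a) / M) ^ 4 := by
  obtain ⟨C, hC0, hC⟩ := exists_sum_rieszError_le hab h0 h1
  set L := b - a with hLdef
  have hL0 : 0 < L := by rw [hLdef]; linarith
  set κ := dα / (2 * Real.cos (Real.pi * α / 2)) with hκ
  set K := d₁ ^ 2 / d₂ + d₁ + 2 * (d₂ + d₁ ^ 2 * L ^ 2 / d₂ + d₁ * L) +
        2 * (d₂ + d₁) * (1 + d₁ * L / d₂) with hK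
  refine ⟨L * K + |κ| * ((1 + d₁ * L / d₂) * C), by positivity, fun M B f hM hf => ?_⟩
  have hB0 : 0 ≤ B := (abs_nonneg _).trans (hf.bound 0 (by norm_num) a ⟨le_rfl, hab.le⟩)
  have hMpos : (0 : ℝ) < M := by exact_mod_cast hM
  have hM1 : (1 : ℝ) ≤ M := by exact_mod_cast hM
  have hh : 0 < L / M := by positivity
  have hMh : M * (L / M) = L := mul_div_cancel₀ _ hMpos.ne'
  have hhL : L / M ≤ L := div_le_self hL0.le hM1
  have hE := hC M B f hM hf
  set h := L / M
  have hb : a + M * h = b := by rw [hMh, hLdef]; ring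
  have hmem : ∀ j : ℤ, 0 ≤ j → j ≤ M → a + j * h ∈ Set.Icc a b := by
    intro j hj0 hj
    have h1 : (0 : ℝ) ≤ j := by exact_mod_cast hj0
    have h2 : (j : ℝ) ≤ M := by exact_mod_cast hj
    have := mul_le_mul_of_nonneg_right h2 hh.le
    have := mul_nonneg h1 hh.le
    exact ⟨by linarith, by linarith⟩
  have hnu : nu α dα h = κ * h ^ (-α) := by
    rw [nu, hκ, Real.rpow_neg hh.le]; field_simp
  have hv := gridFun_zeroBoundary a h M (f 0)
  have hval := fun {j : ℤ} => gridFun_eq (j := j) hb (hf.left 0 (by norm_num)) (hf.right 0 (by norm_num))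
  have hpt : ∀ j ∈ Finset.Ico 1 M, |spaceOp α d₁ d₂ dα h M (gridFun a h M (f 0)) j -
      avg d₁ d₂ h (fun i => spaceLim α d₁ d₂ dα a b f (a + i * h)) j| ≤
      K * B * h ^ 4 + |κ| * |avg d₁ d₂ h (rieszError a b α h M f) j| := by
    intro j hj
    have hj' := Finset.mem_Ico.1 hj
    have hc := abs_compact_residual_le hf hd₁ hd₂ hh hhL (x := a + (j : ℤ) * h)
      (hmem j (by omega) (by omega))
      (by have := hmem (j - 1) (by omega) (by omega); push_cast at this ⊢; convert this using 1; ring)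
      (by have := hmem (j + 1) (by omega) (by omega); push_cast at this ⊢; convert this using 1; ring)
    have hid : spaceOp α d₁ d₂ dα h M (gridFun a h M (f 0)) j -
        avg d₁ d₂ h (fun i => spaceLim α d₁ d₂ dα a b f (a + i * h)) j =
        ((b₁ d₁ d₂ h * f 0 (a + (j : ℤ) * h - h) + b₂ d₁ d₂ h * f 0 (a + (j : ℤ) * h) +
          b₃ d₁ d₂ h * f 0 (a + (j : ℤ) * h + h)) -
        (a₁ d₁ d₂ h * (d₂ * f 2 (a + (j : ℤ) * h - h) - d₁ * f 1 (a + (j : ℤ) * h - h)) +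
          a₂ * (d₂ * f 2 (a + (j : ℤ) * h) - d₁ * f 1 (a + (j : ℤ) * h)) +
          a₃ d₁ d₂ h * (d₂ * f 2 (a + (j : ℤ) * h + h) - d₁ * f 1 (a + (j : ℤ) * h + h)))) -
        κ * avg d₁ d₂ h (rieszError a b α h M f) j := by
      rw [spaceOp, bracket_eq_avg hv α d₁ d₂ h hj'.2, hnu]
      simp only [avg, stencil, smul_eq_mul, spaceLim, rieszError]
      rw [hval (by omega) (by omega), hval (by omega) (by omega), hval (by omega) (by omega)]
      rw [show a + ((j - 1 : ℤ) : ℝ) * h = a + (j : ℤ) * h - h by push_cast; ring,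
        show a + ((j + 1 : ℤ) : ℝ) * h = a + (j : ℤ) * h + h by push_cast; ring]
      ring
    rw [hid]
    refine (abs_sub _ _).trans ?_
    rw [abs_mul]
    exact add_le_add_left hc _
  refine (mul_le_mul_of_nonneg_left (Finset.sum_le_sum hpt) hh.le).trans ?_
  rw [Finset.sum_add_distrib, Finset.sum_const, nsmul_eq_mul, Nat.card_Ico, ← Finset.mul_sum, mul_add]
  have k1 : h * (((M - 1 : ℕ) : ℝ) * (K * B * h ^ 4)) ≤ L * K * B * h ^ 4 := by
    have hM' : ((M - 1 : ℕ) : ℝ) ≤ M := by exact_mod_cast Nat.sub_le _ _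
    have : 0 ≤ K * B * h ^ 4 := by positivity
    calc _ = ((M - 1 : ℕ) : ℝ) * h * (K * B * h ^ 4) := by ring
      _ ≤ M * h * (K * B * h ^ 4) := by gcongr
      _ = _ := by rw [hMh]; ring
  have k2 : h * (|κ| * ∑ j ∈ Finset.Ico 1 M, |avg d₁ d₂ h (rieszError a b α h M f) j|) ≤
      |κ| * ((1 + d₁ * L / d₂) * C) * B * h ^ 4 := by
    have s1 := sum_abs_stencil_le (M := M) (a₁ d₁ d₂ h) a₂ (a₃ d₁ d₂ h) (rieszError a b α h M f)
    have s2 := abs_avg_coeff_le hd₁ hd₂ hh hhL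
    set S := ∑ n ∈ Finset.range (M + 1), |rieszError a b α h M f n|
    have hS0 : 0 ≤ S := Finset.sum_nonneg fun _ _ => abs_nonneg _
    calc _ ≤ h * (|κ| * ((1 + d₁ * L / d₂) * S)) := by
          refine mul_le_mul_of_nonneg_left (mul_le_mul_of_nonneg_left (s1.trans ?_) (abs_nonneg _)) hh.le
          exact mul_le_mul_of_nonneg_right s2 hS0
      _ = |κ| * ((1 + d₁ * L / d₂) * (h * S)) := by ring
      _ ≤ |κ| * ((1 + d₁ * L / d₂) * (C * B * h ^ 4)) := by gcongr
      _ = _ := by ring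
  calc _ ≤ L * K * B * h ^ 4 + |κ| * ((1 + d₁ * L / d₂) * C) * B * h ^ 4 := add_le_add k1 k2
    _ = _ := by ring

end RieszDiffusion
end

noncomputable section
namespace RieszDiffusion

open Finset Filter Topology

/-! Partial derivatives of a function on a rectangle. -/

/-- The derivative of `v` in the direction `e` within `S`. -/
def dirDeriv (S : Set (ℝ × ℝ)) (e : ℝ × ℝ) (v : ℝ × ℝ → ℝ) (p : ℝ × ℝ) : ℝ := fderivWithin ℝ v S p e

theorem ContDiffOn.dirDeriv {S : Set (ℝ × ℝ)} (hS : UniqueDiffOn ℝ S) {v : ℝ × ℝ → ℝ} {n : ℕ}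
    (hv : ContDiffOn ℝ (n + 1 : ℕ) v S) (e : ℝ × ℝ) :
    ContDiffOn ℝ n (RieszDiffusion.dirDeriv S e v) S :=
  (hv.fderivWithin hS (m := n) (by norm_cast)).clm_apply contDiffOn_const

theorem contDiffOn_iterate_dirDeriv {S : Set (ℝ × ℝ)} (hS : UniqueDiffOn ℝ S) (e : ℝ × ℝ) (m : ℕ) :
    ∀ {v : ℝ × ℝ → ℝ} {n : ℕ}, ContDiffOn ℝ (n + m : ℕ) v S →
      ContDiffOn ℝ n ((dirDeriv S e)^[m] v) S := by
  induction m with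
  | zero => intro v n hv; exact hv
  | succ m ih =>
    intro v n hv
    rw [Function.iterate_succ_apply]
    exact ih (ContDiffOn.dirDeriv hS hv e)

theorem hasDerivWithinAt_slice {S : Set (ℝ × ℝ)} {v : ℝ × ℝ → ℝ} {n : ℕ}
    (hv : ContDiffOn ℝ (n + 1 : ℕ) v S) (e p : ℝ × ℝ) {I : Set ℝ} {γ : ℝ → ℝ × ℝ} {x : ℝ}
    (hγ : HasDerivAt γ e x) (hI : Set.MapsTo γ I S) (hx : γ x = p) (hp : p ∈ S) :
    HasDerivWithinAt (fun y => v (γ y)) (dirDeriv S e v p) I x := by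
  subst hx
  have h := ((hv.differentiableOn (by simp)) _ hp).hasFDerivWithinAt
  exact h.comp_hasDerivWithinAt x hγ.hasDerivWithinAt hI

theorem iteratedDerivWithin_eq_of_hasDerivWithinAt {I : Set ℝ} (hI : UniqueDiffOn ℝ I)
    {f : ℕ → ℝ → ℝ} (m : ℕ)
    (hf : ∀ i < m, ∀ x ∈ I, HasDerivWithinAt (f i) (f (i + 1) x) I x) :
    ∀ x ∈ I, iteratedDerivWithin m (f 0) I x = f m x := by
  induction m with
  | zero => intro x _; simp
  | succ m ih =>
    intro x hx
    have ih' := ih fun i hi => hf i (by omega)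
    rw [iteratedDerivWithin_succ, derivWithin_congr ih' (ih' x hx)]
    exact (hf m (by omega) x hx).derivWithin (hI x hx)

section Rectangle

variable {a b T : ℝ}

/-- The rectangle `[a, b] × [0, T]`. -/
def rect (a b T : ℝ) : Set (ℝ × ℝ) := Set.Icc a b ×ˢ Set.Icc 0 T

theorem uniqueDiffOn_rect (hab : a < b) (hT : 0 < T) : UniqueDiffOn ℝ (rect a b T) :=
  (uniqueDiffOn_Icc hab).prod (uniqueDiffOn_Icc hT)

theorem exists_bound_rect {v : ℝ × ℝ → ℝ} (hv : ContinuousOn v (rect a b T)) :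
    ∃ B : ℝ, 0 ≤ B ∧ ∀ x ∈ Set.Icc a b, ∀ t ∈ Set.Icc 0 T, |v (x, t)| ≤ B := by
  obtain ⟨B, hB⟩ := (isCompact_Icc.prod isCompact_Icc : IsCompact (rect a b T)).exists_bound_of_continuousOn hv
  exact ⟨max B 0, le_max_right _ _, fun x hx t ht => (hB (x, t) ⟨hx, ht⟩).trans (le_max_left _ _)⟩

/-- The `i`-th derivative in the first variable. -/
def spaceDeriv (a b T : ℝ) (u : ℝ → ℝ → ℝ) (i : ℕ) (x t : ℝ) : ℝ :=
  (dirDeriv (rect a b T) (1, 0))^[i] (fun p => u p.1 p.2) (x, t)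

/-- The `m`-th time derivative of the `i`-th derivative in the first variable. -/
def timeDeriv (a b T : ℝ) (u : ℝ → ℝ → ℝ) (i m : ℕ) (x t : ℝ) : ℝ :=
  (dirDeriv (rect a b T) (0, 1))^[m]
    ((dirDeriv (rect a b T) (1, 0))^[i] fun p => u p.1 p.2) (x, t)

variable {u : ℝ → ℝ → ℝ}

theorem spaceDeriv_contDiffOn (hab : a < b) (hT : 0 < T)
    (hu : ContDiffOn ℝ 6 (fun p : ℝ × ℝ => u p.1 p.2) (rect a b T)) {i n : ℕ} (hin : n + i = 6) :
    ContDiffOn ℝ n ((dirDeriv (rect a b T) (1, 0))^[i] fun p => u p.1 p.2) (rect a b T) := by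
  refine contDiffOn_iterate_dirDeriv (uniqueDiffOn_rect hab hT) _ i ?_
  rw [hin]
  exact hu

theorem hasDerivWithinAt_spaceDeriv (hab : a < b) (hT : 0 < T)
    (hu : ContDiffOn ℝ 6 (fun p : ℝ × ℝ => u p.1 p.2) (rect a b T)) {t : ℝ}
    (ht : t ∈ Set.Icc 0 T) {i : ℕ} (hi : i < 6) {x : ℝ} (hx : x ∈ Set.Icc a b) :
    HasDerivWithinAt (fun y => spaceDeriv a b T u i y t) (spaceDeriv a b T u (i + 1) x t)
      (Set.Icc a b) x := by
  have h := spaceDeriv_contDiffOn hab hT hu (i := i) (n := 5 - i + 1) (by omega)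
  have h2 := hasDerivWithinAt_slice h (1, 0) (x, t) (I := Set.Icc a b) (γ := fun y => (y, t)) (x := x)
    ((hasDerivAt_id x).prodMk (hasDerivAt_const x t)) (fun y hy => ⟨hy, ht⟩) rfl ⟨hx, ht⟩
  refine h2.congr_deriv ?_
  rw [spaceDeriv, Function.iterate_succ_apply']

/-- Iterated directional derivatives within the rectangle are continuous up to its boundary, so
compactness gives one bound for all times. On slices they agree with the iterated derivatives in the
boundary conditions. -/
theorem exists_isProfile (hab : a < b) (hT : 0 < T)
    (hu : ContDiffOn ℝ 6 (fun p : ℝ × ℝ => u p.1 p.2) (rect a b T))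
    (hl : ∀ t ∈ Set.Icc 0 T, ∀ m < 4, iteratedDerivWithin m (fun y => u y t) (Set.Icc a b) a = 0)
    (hr : ∀ t ∈ Set.Icc 0 T, ∀ m < 4, iteratedDerivWithin m (fun y => u y t) (Set.Icc a b) b = 0) :
    ∃ B : ℝ, 0 ≤ B ∧ ∀ t ∈ Set.Icc 0 T, IsProfile a b B fun i x => spaceDeriv a b T u i x t := by
  have hbd : ∀ i : ℕ, ∃ B : ℝ, 0 ≤ B ∧ (i ≤ 6 → ∀ x ∈ Set.Icc a b, ∀ t ∈ Set.Icc 0 T,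
      |spaceDeriv a b T u i x t| ≤ B) := by
    intro i
    by_cases hi : i ≤ 6
    · obtain ⟨B, h0, hB⟩ := exists_bound_rect
        (spaceDeriv_contDiffOn hab hT hu (i := i) (n := 6 - i) (by omega)).continuousOn
      exact ⟨B, h0, fun _ => hB⟩
    · exact ⟨0, le_rfl, fun h => absurd h hi⟩
  choose B hB0 hB using hbd
  refine ⟨∑ i ∈ Finset.range 7, B i, Finset.sum_nonneg fun i _ => hB0 i, fun t ht => ?_⟩
  have hd : ∀ i < 6, ∀ x ∈ Set.Icc a b, HasDerivWithinAt (fun y => spaceDeriv a b T u i y t)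
      (spaceDeriv a b T u (i + 1) x t) (Set.Icc a b) x :=
    fun i hi x hx => hasDerivWithinAt_spaceDeriv hab hT hu ht hi hx
  have he : ∀ i < 4, ∀ x ∈ Set.Icc a b,
      iteratedDerivWithin i (fun y => u y t) (Set.Icc a b) x = spaceDeriv a b T u i x t :=
    fun i hi => iteratedDerivWithin_eq_of_hasDerivWithinAt (uniqueDiffOn_Icc hab)
      (f := fun i y => spaceDeriv a b T u i y t) i fun j hj => hd j (by omega)
  refine ⟨hd, fun i hi x hx => ?_, fun i hi => ?_, fun i hi => ?_⟩
  · exact (hB i hi x hx t ht).trans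
      (Finset.single_le_sum (fun i _ => hB0 i) (Finset.mem_range.2 (by omega)))
  · rw [← he i hi a ⟨le_rfl, hab.le⟩]; exact hl t ht i hi
  · rw [← he i hi b ⟨hab.le, le_rfl⟩]; exact hr t ht i hi

theorem exists_time_taylor (hab : a < b) (hT : 0 < T)
    (hu : ContDiffOn ℝ 6 (fun p : ℝ × ℝ => u p.1 p.2) (rect a b T)) (i n : ℕ) (hin : i + n ≤ 6) :
    ∃ B : ℝ, 0 ≤ B ∧ ∀ x ∈ Set.Icc a b, ∀ t ∈ Set.Icc 0 T, ∀ r ∈ Set.Icc 0 T,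
      |spaceDeriv a b T u i x r -
        ∑ m ∈ Finset.range n, timeDeriv a b T u i m x t * ((r - t) ^ m / m.factorial)| ≤
        B * |r - t| ^ n := by
  have hS := uniqueDiffOn_rect hab hT
  have hw := spaceDeriv_contDiffOn hab hT hu (i := i) (n := 6 - i) (by omega)
  have hm : ∀ m k : ℕ, k + m ≤ 6 - i → ContDiffOn ℝ k ((dirDeriv (rect a b T) (0, 1))^[m]
      ((dirDeriv (rect a b T) (1, 0))^[i] fun p => u p.1 p.2)) (rect a b T) := fun m k hk =>
    contDiffOn_iterate_dirDeriv hS _ m (hw.of_le (by exact_mod_cast hk))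
  obtain ⟨B, hB0, hB⟩ := exists_bound_rect (hm n 0 (by omega)).continuousOn
  refine ⟨B, hB0, fun x hx t ht r hr => ?_⟩
  refine abs_sub_taylor_le n (f := fun m t => timeDeriv a b T u i m x t) (fun m hmn t ht => ?_)
    (fun t ht => hB x hx t ht) t ht r hr
  have h2 := hasDerivWithinAt_slice (hm m (0 + 1) (by omega)) (0, 1) (x, t) (I := Set.Icc 0 T)
    (γ := fun r => (x, r)) (x := t)
    ((hasDerivAt_const t x).prodMk (hasDerivAt_id t)) (fun y hy => ⟨hx, hy⟩) rfl ⟨hx, ht⟩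
  refine h2.congr_deriv ?_
  rw [timeDeriv, Function.iterate_succ_apply']

theorem hasDerivWithinAt_time
    (hu : ContDiffOn ℝ 6 (fun p : ℝ × ℝ => u p.1 p.2) (rect a b T)) {x t : ℝ}
    (hx : x ∈ Set.Icc a b) (ht : t ∈ Set.Icc 0 T) :
    HasDerivWithinAt (fun r => u x r) (timeDeriv a b T u 0 1 x t) (Set.Icc 0 T) t :=
  hasDerivWithinAt_slice (n := 5) hu (0, 1) (x, t) (I := Set.Icc 0 T) (γ := fun r => (x, r)) (x := t)
    ((hasDerivAt_const t x).prodMk (hasDerivAt_id t)) (fun _ hy => ⟨hx, hy⟩) rfl ⟨hx, ht⟩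

theorem continuousOn_timeDeriv_one (hab : a < b) (hT : 0 < T)
    (hu : ContDiffOn ℝ 6 (fun p : ℝ × ℝ => u p.1 p.2) (rect a b T)) {t : ℝ} (ht : t ∈ Set.Icc 0 T) :
    ContinuousOn (fun x => timeDeriv a b T u 0 1 x t) (Set.Icc a b) := by
  have h := (ContDiffOn.dirDeriv (n := 5) (uniqueDiffOn_rect hab hT) hu (0, 1)).continuousOn
  exact h.comp (f := fun x => (x, t)) (by fun_prop) fun x hx => ⟨hx, ht⟩

end Rectangle

/-- The equation holds up to the lateral boundary, in terms of the derivatives within the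
rectangle. -/
theorem IsRegularSolution.source_eq {α d₁ d₂ dα a b T : ℝ} {φ : ℝ → ℝ} {s u : ℝ → ℝ → ℝ}
    (hab : a < b) (hT : 0 < T) (h1 : α < 1) (h : IsRegularSolution α d₁ d₂ dα a b T φ s u) {t : ℝ}
    (ht : t ∈ Set.Ioo 0 T) {x : ℝ} (hx : x ∈ Set.Icc a b) :
    s x t = timeDeriv a b T u 0 1 x t -
      spaceLim α d₁ d₂ dα a b (fun i x => spaceDeriv a b T u i x t) x := by
  have ht' : t ∈ Set.Icc 0 T := ⟨ht.1.le, ht.2.le⟩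
  obtain ⟨B, -, hB⟩ := exists_isProfile hab hT h.contDiffOn h.left_vanish h.right_vanish
  have hp := hB t ht'
  have hin : Set.EqOn (fun x => s x t) (fun x => timeDeriv a b T u 0 1 x t -
      spaceLim α d₁ d₂ dα a b (fun i x => spaceDeriv a b T u i x t) x) (Set.Ioo a b) := by
    intro y hy
    have hd : ∀ i < 6, ∀ z ∈ Set.Ioo a b,
        HasDerivAt (fun x => spaceDeriv a b T u i x t) (spaceDeriv a b T u (i + 1) z t) z :=
      fun i hi z hz => (hp.hasDeriv i hi z ⟨hz.1.le, hz.2.le⟩).hasDerivAt (Icc_mem_nhds hz.1 hz.2)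
    have e1 : deriv (fun r => u y r) t = timeDeriv a b T u 0 1 y t :=
      ((hasDerivWithinAt_time h.contDiffOn ⟨hy.1.le, hy.2.le⟩ ht').hasDerivAt
        (Icc_mem_nhds ht.1 ht.2)).deriv
    have e2 : deriv (fun x => u x t) y = spaceDeriv a b T u 1 y t := (hd 0 (by norm_num) y hy).deriv
    have e3 : iteratedDeriv 2 (fun x => u x t) y = spaceDeriv a b T u 2 y t := by
      rw [iteratedDeriv_succ, iteratedDeriv_one]
      have he : deriv (fun x => u x t) =ᶠ[𝓝 y] fun x => spaceDeriv a b T u 1 x t := by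
        filter_upwards [Ioo_mem_nhds hy.1 hy.2] with z hz using (hd 0 (by norm_num) z hz).deriv
      rw [he.deriv_eq]
      exact (hd 1 (by norm_num) y hy).deriv
    have e4 : leftRL a α (fun x => u x t) y = leftInt a b α (fun x => spaceDeriv a b T u 4 x t) y :=
      hp.leftRL_eq h1 hy
    have e5 : rightRL b α (fun x => u x t) y = rightInt a b α (fun x => spaceDeriv a b T u 4 x t) y :=
      hp.rightRL_eq h1 hy
    have e := h.pde y hy t ht
    rw [e1, e2, e3, rieszDeriv, e4, e5] at e
    simp only [spaceLim]
    rw [e]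
    ring
  have hc1 : ContinuousOn (fun x => s x t) (Set.Icc a b) :=
    h.source_continuousOn.comp (f := fun x => (x, t)) (by fun_prop) fun x hx => ⟨hx, ht'⟩
  have hc4 : ContinuousOn (fun x => spaceDeriv a b T u 4 x t) (Set.Icc a b) :=
    hp.continuousOn (by norm_num)
  have hc2 : ContinuousOn (fun x => timeDeriv a b T u 0 1 x t -
      spaceLim α d₁ d₂ dα a b (fun i x => spaceDeriv a b T u i x t) x) (Set.Icc a b) := by
    refine (continuousOn_timeDeriv_one hab hT h.contDiffOn ht').sub ?_
    refine (((hp.continuousOn (i := 2) (by norm_num)).const_smul d₂).sub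
      ((hp.continuousOn (i := 1) (by norm_num)).const_smul d₁)).sub ?_
    exact (continuous_const.mul ((continuous_leftInt hab.le h1 hc4).add
      (continuous_rightInt hab.le h1 hc4))).continuousOn
  exact hin.of_subset_closure hc1 hc2 Set.Ioo_subset_Icc_self
    (by rw [closure_Ioo hab.ne]) hx

end RieszDiffusion
end

/-! ### Errors of the midpoint rule in time. -/

noncomputable section
namespace RieszDiffusion

open Finset Filter Topology

theorem abs_leftInt_le {a b α ε : ℝ} (hab : a ≤ b) (h1 : α < 1) {g : ℝ → ℝ}
    (hg : ∀ y ∈ Set.Icc a b, |g y| ≤ ε) {x : ℝ} (hx : x ∈ Set.Icc a b) :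
    |leftInt a b α g x| ≤ 1 / Real.Gamma (4 - α) * ((b - a) ^ (3 - α) * (b - a)) * ε := by
  have hG := Real.Gamma_pos_of_pos (by linarith : 0 < 4 - α)
  have h := intervalIntegral.norm_integral_le_of_norm_le_const (a := a) (b := b)
    (f := fun y => max (x - y) 0 ^ (3 - α) * g y) (C := (b - a) ^ (3 - α) * ε) fun y hy => by
      rw [Set.uIoc_of_le hab] at hy
      rw [norm_mul, Real.norm_eq_abs, Real.norm_eq_abs,
        abs_of_nonneg (Real.rpow_nonneg (le_max_right _ _) _)]
      refine mul_le_mul (Real.rpow_le_rpow (le_max_right _ _) (max_le ?_ ?_) (by linarith))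
        (hg y ⟨hy.1.le, hy.2⟩) (abs_nonneg _) (Real.rpow_nonneg (by linarith) _)
      · linarith [hx.2, hy.1]
      · linarith
  rw [abs_of_nonneg (by linarith : 0 ≤ b - a), Real.norm_eq_abs] at h
  rw [leftInt, abs_mul, abs_of_pos (by positivity : 0 < 1 / Real.Gamma (4 - α)), mul_assoc]
  exact mul_le_mul_of_nonneg_left (h.trans (le_of_eq (by ring))) (by positivity)

theorem leftInt_mid {a b α : ℝ} (hab : a ≤ b) (h1 : α < 1) {g₁ g₂ g₃ : ℝ → ℝ}
    (h₁ : ContinuousOn g₁ (Set.Icc a b)) (h₂ : ContinuousOn g₂ (Set.Icc a b))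
    (h₃ : ContinuousOn g₃ (Set.Icc a b)) (x : ℝ) :
    leftInt a b α (fun y => g₁ y - (g₂ y + g₃ y) / 2) x =
      leftInt a b α g₁ x - (leftInt a b α g₂ x + leftInt a b α g₃ x) / 2 := by
  have hi : ∀ {g : ℝ → ℝ}, ContinuousOn g (Set.Icc a b) → IntervalIntegrable
      (fun y => max (x - y) 0 ^ (3 - α) * g y) MeasureTheory.volume a b := fun {g} hg => by
    refine ContinuousOn.intervalIntegrable ?_
    rw [Set.uIcc_of_le hab]
    exact ((continuous_max_rpow (by linarith : 0 ≤ 3 - α)).comp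
      (continuous_sub_left x)).continuousOn.mul hg
  have e : ∫ y in a..b, max (x - y) 0 ^ (3 - α) * (g₁ y - (g₂ y + g₃ y) / 2) =
      (∫ y in a..b, max (x - y) 0 ^ (3 - α) * g₁ y) -
        ((∫ y in a..b, max (x - y) 0 ^ (3 - α) * g₂ y) +
          ∫ y in a..b, max (x - y) 0 ^ (3 - α) * g₃ y) / 2 := by
    rw [← intervalIntegral.integral_add (hi h₂) (hi h₃), ← intervalIntegral.integral_div,
      ← intervalIntegral.integral_sub (hi h₁) (((hi h₂).add (hi h₃)).div_const 2)]
    exact intervalIntegral.integral_congr fun y _ => by ring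
  rw [leftInt, e, leftInt, leftInt, leftInt]
  ring

theorem abs_leftInt_mid_le {a b α ε : ℝ} (hab : a ≤ b) (h1 : α < 1) {g₁ g₂ g₃ : ℝ → ℝ}
    (h₁ : ContinuousOn g₁ (Set.Icc a b)) (h₂ : ContinuousOn g₂ (Set.Icc a b))
    (h₃ : ContinuousOn g₃ (Set.Icc a b))
    (hg : ∀ y ∈ Set.Icc a b, |g₁ y - (g₂ y + g₃ y) / 2| ≤ ε) {x : ℝ} (hx : x ∈ Set.Icc a b) :
    |leftInt a b α g₁ x - (leftInt a b α g₂ x + leftInt a b α g₃ x) / 2| ≤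
      1 / Real.Gamma (4 - α) * ((b - a) ^ (3 - α) * (b - a)) * ε := by
  rw [← leftInt_mid hab h1 h₁ h₂ h₃]
  exact abs_leftInt_le hab h1 hg hx

theorem abs_rightInt_mid_le {a b α ε : ℝ} (hab : a ≤ b) (h1 : α < 1) {g₁ g₂ g₃ : ℝ → ℝ}
    (h₁ : ContinuousOn g₁ (Set.Icc a b)) (h₂ : ContinuousOn g₂ (Set.Icc a b))
    (h₃ : ContinuousOn g₃ (Set.Icc a b))
    (hg : ∀ y ∈ Set.Icc a b, |g₁ y - (g₂ y + g₃ y) / 2| ≤ ε) {x : ℝ} (hx : x ∈ Set.Icc a b) :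
    |rightInt a b α g₁ x - (rightInt a b α g₂ x + rightInt a b α g₃ x) / 2| ≤
      1 / Real.Gamma (4 - α) * ((b - a) ^ (3 - α) * (b - a)) * ε := by
  have hm : ∀ y ∈ Set.Icc a b, a + b - y ∈ Set.Icc a b := fun y hy =>
    ⟨by linarith [hy.2], by linarith [hy.1]⟩
  have hc := (continuous_sub_left (a + b)).continuousOn (s := Set.Icc a b)
  rw [rightInt_eq, rightInt_eq, rightInt_eq]
  exact abs_leftInt_mid_le hab h1 (h₁.comp hc hm) (h₂.comp hc hm) (h₃.comp hc hm)
    (fun y hy => hg _ (hm y hy)) (hm x hx)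

/-- The limit operator is linear and bounded in terms of the derivatives of orders 1, 2 and 4, so it
inherits the midpoint error of these derivatives. -/
theorem abs_spaceLim_mid_le {α d₁ d₂ a b B₁ B₂ B₃ ε : ℝ} (dα : ℝ) (hab : a ≤ b) (h1 : α < 1)
    (hd₁ : 0 < d₁) (hd₂ : 0 < d₂) {f g k : ℕ → ℝ → ℝ} (hf : IsProfile a b B₁ f)
    (hg : IsProfile a b B₂ g) (hk : IsProfile a b B₃ k)
    (h : ∀ i ≤ 4, ∀ y ∈ Set.Icc a b, |f i y - (g i y + k i y) / 2| ≤ ε) {x : ℝ}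
    (hx : x ∈ Set.Icc a b) :
    |spaceLim α d₁ d₂ dα a b f x -
      (spaceLim α d₁ d₂ dα a b g x + spaceLim α d₁ d₂ dα a b k x) / 2| ≤
      (d₂ + d₁ + |dα / (2 * Real.cos (Real.pi * α / 2))| *
        (2 * (1 / Real.Gamma (4 - α) * ((b - a) ^ (3 - α) * (b - a))))) * ε := by
  have c1 := hf.continuousOn (i := 4) (by norm_num)
  have c2 := hg.continuousOn (i := 4) (by norm_num)
  have c3 := hk.continuousOn (i := 4) (by norm_num)
  have k1 := abs_leftInt_mid_le hab h1 c1 c2 c3 (h 4 le_rfl) hx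
  have k2 := abs_rightInt_mid_le hab h1 c1 c2 c3 (h 4 le_rfl) hx
  have k3 := h 1 (by norm_num) x hx
  have k4 := h 2 (by norm_num) x hx
  set A := 1 / Real.Gamma (4 - α) * ((b - a) ^ (3 - α) * (b - a))
  set κ := dα / (2 * Real.cos (Real.pi * α / 2)) with hκ
  have hid : spaceLim α d₁ d₂ dα a b f x -
      (spaceLim α d₁ d₂ dα a b g x + spaceLim α d₁ d₂ dα a b k x) / 2 =
      d₂ * (f 2 x - (g 2 x + k 2 x) / 2) - d₁ * (f 1 x - (g 1 x + k 1 x) / 2) -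
      κ * ((leftInt a b α (f 4) x - (leftInt a b α (g 4) x + leftInt a b α (k 4) x) / 2) +
        (rightInt a b α (f 4) x - (rightInt a b α (g 4) x + rightInt a b α (k 4) x) / 2)) := by
    simp only [spaceLim, ← hκ]
    ring
  rw [hid]
  refine (abs_sub _ _).trans ((add_le_add_left (abs_sub _ _) _).trans ?_)
  rw [abs_mul, abs_mul, abs_mul, abs_of_pos hd₁, abs_of_pos hd₂]
  have k5 := mul_le_mul_of_nonneg_left ((abs_add_le _ _).trans (add_le_add k1 k2)) (abs_nonneg κ)
  have k6 := mul_le_mul_of_nonneg_left k3 hd₁.le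
  have k7 := mul_le_mul_of_nonneg_left k4 hd₂.le
  linarith

variable {a b T : ℝ} {u : ℝ → ℝ → ℝ}

/-- In the average of the values at t ± δ the first-order terms cancel. Two time derivatives on top
of four space derivatives use up the C⁶ regularity. -/
theorem exists_mid_error_le (hab : a < b) (hT : 0 < T)
    (hu : ContDiffOn ℝ 6 (fun p : ℝ × ℝ => u p.1 p.2) (rect a b T)) :
    ∃ B : ℝ, 0 ≤ B ∧ ∀ i ≤ 4, ∀ x ∈ Set.Icc a b, ∀ t δ : ℝ, 0 ≤ δ → t - δ ∈ Set.Icc 0 T →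
      t ∈ Set.Icc 0 T → t + δ ∈ Set.Icc 0 T →
      |spaceDeriv a b T u i x t -
        (spaceDeriv a b T u i x (t + δ) + spaceDeriv a b T u i x (t - δ)) / 2| ≤ B * δ ^ 2 := by
  have h : ∀ i : ℕ, ∃ B : ℝ, 0 ≤ B ∧ (i ≤ 4 → ∀ x ∈ Set.Icc a b, ∀ t ∈ Set.Icc 0 T, ∀ r ∈ Set.Icc 0 T,
      |spaceDeriv a b T u i x r -
        ∑ m ∈ Finset.range 2, timeDeriv a b T u i m x t * ((r - t) ^ m / m.factorial)| ≤
        B * |r - t| ^ 2) := by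
    intro i
    by_cases hi : i ≤ 4
    · obtain ⟨B, h0, hB⟩ := exists_time_taylor hab hT hu i 2 (by omega)
      exact ⟨B, h0, fun _ => hB⟩
    · exact ⟨0, le_rfl, fun h => absurd h hi⟩
  choose B hB0 hB using h
  refine ⟨∑ i ∈ Finset.range 5, B i, Finset.sum_nonneg fun i _ => hB0 i,
    fun i hi x hx t δ hδ htm ht htp => ?_⟩
  have k1 := hB i hi x hx t ht (t - δ) htm
  have k2 := hB i hi x hx t ht (t + δ) htp
  simp only [Finset.sum_range_succ, Finset.sum_range_zero, Nat.factorial, pow_zero, pow_one,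
    Nat.cast_one, div_one, mul_one, zero_add, sq_abs] at k1 k2
  have k0 : timeDeriv a b T u i 0 x t = spaceDeriv a b T u i x t := rfl
  rw [k0, show t - δ - t = -δ by ring, neg_sq] at k1
  rw [k0, show t + δ - t = δ by ring] at k2
  have k3 := Finset.single_le_sum (fun i _ => hB0 i) (Finset.mem_range.2 (by omega : i < 5))
  have k4 := mul_le_mul_of_nonneg_right k3 (sq_nonneg δ)
  rw [abs_le] at k1 k2 ⊢
  norm_num at k1 k2
  constructor <;> linarith

/-- The even terms cancel in the central difference, and the third-order remainder is divided by 2δ.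
-/
theorem exists_diff_quotient_error_le (hab : a < b) (hT : 0 < T)
    (hu : ContDiffOn ℝ 6 (fun p : ℝ × ℝ => u p.1 p.2) (rect a b T)) :
    ∃ B : ℝ, 0 ≤ B ∧ ∀ x ∈ Set.Icc a b, ∀ t δ : ℝ, 0 < δ → t - δ ∈ Set.Icc 0 T →
      t ∈ Set.Icc 0 T → t + δ ∈ Set.Icc 0 T →
      |(u x (t + δ) - u x (t - δ)) / (2 * δ) - timeDeriv a b T u 0 1 x t| ≤ B * δ ^ 2 := by
  obtain ⟨B, hB0, hB⟩ := exists_time_taylor hab hT hu 0 3 (by norm_num)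
  refine ⟨B, hB0, fun x hx t δ hδ htm ht htp => ?_⟩
  have k1 := hB x hx t ht (t - δ) htm
  have k2 := hB x hx t ht (t + δ) htp
  rw [show t - δ - t = -δ by ring, abs_neg, abs_of_pos hδ] at k1
  rw [show t + δ - t = δ by ring, abs_of_pos hδ] at k2
  simp only [Finset.sum_range_succ, Finset.sum_range_zero, Nat.factorial, pow_zero, pow_one,
    Nat.cast_one, div_one, mul_one, zero_add, neg_sq] at k1 k2
  have e1 : spaceDeriv a b T u 0 x (t + δ) = u x (t + δ) := rfl
  have e2 : spaceDeriv a b T u 0 x (t - δ) = u x (t - δ) := rfl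
  rw [e1] at k2
  rw [e2] at k1
  have e : (u x (t + δ) - u x (t - δ)) / (2 * δ) - timeDeriv a b T u 0 1 x t =
      (u x (t + δ) - u x (t - δ) - 2 * δ * timeDeriv a b T u 0 1 x t) / (2 * δ) := by
    field_simp
  rw [e, abs_div, abs_of_pos (by positivity : 0 < 2 * δ), div_le_iff₀ (by positivity)]
  rw [abs_le] at k1 k2 ⊢
  constructor <;> nlinarith

end RieszDiffusion
end

/-! ### Truncation error of the scheme and convergence. -/

noncomputable section
namespace RieszDiffusion

open Finset Filter Topology

theorem exists_residual_le {α d₁ d₂ dα a b T : ℝ} {φ : ℝ → ℝ} {s u : ℝ → ℝ → ℝ} (h0 : 0 < α)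
    (h1 : α < 1) (hd₁ : 0 < d₁) (hd₂ : 0 < d₂) (hab : a < b) (hT : 0 < T)
    (hu : IsRegularSolution α d₁ d₂ dα a b T φ s u) :
    ∃ C : ℝ, 0 ≤ C ∧ ∀ M N : ℕ, 0 < M → 0 < N → ∀ k < N, ∃ f : ℕ → ℝ,
      IsStep α d₁ d₂ dα (T / N) ((b - a) / M) M f
        (gridFun a ((b - a) / M) M fun x => u x ((k + 1 : ℕ) * (T / N)))
        (gridFun a ((b - a) / M) M fun x => u x (k * (T / N))) ∧
      (b - a) / M * ∑ j ∈ Finset.Ico 1 M, |f j - avg d₁ d₂ ((b - a) / M)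
        (fun j : ℤ => s (a + j * ((b - a) / M)) (((k : ℝ) + 1 / 2) * (T / N))) j| ≤
        C * ((T / N) ^ 2 + ((b - a) / M) ^ 4) := by
  obtain ⟨B₁, hB₁, hprof⟩ := exists_isProfile hab hT hu.contDiffOn hu.left_vanish hu.right_vanish
  obtain ⟨B₂, hB₂, hmid⟩ := exists_mid_error_le hab hT hu.contDiffOn
  obtain ⟨B₃, hB₃, hquot⟩ := exists_diff_quotient_error_le hab hT hu.contDiffOn
  obtain ⟨Cs, hCs, hspace⟩ := exists_space_consistency hab h0 h1 hd₁ hd₂ dα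
  set L := b - a with hLdef
  have hL0 : 0 < L := by rw [hLdef]; linarith
  set A := d₂ + d₁ + |dα / (2 * Real.cos (Real.pi * α / 2))| *
    (2 * (1 / Real.Gamma (4 - α) * (L ^ (3 - α) * L))) with hA
  have hA0 : 0 ≤ A := by
    have := Real.Gamma_pos_of_pos (by linarith : 0 < 4 - α)
    have := Real.rpow_nonneg hL0.le (3 - α)
    positivity
  refine ⟨Cs * B₁ + (1 + d₁ * L / d₂) * (L * (B₃ + A * B₂)), by positivity,
    fun M N hM hN k hk => ?_⟩
  have hMpos : (0 : ℝ) < M := by exact_mod_cast hM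
  have hNpos : (0 : ℝ) < N := by exact_mod_cast hN
  have hM1 : (1 : ℝ) ≤ M := by exact_mod_cast hM
  have hh : 0 < L / M := by positivity
  have hMh : M * (L / M) = L := mul_div_cancel₀ _ hMpos.ne'
  have hhL : L / M ≤ L := div_le_self hL0.le hM1
  have hτ : 0 < T / N := by positivity
  have hNτ : N * (T / N) = T := mul_div_cancel₀ _ hNpos.ne'
  have hsp := fun t ht => hspace M B₁ _ hM (hprof t ht)
  set h := L / M
  set τ := T / N
  have hb : a + M * h = b := by rw [hMh, hLdef]; ring
  have hk1 : ((k + 1 : ℕ) : ℝ) ≤ N := by exact_mod_cast hk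
  have hkτ : ((k + 1 : ℕ) : ℝ) * τ ≤ T := by
    rw [← hNτ]; exact mul_le_mul_of_nonneg_right hk1 hτ.le
  have hk0 : (0 : ℝ) ≤ k * τ := by positivity
  push_cast at hkτ
  set t := ((k : ℝ) + 1 / 2) * τ with ht
  have et1 : ((k + 1 : ℕ) : ℝ) * τ = t + τ / 2 := by rw [ht]; push_cast; ring
  have et0 : (k : ℝ) * τ = t - τ / 2 := by rw [ht]; ring
  have m0 : t - τ / 2 ∈ Set.Icc 0 T := ⟨by rw [← et0]; exact hk0, by rw [ht]; linarith⟩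
  have m1 : t + τ / 2 ∈ Set.Icc 0 T := ⟨by linarith [m0.1], by rw [ht]; linarith⟩
  have mh : t ∈ Set.Ioo 0 T := ⟨by linarith [m0.1], by linarith [m1.2]⟩
  have mh' : t ∈ Set.Icc 0 T := ⟨mh.1.le, mh.2.le⟩
  rw [et1, et0]
  set W := gridFun a h M fun x => u x (t + τ / 2)
  set V := gridFun a h M fun x => u x (t - τ / 2)
  let S : ℝ → ℝ → ℝ := fun t x => spaceLim α d₁ d₂ dα a b (fun i x => spaceDeriv a b T u i x t) x
  -- P is the time truncation error before averaging. Replacing s by u_t minus the limit operator at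
  -- the midpoint leaves the errors of the central difference and of the time average. Averages need
  -- P also at nodes 0 and M, where the equation holds by `IsRegularSolution.source_eq`.
  let P : ℤ → ℝ := fun i => (W i - V i) / τ - s (a + i * h) t -
    (S (t + τ / 2) (a + i * h) + S (t - τ / 2) (a + i * h)) / 2
  -- The residual is defined by solving the step equation for it, so only its distance to the
  -- averaged source has to be estimated.
  refine ⟨fun j => (2 / τ * (avg d₁ d₂ h W j - avg d₁ d₂ h V j) -
    spaceOp α d₁ d₂ dα h M W j - spaceOp α d₁ d₂ dα h M V j) / 2, fun j _ _ => by ring, ?_⟩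
  have hPb : ∀ n ∈ Finset.range (M + 1), |P n| ≤ (B₃ + A * B₂) * (τ / 2) ^ 2 := by
    intro n hn
    have hn' : n ≤ M := Nat.lt_succ_iff.1 (Finset.mem_range.1 hn)
    have hx : a + ((n : ℤ) : ℝ) * h ∈ Set.Icc a b := by
      have h1 : (n : ℝ) ≤ M := by exact_mod_cast hn'
      have := mul_le_mul_of_nonneg_right h1 hh.le
      have : 0 ≤ n * h := by positivity
      rw [Int.cast_natCast]
      exact ⟨by linarith, by linarith⟩
    have hbd : ∀ t ∈ Set.Icc 0 T, u a t = 0 ∧ u b t = 0 := fun t ht =>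
      ⟨(hprof t ht).left 0 (by norm_num), (hprof t ht).right 0 (by norm_num)⟩
    have eW : W n = u (a + ((n : ℤ) : ℝ) * h) (t + τ / 2) :=
      gridFun_eq hb (hbd _ m1).1 (hbd _ m1).2 (by omega) (by omega)
    have eV : V n = u (a + ((n : ℤ) : ℝ) * h) (t - τ / 2) :=
      gridFun_eq hb (hbd _ m0).1 (hbd _ m0).2 (by omega) (by omega)
    have k1 := hquot _ hx t (τ / 2) (by positivity) m0 mh' m1
    have k2 := abs_spaceLim_mid_le dα hab.le h1 hd₁ hd₂ (hprof t mh') (hprof _ m1) (hprof _ m0)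
      (fun i hi y hy => hmid i hi y hy t (τ / 2) (by positivity) m0 mh' m1) hx
    rw [mul_div_cancel₀ _ (two_ne_zero : (2 : ℝ) ≠ 0)] at k1
    have e : P n = ((u (a + ((n : ℤ) : ℝ) * h) (t + τ / 2) - u (a + ((n : ℤ) : ℝ) * h) (t - τ / 2)) / τ -
        timeDeriv a b T u 0 1 (a + ((n : ℤ) : ℝ) * h) t) +
        (S t (a + ((n : ℤ) : ℝ) * h) -
          (S (t + τ / 2) (a + ((n : ℤ) : ℝ) * h) + S (t - τ / 2) (a + ((n : ℤ) : ℝ) * h)) / 2) := by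
      simp only [P]
      rw [eW, eV, hu.source_eq hab hT h1 mh hx]
      simp only [S]
      ring
    rw [e]
    refine (abs_add_le _ _).trans ((add_le_add k1 k2).trans (le_of_eq ?_))
    ring
  have hpt : ∀ j ∈ Finset.Ico 1 M, |(2 / τ * (avg d₁ d₂ h W j - avg d₁ d₂ h V j) -
      spaceOp α d₁ d₂ dα h M W j - spaceOp α d₁ d₂ dα h M V j) / 2 -
      avg d₁ d₂ h (fun j : ℤ => s (a + j * h) t) j| ≤
      |avg d₁ d₂ h P j| +
      (|spaceOp α d₁ d₂ dα h M W j - avg d₁ d₂ h (fun i => S (t + τ / 2) (a + i * h)) j| / 2 +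
      |spaceOp α d₁ d₂ dα h M V j - avg d₁ d₂ h (fun i => S (t - τ / 2) (a + i * h)) j| / 2) := by
    intro j _
    have e : (2 / τ * (avg d₁ d₂ h W j - avg d₁ d₂ h V j) -
      spaceOp α d₁ d₂ dα h M W j - spaceOp α d₁ d₂ dα h M V j) / 2 -
      avg d₁ d₂ h (fun j : ℤ => s (a + j * h) t) j =
      avg d₁ d₂ h P j -
      ((spaceOp α d₁ d₂ dα h M W j - avg d₁ d₂ h (fun i => S (t + τ / 2) (a + i * h)) j) +
      (spaceOp α d₁ d₂ dα h M V j - avg d₁ d₂ h (fun i => S (t - τ / 2) (a + i * h)) j)) / 2 := by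
      simp only [avg, stencil, smul_eq_mul, P]
      ring
    rw [e, ← add_div]
    refine (abs_sub _ _).trans (add_le_add_right ?_ _)
    rw [abs_div, abs_two]
    exact div_le_div_of_nonneg_right (abs_add_le _ _) two_pos.le
  refine (mul_le_mul_of_nonneg_left (Finset.sum_le_sum hpt) hh.le).trans ?_
  rw [Finset.sum_add_distrib, Finset.sum_add_distrib, ← Finset.sum_div, ← Finset.sum_div]
  have k1 := hsp _ m1
  have k2 := hsp _ m0
  have k3 : h * ∑ j ∈ Finset.Ico 1 M, |avg d₁ d₂ h P j| ≤
      (1 + d₁ * L / d₂) * (L * (B₃ + A * B₂)) * τ ^ 2 := by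
    have s1 := sum_abs_stencil_le (M := M) (a₁ d₁ d₂ h) a₂ (a₃ d₁ d₂ h) P
    have s2 := abs_avg_coeff_le hd₁ hd₂ hh hhL
    have s3 := Finset.sum_le_card_nsmul _ _ _ hPb
    rw [Finset.card_range, nsmul_eq_mul] at s3
    push_cast at s3
    have s4 : h * (M + 1) ≤ 2 * L := by rw [← hMh]; nlinarith
    have hc : 0 ≤ B₃ + A * B₂ := by positivity
    calc h * ∑ j ∈ Finset.Ico 1 M, |avg d₁ d₂ h P j|
        ≤ h * ((1 + d₁ * L / d₂) * ((M + 1) * ((B₃ + A * B₂) * (τ / 2) ^ 2))) := by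
          refine mul_le_mul_of_nonneg_left (s1.trans ?_) hh.le
          exact mul_le_mul s2 s3 (Finset.sum_nonneg fun _ _ => abs_nonneg _) (by positivity)
      _ = (1 + d₁ * L / d₂) * ((h * (M + 1)) * ((B₃ + A * B₂) * (τ / 2) ^ 2)) := by ring
      _ ≤ (1 + d₁ * L / d₂) * ((2 * L) * ((B₃ + A * B₂) * (τ / 2) ^ 2)) := by gcongr
      _ = 1 / 2 * ((1 + d₁ * L / d₂) * (L * (B₃ + A * B₂)) * τ ^ 2) := by ring
      _ ≤ _ := by
          have : 0 ≤ (1 + d₁ * L / d₂) * (L * (B₃ + A * B₂)) * τ ^ 2 := by positivity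
          linarith
  have k4 : 0 ≤ Cs * B₁ * τ ^ 2 := by positivity
  have k5 : 0 ≤ (1 + d₁ * L / d₂) * (L * (B₃ + A * B₂)) * h ^ 4 := by positivity
  have k1' : h * ∑ j ∈ Finset.Ico 1 M, |spaceOp α d₁ d₂ dα h M W j -
      avg d₁ d₂ h (fun i => S (t + τ / 2) (a + i * h)) j| ≤ Cs * B₁ * h ^ 4 := k1
  have k2' : h * ∑ j ∈ Finset.Ico 1 M, |spaceOp α d₁ d₂ dα h M V j -
      avg d₁ d₂ h (fun i => S (t - τ / 2) (a + i * h)) j| ≤ Cs * B₁ * h ^ 4 := k2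
  linarith

/-- The error satisfies the scheme with the truncation error as residual and starts from zero, so
`exists_stability` applies with F of size τ² + h⁴. -/
theorem exists_convergence {α d₁ d₂ dα a b T : ℝ} {φ : ℝ → ℝ} {s u : ℝ → ℝ → ℝ} (h0 : 0 < α)
    (hα : α ≤ alphaMax) (hd₁ : 0 < d₁) (hd₂ : 0 < d₂) (hdα : 0 < dα) (hab : a < b) (hT : 0 < T)
    (hu : IsRegularSolution α d₁ d₂ dα a b T φ s u) :
    ∃ C : ℝ, ∀ M N : ℕ, 0 < M → 0 < N → ∀ U : ℕ → ℤ → ℝ,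
      IsSchemeSolution α d₁ d₂ dα (T / N) ((b - a) / M) M N
        (fun k j => s (a + j * ((b - a) / M)) (((k : ℝ) + 1 / 2) * (T / N))) U →
      (∀ j : ℕ, j ≤ M → U 0 j = φ (a + j * ((b - a) / M))) →
      ∀ k ≤ N, gridNorm ((b - a) / M) M
          (fun j => u (a + j * ((b - a) / M)) (k * (T / N)) - U k j) ≤
        C * ((T / N) ^ 2 + ((b - a) / M) ^ 4) := by
  obtain ⟨C₁, hC₁, hres⟩ := exists_residual_le h0 (hα.trans_lt alphaMax_lt_one) hd₁ hd₂ hab hT hu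
  obtain ⟨C₂, hC₂, hstab⟩ := exists_stability h0 hα hd₁ hd₂ hdα (sub_pos.2 hab) hT
  refine ⟨C₂ * C₁, fun M N hM hN U hU hU0 k hk => ?_⟩
  have hMpos : (0 : ℝ) < M := by exact_mod_cast hM
  have hMh : M * ((b - a) / M) = b - a := mul_div_cancel₀ _ hMpos.ne'
  have hh : 0 < (b - a) / M := div_pos (sub_pos.2 hab) hMpos
  have hr : ∀ k : ℕ, ∃ f : ℕ → ℝ, k < N → IsStep α d₁ d₂ dα (T / N) ((b - a) / M) M f
        (gridFun a ((b - a) / M) M fun x => u x ((k + 1 : ℕ) * (T / N)))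
        (gridFun a ((b - a) / M) M fun x => u x (k * (T / N))) ∧
      (b - a) / M * ∑ j ∈ Finset.Ico 1 M, |f j - avg d₁ d₂ ((b - a) / M)
        (fun j : ℤ => s (a + j * ((b - a) / M)) (((k : ℝ) + 1 / 2) * (T / N))) j| ≤
        C₁ * ((T / N) ^ 2 + ((b - a) / M) ^ 4) := by
    intro k
    by_cases hk : k < N
    · obtain ⟨f, hf⟩ := hres M N hM hN k hk
      exact ⟨f, fun _ => hf⟩
    · exact ⟨0, fun h => absurd h hk⟩
  choose f hf using hr
  set h := (b - a) / M
  set τ := T / N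
  let V : ℕ → ℤ → ℝ := fun k => gridFun a h M fun x => u x (k * τ)
  have hV : ∀ k (j : ℕ), j ∈ Finset.Ico 1 M → V k j = u (a + ((j : ℤ) : ℝ) * h) (k * τ) := by
    intro k j hj
    have := Finset.mem_Ico.1 hj
    exact if_pos (by omega)
  have key := hstab M N (fun k j => V k j - U k j)
    (fun k j => f k j - avg d₁ d₂ h (fun j : ℤ => s (a + j * h) (((k : ℝ) + 1 / 2) * τ)) j)
    (C₁ * (τ ^ 2 + h ^ 4)) hM hN (by positivity)
    (fun k hk j hj => by
      simp only
      rw [hU.1 k hk j hj, show V k j = 0 from gridFun_zeroBoundary _ _ _ _ j hj, sub_zero])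
    (fun k hk => (hf k hk).1.sub (isStep_iff.2 (hU.2 k hk)))
    (fun k hk => (hf k hk).2) k hk
  have e0 : (gridNorm h M fun j => V 0 j - U 0 j) = 0 := by
    rw [gridNorm, Finset.sum_eq_zero, mul_zero, Real.sqrt_zero]
    intro j hj
    have hj' := Finset.mem_Ico.1 hj
    have hx : a + (j : ℝ) * h ∈ Set.Icc a b := by
      have h1 : (j : ℝ) ≤ M := by exact_mod_cast hj'.2.le
      have := mul_le_mul_of_nonneg_right h1 hh.le
      have : 0 ≤ j * h := by positivity
      exact ⟨by linarith, by linarith⟩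
    rw [hV 0 j hj, hU0 j hj'.2.le, ← hu.initial _ hx]
    simp
  have e1 : (gridNorm h M fun j => V k j - U k j) =
      gridNorm h M fun j => u (a + j * h) (k * τ) - U k j := by
    rw [gridNorm, gridNorm]
    congr 2
    refine Finset.sum_congr rfl fun j hj => ?_
    rw [hV k j hj]
  rw [e0, e1, zero_add] at key
  refine key.trans (le_of_eq ?_)
  ring

end RieszDiffusion
end

theorem mainTheorem4 (α d₁ d₂ dα : ℝ) (hα : 0 < α) (hα' : α ≤ RieszDiffusion.alphaMax)
    (hd₁ : 0 < d₁) (hd₂ : 0 < d₂) (hdα : 0 < dα) :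
    -- the series in the error equation converge absolutely
    Summable (fun l : ℕ => |RieszDiffusion.weight α l|) ∧
    -- von Neumann stability for all step sizes
    (∀ τ h : ℝ, 0 < τ → 0 < h → ∀ θ ∈ Set.Icc (-Real.pi) Real.pi,
      (∃! ξ : ℂ, RieszDiffusion.IsFourierMode α d₁ d₂ dα τ h θ ξ) ∧
      ∀ ξ : ℂ, RieszDiffusion.IsFourierMode α d₁ d₂ dα τ h θ ξ → ‖ξ‖ ≤ 1) ∧
    ∀ a b T : ℝ, a < b → 0 < T →
      -- solvability of the scheme on every grid
      (∀ M N : ℕ, 0 < M → 0 < N → ∀ (S : ℕ → ℤ → ℝ) (v : ℤ → ℝ),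
        RieszDiffusion.ZeroBoundary M v →
        ∃ U : ℕ → ℤ → ℝ,
          RieszDiffusion.IsSchemeSolution α d₁ d₂ dα (T / N) ((b - a) / M) M N S U ∧ U 0 = v) ∧
      -- stability with respect to the initial values, uniformly in all grids
      (∃ C : ℝ, ∀ M N : ℕ, 0 < M → 0 < N → ∀ S U V : ℕ → ℤ → ℝ,
        RieszDiffusion.IsSchemeSolution α d₁ d₂ dα (T / N) ((b - a) / M) M N S U →
        RieszDiffusion.IsSchemeSolution α d₁ d₂ dα (T / N) ((b - a) / M) M N S V →
        ∀ k ≤ N,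
          RieszDiffusion.gridNorm ((b - a) / M) M (fun j => U k j - V k j) ≤
            C * RieszDiffusion.gridNorm ((b - a) / M) M (fun j => U 0 j - V 0 j)) ∧
      -- convergence of order `τ² + h⁴`, uniformly in all grids
      (∀ (φ : ℝ → ℝ) (s u : ℝ → ℝ → ℝ),
        RieszDiffusion.IsRegularSolution α d₁ d₂ dα a b T φ s u →
        ∃ C : ℝ, ∀ M N : ℕ, 0 < M → 0 < N → ∀ U : ℕ → ℤ → ℝ,
          RieszDiffusion.IsSchemeSolution α d₁ d₂ dα (T / N) ((b - a) / M) M N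
            (fun k j => s (a + j * ((b - a) / M)) (((k : ℝ) + 1 / 2) * (T / N))) U →
          (∀ j : ℕ, j ≤ M → U 0 j = φ (a + j * ((b - a) / M))) →
          ∀ k ≤ N,
            RieszDiffusion.gridNorm ((b - a) / M) M
                (fun j => u (a + j * ((b - a) / M)) (k * (T / N)) - U k j) ≤
              C * ((T / N) ^ 2 + ((b - a) / M) ^ 4)) := by
  have h1 := hα'.trans_lt RieszDiffusion.alphaMax_lt_one
  refine ⟨RieszDiffusion.summable_abs_weight hα h1, fun τ h hτ hh θ _ => ?_,
    fun a b T hab hT => ⟨fun M N hM hN S v hv => ?_, ?_, fun φ s u hu => ?_⟩⟩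
  · exact RieszDiffusion.fourierMode_stability hα hα' hd₂ hdα hτ hh θ
  · have hMpos : (0 : ℝ) < M := by exact_mod_cast hM
    have hNpos : (0 : ℝ) < N := by exact_mod_cast hN
    exact RieszDiffusion.exists_isSchemeSolution hα hα' hd₂ hdα (div_pos hT hNpos)
      (div_pos (sub_pos.2 hab) hMpos) hM N S hv
  · exact RieszDiffusion.exists_grid_stability hα hα' hd₁ hd₂ hdα (sub_pos.2 hab) hT
  · exact RieszDiffusion.exists_convergence hα hα' hd₁ hd₂ hdα hab hT hu
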